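/- **Setting.** Let $n\ge 1$, $N\ge 0$, $m\ge 1$ be integers, $0<\gamma\le 1/4$, $0<\lambda\le\Lambda$ and $M$ be real numbers. Write $x=(x^1,x')\in\mathbb R\times\mathbb R^{n-1}$, let $Q_r=\{x:\max_i|x^i|<r\}$ and $Q_r'=\{x':\max_{i\ge2}|x^i|<r\}$. For a function $f$ on a set $S$ put $\|f\|_{C^{l,\gamma}(S)}=\sum_{j\le l}\sup_S|D^jf|+[D^lf]_{C^\gamma(S)}$ (derivatives relative to $S$), and write $f\in C^{l,\gamma}(S)$ if $f$ is $C^l$ on $S$ and this norm is finite. Let $K=\{k_-,\dots,k_+\}\subset\mathbb Z$, $K_+=K\cup\{k_++1\}$, and let $\varphi_k$ $(k\in K_+)$ be functions on $\mathbb R^{n-1}$ with $\varphi_k<\varphi_{k+1}$ on $Q_7'$ $(k\in K)$ such that $Q_7$ is the disjoint union of the sets $Q_7^k$, $k\in K$, where $$Q_r^k=\{x\in Q_r:\varphi_k(x')<x^1\le\varphi_{k+1}(x')\}.$$ Assume $\varphi_k\in C^{m+1,\gamma}(Q_7')$ with $\|\varphi_k\|_{C^{m+1,\gamma}(Q_7')}\le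 M$ and $|D\varphi_k|\le\frac1{20n}$ on $Q_7'$, for $k\in K_+$. Let $A^{\alpha\beta,k}_{ij}\in C^{m,\gamma}(\mathbb R^n)$ $(1\le\alpha,\beta\le n,\ 1\le i,j\le N,\ k\in K)$ satisfy $\|A^{\alpha\beta,k}_{ij}\|_{C^{m,\gamma}(\mathbb R^n)}\le M$, $|A^{\alpha\beta,k}_{ij}|\le\Lambda$ and $\lambda|\zeta|^2\le\sum A^{\alpha\beta,k}_{ij}(x)\zeta^i_\alpha\zeta^j_\beta$ for all $x\in\mathbb R^n$, $\zeta\in\mathbb R^{Nn}$, and let $A^{\alpha\beta}_{ij}=\sum_kA^{\alpha\beta,k}_{ij}\chi_{Q_7^k}$. Let $u=(u^i)\in W^{1,2}(Q_7)$ be a weak solution of $$\sum_\alpha D_\alpha\Big[\sum_{j,\beta}A^{\alpha\beta}_{ij}D_\beta u^j\Big]=\sum_\alpha D_\alpha F^i_\alpha\quad\text{in }Q_7,\quad 1\le i\le N,$$ where $u,F\in C^{m,\gamma}(Q_7^k)$ for all $k\in K$, and assume that $u$ is of class $C^{m+1}$ on each $Q_5^k$ (up to the upper graph, which belongs to $Q_5^k$),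 so that $D^{m+1}u$ is defined on $Q_5$ (piecewise, one-sidedly on the graphs). Put $$E=\sum_{k\in K}\big[\|u\|_{C^{m,\gamma}(Q_7^k)}+\|F\|_{C^{m,\gamma}(Q_7^k)}\big].$$ **The functions $U^{p'}$.** Primes denote multi-indices $p'=(p_2,\dots,p_n)$; $D^{(a,s')}=D_1^aD_2^{s_2}\cdots D_n^{s_n}$; derivatives of $u$, $F$, $A$ are taken piecewise. On $Q_7^k$ let $T_k=\frac{x^1-\varphi_k(x')}{\varphi_{k+1}(x')-\varphi_k(x')}$, $\psi(x,t')=[\varphi_{k+1}(x'+t')-\varphi_{k+1}(x')]T_k+[\varphi_k(x'+t')-\varphi_k(x')](1-T_k)$, $\pi_1=-1$, $\pi_\alpha=D_\alpha\varphi_{k+1}(x')T_k+D_\alpha\varphi_k(x')(1-T_k)$ for $\alpha\ge2$, $\pi^{q'}=\pi_2^{q_2}\cdots\pi_n^{q_n}$, and for $\xi=(a,s')$ let $P^{p'}_\xi(x)=\binom{p'}{s'}\frac1{a!}\,\partial_{t'}^{p'-s'}[\psi(x,t')^a]\big|_{t'=0}$ ($=0$ unless $s'\le p'$); for $|\xi|\le|p'|-1$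 this is the coefficient of $D_\xi h(x)$ in the expansion of $\partial_{t'}^{p'}[h(x+(\psi(x,t'),t'))]|_{t'=0}$. Let $K_-$ be the set of $k\in K$ whose graph $\{(\varphi_k(x'),x'):x'\in Q_5'\}$ meets $Q_5$, let $H_k=1$ on $Q_7^l$ for $l\ge k$ and $H_k=0$ on $Q_7^l$ for $l<k$. For a piecewise defined function, $|_k$ denotes the continuous extension of it and of its derivatives from $Q_7^k$ to the closure. With $U^i_\alpha=\sum_{j,\beta}A^{\alpha\beta}_{ij}D_\beta u^j-F^i_\alpha$ put $$G_1^{i,p'}=\sum_{k\in K_-}\sum_{\alpha=1}^n g^{p',k}_\alpha\big[U^i_\alpha|_{k-1}-U^i_\alpha|_k\big]H_k,\qquad G_\beta^{i,p'}=\sum_{k\in K_-}h^{p',k}_\beta\big[u^i|_{k-1}-u^i|_k\big]H_k\quad(\beta\ge2),$$ where $$g^{p',k}_\alpha[h](x')=\sum_{|\xi|\le|p'|-1}[\pi_\alpha P^{p'}_\xi D_\xi h](\varphi_k(x'),x')+\sum_{0'<q'\le p'}\binom{p'}{q'}D^{q'}D_\alpha\varphi_k(x')\,D^{p'-q'}[h(\varphi_k(x'),x')]$$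 (with $D_1\varphi_k=0$) and $$h^{p',k}_\beta[h](x')=\sum_{0'\le q'\le p'}\binom{p'}{q'}D_\beta\big[\pi^{q'}(\varphi_k(x'),x')\big]D^{(|q'|,p'-q')}h(\varphi_k(x'),x')+\sum_{|\xi|\le|p'|-1}D_\beta\big[P^{p'}_\xi(\varphi_k(x'),x')\,D_\xi h(\varphi_k(x'),x')\big].$$ For $|p'|=m$ define $U^{p'}=(U^{i,p'}_\alpha):Q_5\to\mathbb R^{Nn}$ by $$U_1^{i,p'}=G_1^{i,p'}+\sum_{\alpha=1}^n\pi_\alpha\sum_{0'\le q'\le p'}\binom{p'}{q'}\pi^{q'}D^{(|q'|,p'-q')}U^i_\alpha,$$ $$U_\beta^{i,p'}=G_\beta^{i,p'}+\sum_{0'\le q'\le p'}\binom{p'}{q'}\pi^{q'}\big[D^{(|q'|,p'-q')}D_\beta u^i+\pi_\beta D^{(|q'|,p'-q')}D_1u^i\big]\quad(\beta\ge2).$$ **Proposition.** There is a constant $c>0$ depending only on $n,N,m,\gamma,\lambda,\Lambda,M$ (in particular not on the number of graphs nor on the distance between them) such that in the above setting, for every $z\in Q_5$, $$|D^{m+1}u(z)|\le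 c\Big[E+\sum_{|p'|=m}|U^{p'}(z)|\Big]\qquad\text{and}\qquad E+\sum_{|p'|=m}|U^{p'}(z)|\le c\big[E+|D^{m+1}u(z)|\big],$$ and, for every $k\in K$ and all $w,z\in Q_5^k$, $$|D^{m+1}u(w)-D^{m+1}u(z)|\le c\sum_{|p'|=m}\Big[|U^{p'}(w)-U^{p'}(z)|+|w-z|^\gamma|U^{p'}(z)|\Big]+c\,|w-z|^\gamma E.$$ -/

import Mathlib

open MeasureTheory Set
open scoped NNReal ENNReal ContDiff

noncomputable section

namespace PiecewiseSmooth

/-- Euclidean space `ℝⁿ`. For `n = d + 1` the coordinate `0` is `x¹`, and the coordinates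
`b.succ`, `b : Fin d`, are `x², …, xⁿ`. -/
abbrev Pt (n : ℕ) := EuclideanSpace ℝ (Fin n)

/-- Matrix-valued data in `ℝ^{Nn}`, indexed by (component `i`, direction `α`). -/
abbrev Mat (N n : ℕ) := EuclideanSpace ℝ (Fin N × Fin n)

/-- The open cube of size `r` centred at the origin. -/
def cube (n : ℕ) (r : ℝ) : Set (Pt n) := {x | ∀ i, |x i| < r}

/-- The point `(t, x')`. -/
def pt {d : ℕ} (t : ℝ) (x' : Pt d) : Pt (d + 1) :=
  WithLp.toLp 2 (Fin.cons t (fun b => x' b) : Fin (d + 1) → ℝ)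

/-- The point `x'` of `x = (x¹, x')`. -/
def prime {d : ℕ} (x : Pt (d + 1)) : Pt d := WithLp.toLp 2 (fun b => x b.succ)

/-! ### Derivatives and Hölder norms -/

section Calculus

variable {n : ℕ} {V : Type*} [NormedAddCommGroup V] [NormedSpace ℝ V]

/-- The partial derivative `D_α f` relative to the set `S`. -/
def pd (S : Set (Pt n)) (α : Fin n) (f : Pt n → V) : Pt n → V :=
  fun x => fderivWithin ℝ f S x (EuclideanSpace.single α 1)

/-- `D^ξ f = D₁^{ξ₁} ⋯ D_n^{ξ_n} f` relative to the set `S`. -/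
def mpd (S : Set (Pt n)) (ξ : Fin n → ℕ) (f : Pt n → V) : Pt n → V :=
  (List.finRange n).foldr (fun α g => (pd S α)^[ξ α] g) f

/-- The norm `∑_{j ≤ m} sup_S |D^j f| + [D^m f]_{C^γ(S)}`, with values in `[0, ∞]`. -/
def holderENorm (m : ℕ) (γ : ℝ≥0) (S : Set (Pt n)) (f : Pt n → V) : ℝ≥0∞ :=
  (∑ j ∈ Finset.range (m + 1), ⨆ x ∈ S, ‖iteratedFDerivWithin ℝ j f S x‖ₑ) +
    eHolderNorm γ (S.domRestrict (iteratedFDerivWithin ℝ m f S))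

/-- `f ∈ C^{m,γ}(S)`. -/
def MemCHolder (m : ℕ) (γ : ℝ≥0) (S : Set (Pt n)) (f : Pt n → V) : Prop :=
  ContDiffOn ℝ m f S ∧ holderENorm m γ S f ≠ ⊤

end Calculus

/-- The multi-index `(a, s')`. -/
def mi {d : ℕ} (a : ℕ) (s : Fin d → ℕ) : Fin (d + 1) → ℕ := Fin.cons a s

/-- The order `|p'|` of a multi-index. -/
def order {d : ℕ} (p : Fin d → ℕ) : ℕ := ∑ b, p b

/-- The binomial coefficient of two multi-indices (zero unless `q ≤ p`). -/
def binom {d : ℕ} (p q : Fin d → ℕ) : ℝ := ∏ b, ((p b).choose (q b) : ℝ)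

/-! ### Composite cubes -/

/-- The index set `K = {lo, …, hi}` and the graph functions `φ k`
(those with `k ∈ {lo, …, hi + 1}` are relevant). -/
structure Graphs (d : ℕ) where
  lo : ℤ
  hi : ℤ
  φ : ℤ → Pt d → ℝ

namespace Graphs

variable {d : ℕ} (G : Graphs d)

/-- The index set `K` of the subregions. -/
def K : Finset ℤ := Finset.Icc G.lo G.hi

/-- The index set `K₊ = K ∪ {hi + 1}` of the graphs. -/
def Kplus : Finset ℤ := Finset.Icc G.lo (G.hi + 1)

/-- The subregion `Q_r^k`. -/
def strip (r : ℝ) (k : ℤ) : Set (Pt (d + 1)) :=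
  {x | x ∈ cube (d + 1) r ∧ G.φ k (prime x) < x 0 ∧ x 0 ≤ G.φ (k + 1) (prime x)}

/-- `(Q_r, {φ_k})` is a composite cube. -/
structure IsCompositeCube (r : ℝ) : Prop where
  mono : ∀ k ∈ G.K, ∀ x' ∈ cube d r, G.φ k x' ≤ G.φ (k + 1) x'
  cover : cube (d + 1) r = ⋃ k ∈ G.K, G.strip r k
  disjoint : (G.K : Set ℤ).PairwiseDisjoint (G.strip r)

/-- The point `(φ_k(x'), x')` of the `k`-th graph. -/
def graphPt (k : ℤ) (x' : Pt d) : Pt (d + 1) := pt (G.φ k x') x'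

open Classical in
/-- `K₋`: the indices in `K` of the graphs which intersect `Q₅`. -/
def Kminus : Finset ℤ :=
  G.K.filter fun k => ∃ x' ∈ cube d 5, G.graphPt k x' ∈ cube (d + 1) 5

/-- `∑_{k ∈ K} f_k χ_{Q₇^k}`: the function on `Q₇` that equals `f k` on `Q₇^k`. -/
def glue {V : Type*} [AddCommMonoid V] (f : ℤ → Pt (d + 1) → V) : Pt (d + 1) → V :=
  fun x => ∑ k ∈ G.K, (G.strip 7 k).indicator (f k) x

open Classical in
/-- The Heaviside function `H_k`. -/
def heaviside (k : ℤ) (x : Pt (d + 1)) : ℝ :=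
  if ∃ l ∈ G.K, k ≤ l ∧ x ∈ G.strip 7 l then 1 else 0

/-- `T_k(x) = (x¹ - φ_k(x')) / (φ_{k+1}(x') - φ_k(x'))`, used on `Q₇^k`. -/
def T (k : ℤ) (x : Pt (d + 1)) : ℝ :=
  (x 0 - G.φ k (prime x)) / (G.φ (k + 1) (prime x) - G.φ k (prime x))

/-- The flow `ψ(x, t')`. -/
def flow (x : Pt (d + 1)) (t' : Pt d) : ℝ :=
  G.glue (fun k y =>
    (G.φ (k + 1) (prime y + t') - G.φ (k + 1) (prime y)) * G.T k y
      + (G.φ k (prime y + t') - G.φ k (prime y)) * (1 - G.T k y)) x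

/-- `D_α φ_k` as a function of `x'`, for `1 ≤ α ≤ n`; it vanishes for `α = 1`. -/
def dφ (k : ℤ) (α : Fin (d + 1)) : Pt d → ℝ :=
  Fin.cases (fun _ => 0) (fun b => pd univ b (G.φ k)) α

/-- `π = (-1, π₂, …, π_n)`. -/
def vpi (α : Fin (d + 1)) (x : Pt (d + 1)) : ℝ :=
  Fin.cases (-1)
    (fun b => G.glue (fun k y =>
      G.dφ (k + 1) b.succ (prime y) * G.T k y
        + G.dφ k b.succ (prime y) * (1 - G.T k y)) x) α

/-- `π^{q'} = π₂^{q₂} ⋯ π_n^{q_n}`. -/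
def vpiPow (q : Fin d → ℕ) (x : Pt (d + 1)) : ℝ := ∏ b, G.vpi b.succ x ^ q b

/-- The coefficient `P_ξ^{p'}(x)` of `D_ξ h(x)`, `|ξ| ≤ |p'| - 1`, `ξ = (ξ₁, ξ')`, in the expansion
`∂_{t'}^{p'} [h(x + (ψ(x,t'), t'))] |_{t'=0}
  = ∑_{q' ≤ p'} (p' choose q') π^{q'} D^{(|q'|, p'-q')} h + ∑_{|ξ| ≤ |p'|-1} P_ξ^{p'} D_ξ h`.
Taylor expansion of `h` gives `P_ξ^{p'} = (p' choose ξ') ∂_{t'}^{p'-ξ'} [ψ(x,t')^{ξ₁}] |_{t'=0} / ξ₁!`,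
a polynomial in the `t'`-derivatives of `ψ` at `t' = 0`. -/
def P (p : Fin d → ℕ) (ξ : Fin (d + 1) → ℕ) (x : Pt (d + 1)) : ℝ :=
  binom p (Fin.tail ξ) / ((ξ 0).factorial : ℝ) *
    mpd univ (p - Fin.tail ξ) (fun t' => G.flow x t' ^ ξ 0) 0

/-- The value at `(φ_k(x'), x')` of the continuous extension of `f` from `Q₇^j` to its closure. -/
def trace (j k : ℤ) (f : Pt (d + 1) → ℝ) (x' : Pt d) : ℝ :=
  extendFrom (G.strip 7 j) f (G.graphPt k x')

/-- `(D_ξ h)(φ_k(x'), x')` for `h = f_{k-1}|_{k-1} - f_k|_k`, where `f_j` is a function on `Q₇^j`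
and `D_ξ f_j` is extended continuously from `Q₇^j` to its closure. -/
def jump (k : ℤ) (ξ : Fin (d + 1) → ℕ) (f : ℤ → Pt (d + 1) → ℝ) (x' : Pt d) : ℝ :=
  G.trace (k - 1) k (mpd (G.strip 7 (k - 1)) ξ (f (k - 1))) x'
    - G.trace k k (mpd (G.strip 7 k) ξ (f k)) x'

/-- The operator `g_α^{p',k}` applied to `h = f_{k-1}|_{k-1} - f_k|_k`. -/
def opg (p : Fin d → ℕ) (k : ℤ) (α : Fin (d + 1)) (f : ℤ → Pt (d + 1) → ℝ) (x' : Pt d) : ℝ :=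
  (∑ j ∈ Finset.range (order p), ∑ ξ ∈ Finset.piAntidiag (Finset.univ : Finset (Fin (d + 1))) j,
      G.vpi α (G.graphPt k x') * G.P p ξ (G.graphPt k x') * G.jump k ξ f x')
    + ∑ q ∈ Finset.Ioc 0 p,
        binom p q * mpd univ q (G.dφ k α) x' * mpd univ (p - q) (G.jump k 0 f) x'

/-- The operator `h_β^{p',k}`, `β ∈ {2, …, n}`, applied to `h = f_{k-1}|_{k-1} - f_k|_k`. -/
def oph (p : Fin d → ℕ) (k : ℤ) (b : Fin d) (f : ℤ → Pt (d + 1) → ℝ) (x' : Pt d) : ℝ :=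
  (∑ q ∈ Finset.Icc 0 p,
      binom p q * pd univ b (fun y' => G.vpiPow q (G.graphPt k y')) x'
        * G.jump k (mi (order q) (p - q)) f x')
    + ∑ j ∈ Finset.range (order p), ∑ ξ ∈ Finset.piAntidiag (Finset.univ : Finset (Fin (d + 1))) j,
        pd univ b (fun y' => G.P p ξ (G.graphPt k y') * G.jump k ξ f y') x'

end Graphs

/-! ### The elliptic system -/

/-- Coefficients `A k α β i j = A^{αβ,k}_{ij}`. -/
abbrev Coeff (N n : ℕ) := ℤ → Fin n → Fin n → Fin N → Fin N → Pt n → ℝ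

/-- `g` is the weak gradient of `u` in the open set `S`, `g x (i, α) = D_α uⁱ(x)`. -/
def IsWeakGradient {N n : ℕ} (S : Set (Pt n)) (u : Pt n → Pt N) (g : Pt n → Mat N n) : Prop :=
  ∀ (i : Fin N) (α : Fin n) (η : Pt n → ℝ), ContDiff ℝ ∞ η → HasCompactSupport η → tsupport η ⊆ S →
    ∫ x in S, u x i * fderiv ℝ η x (EuclideanSpace.single α 1) = - ∫ x in S, g x (i, α) * η x

/-- `u ∈ W^{1,2}(S)` is a weak solution of `D_α[A^{αβ}_{ij} D_β u^j] = D_α F_α^i` in `S`. -/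
def IsWeakSolution {N n : ℕ} (S : Set (Pt n)) (A : Fin n → Fin n → Fin N → Fin N → Pt n → ℝ)
    (F : Pt n → Mat N n) (u : Pt n → Pt N) : Prop :=
  ∃ g : Pt n → Mat N n,
    MemLp u 2 (volume.restrict S) ∧ MemLp g 2 (volume.restrict S) ∧ IsWeakGradient S u g ∧
    ∀ (i : Fin N) (η : Pt n → ℝ), ContDiff ℝ ∞ η → HasCompactSupport η → tsupport η ⊆ S →
      ∫ x in S, ∑ α, (∑ j, ∑ β, A α β i j x * g x (j, β)) * fderiv ℝ η x (EuclideanSpace.single α 1)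
        = ∫ x in S, ∑ α, F x (i, α) * fderiv ℝ η x (EuclideanSpace.single α 1)

namespace Graphs

variable {d N : ℕ} (G : Graphs d) (A : Coeff N (d + 1)) (F : Pt (d + 1) → Mat N (d + 1))
  (u : Pt (d + 1) → Pt N)

/-- `A^{αβ}_{ij} = ∑_k A^{αβ,k}_{ij} χ_{Q₇^k}`. -/
def coeff (α β : Fin (d + 1)) (i j : Fin N) : Pt (d + 1) → ℝ :=
  G.glue fun k => A k α β i j

/-- The flux `U_α^i = A^{αβ}_{ij} D_β u^j - F_α^i` on `Q₇^k`. -/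
def flux (i : Fin N) (α : Fin (d + 1)) (k : ℤ) (x : Pt (d + 1)) : ℝ :=
  (∑ j, ∑ β, A k α β i j x * pd (G.strip 7 k) β (fun y => u y j) x) - F x (i, α)

/-- `G^{i,p'}_α`. -/
def bigG (p : Fin d → ℕ) (i : Fin N) (α : Fin (d + 1)) (x : Pt (d + 1)) : ℝ :=
  Fin.cases
    (∑ k ∈ G.Kminus, ∑ α', G.opg p k α' (G.flux A F u i α') (prime x) * G.heaviside k x)
    (fun b => ∑ k ∈ G.Kminus, G.oph p k b (fun _ y => u y i) (prime x) * G.heaviside k x) α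

/-- `U^{i,p'}_α`. -/
def bigUComp (p : Fin d → ℕ) (i : Fin N) (α : Fin (d + 1)) (x : Pt (d + 1)) : ℝ :=
  G.bigG A F u p i α x +
  Fin.cases
    (∑ α', G.vpi α' x * ∑ q ∈ Finset.Icc 0 p, binom p q * G.vpiPow q x *
      G.glue (fun k => mpd (G.strip 7 k) (mi (order q) (p - q)) (G.flux A F u i α' k)) x)
    (fun b => ∑ q ∈ Finset.Icc 0 p, binom p q * G.vpiPow q x *
      (G.glue (fun k => mpd (G.strip 7 k) (mi (order q) (p - q))
          (pd (G.strip 7 k) b.succ fun y => u y i)) x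
        + G.vpi b.succ x * G.glue (fun k => mpd (G.strip 7 k) (mi (order q) (p - q))
          (pd (G.strip 7 k) 0 fun y => u y i)) x)) α

/-- `U^{p'} : Q₅ → ℝ^{Nn}`. -/
def bigU (p : Fin d → ℕ) (x : Pt (d + 1)) : Mat N (d + 1) :=
  WithLp.toLp 2 fun iα => G.bigUComp A F u p iα.1 iα.2 x

/-- The multi-indices `p'` with `|p'| = m`. -/
def idx (d m : ℕ) : Finset (Fin d → ℕ) := Finset.piAntidiag Finset.univ m

/-- `D^j u` on `Q₇`, computed on each `Q₇^k` relative to `Q₇^k` (so one-sided on the interfaces). -/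
def pieceDeriv (j : ℕ) : Pt (d + 1) → (Pt (d + 1) [×j]→L[ℝ] Pt N) :=
  G.glue fun k => iteratedFDerivWithin ℝ j u (G.strip 7 k)

/-- `E = ∑_{k ∈ K} (‖u‖_{C^{m,γ}(Q₇^k)} + ‖F‖_{C^{m,γ}(Q₇^k)})`. -/
def dataNorm (m : ℕ) (γ : ℝ≥0) : ℝ :=
  (∑ k ∈ G.K, (holderENorm m γ (G.strip 7 k) u + holderENorm m γ (G.strip 7 k) F)).toReal

end Graphs

end PiecewiseSmooth

end

open MeasureTheory Set
open scoped NNReal ENNReal ContDiff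

noncomputable section

namespace PiecewiseSmooth

/-! Fix a strip and let `theta` be the linear functional on polynomials which sends the monomial X^ξ
to D^ξ u^j(z). Treat the numbers π_b(z) as constants and put Y_b = X_b + π_b X_0, where X_0 stands
for D_1. Up to terms that are bounded and Hölder continuous with norm O(E), the component U_β^{p'}
with β ≥ 2 is `theta` of Y^{p'} Y_β, and U_1^{p'} is the sum of π_α A^{αβ} times `theta` of Y^{p'}
X_β. The whole statement is then linear algebra on polynomials of degree m + 1.

All purely tangential products Y^e are components of some U^{p'} (`normalCtrl_zero`). Writing X_β =
(X_β + π_β X_0) - π_β X_0 in U_1^{p'} leaves tangential terms and the matrix N_ij = ∑ π_α π_β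
A^{αβ}_ij acting on X_0 Y^{p'}. Since π_1 = -1, ellipticity tested on ζ_i π_α makes N coercive, so
X_0 Y^{p'} is controlled (`normalCtrl_one`). The differentiated equation, decomposed in the same
way, expresses N applied to X_0^{a+2} Y^e by products with fewer factors X_0 (`normalCtrl_add_two`).
Induction on a gives all X_0^a Y^e, and substituting X_b = Y_b - π_b X_0 recovers every derivative
of order m + 1 (`UCtrl.wd`). The reverse estimate reads the formulas for U^{p'} forwards
(`UCtrl.of_wd`).

Pointwise and Hölder estimates are proved at once: `Ctrl` bounds values by R₀ and differences by R₁,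
and is stable under multiplication by Hölder factors as soon as |w - z|^γ R₀(z) ≤ R₁(w, z).

The analytic content lies in the uniformity of the error terms. First, π involves T_k, whose slope
is of the size of the inverse thickness of the strip, but T_k is multiplied by the gradient of the
thickness, and a positive function with Lipschitz gradient has gradient at most a multiple of its
square root. Hence π is Hölder continuous with a constant independent of the thickness
(`abs_deriv_le_sqrt`, `uhb_vpi`). Secondly, a thin strip is not convex, but it is quasi-convex with
a fixed constant (`qc_mid`), so bounds on lower-order derivatives give Hölder bounds. Thirdly, the
jump terms G involve only traces of derivatives controlled by E. The contribution of one graph is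
bounded by the data norms of its two neighbouring strips, and the sum over all graphs by 2E
(`uhb_bigG`).

Uniformity of constants is encoded by families indexed by all possible data (`StripIdx`, `PlusIdx`,
`GraphIdx`): one constant for a whole family depends only on the fixed parameters. -/

section

/-! ### Iterated partial derivatives relative to a set, along words of directions. -/

section Words

variable {n : ℕ} {V : Type*} [NormedAddCommGroup V] [NormedSpace ℝ V]

/-- Iterated partial derivatives relative to `S` along a word of directions. -/
def wd (S : Set (Pt n)) (l : List (Fin n)) (f : Pt n → V) : Pt n → V :=
  l.foldr (fun α g => pd S α g) f

@[simp] theorem wd_nil (S : Set (Pt n)) (f : Pt n → V) : wd S [] f = f := rfl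

theorem wd_cons (S : Set (Pt n)) (α : Fin n) (l : List (Fin n)) (f : Pt n → V) :
    wd S (α :: l) f = pd S α (wd S l f) := rfl

theorem wd_append (S : Set (Pt n)) (l l' : List (Fin n)) (f : Pt n → V) :
    wd S (l ++ l') f = wd S l (wd S l' f) := by
  simp [wd, List.foldr_append]

theorem wd_concat (S : Set (Pt n)) (l : List (Fin n)) (α : Fin n) (f : Pt n → V) :
    wd S (l ++ [α]) f = wd S l (pd S α f) := by
  rw [wd_append]; rfl

/-- The word of a multi-index. -/
def word (ξ : Fin n → ℕ) : List (Fin n) :=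
  (List.finRange n).flatMap fun α => List.replicate (ξ α) α

theorem wd_replicate (S : Set (Pt n)) (k : ℕ) (α : Fin n) (f : Pt n → V) :
    wd S (List.replicate k α) f = (pd S α)^[k] f := by
  induction k with
  | zero => rfl
  | succ k ih => rw [List.replicate_succ, wd_cons, ih, Function.iterate_succ_apply']

/-- Words, unlike multi-indices, permit induction on one derivative at either end. The order of the
letters is dealt with once, in `wd_perm`. -/
theorem mpd_eq_wd (S : Set (Pt n)) (ξ : Fin n → ℕ) (f : Pt n → V) :
    mpd S ξ f = wd S (word ξ) f := by
  unfold mpd word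
  induction List.finRange n with
  | nil => rfl
  | cons α L ih => rw [List.foldr_cons, ih, List.flatMap_cons, wd_append, wd_replicate]

theorem count_word (ξ : Fin n → ℕ) (α : Fin n) : (word ξ).count α = ξ α := by
  unfold word
  rw [List.count_flatMap]
  have : (List.map (List.count α ∘ fun β => List.replicate (ξ β) β) (List.finRange n))
      = (List.finRange n).map fun β => if β = α then ξ α else 0 := by
    refine List.map_congr_left fun β _ => ?_
    simp only [Function.comp, List.count_replicate, beq_iff_eq]
    split_ifs with h <;> simp [h]
  rw [this, ← List.ofFn_eq_map, List.sum_ofFn]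
  simp

theorem length_word (ξ : Fin n → ℕ) : (word ξ).length = ∑ α, ξ α := by
  unfold word
  rw [List.length_flatMap, ← List.ofFn_eq_map, List.sum_ofFn]
  simp

theorem perm_word {l : List (Fin n)} {ξ : Fin n → ℕ} (h : ∀ α, l.count α = ξ α) :
    l.Perm (word ξ) := by
  rw [List.perm_iff_count]
  intro α
  rw [h, count_word]

theorem pd_congr {S : Set (Pt n)} {f g : Pt n → V} (h : EqOn f g S) (α : Fin n) :
    EqOn (pd S α f) (pd S α g) S := fun x hx => by
  simp only [pd, fderivWithin_congr h (h hx)]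

theorem wd_congr {S : Set (Pt n)} {f g : Pt n → V} (h : EqOn f g S) (l : List (Fin n)) :
    EqOn (wd S l f) (wd S l g) S := by
  induction l with
  | nil => exact h
  | cons α l ih => exact pd_congr ih α

theorem pd_inter {S O : Set (Pt n)} (hO : IsOpen O) (f : Pt n → V) (α : Fin n) :
    EqOn (pd (S ∩ O) α f) (pd S α f) (S ∩ O) := fun x hx => by
  simp only [pd, fderivWithin_inter (hO.mem_nhds hx.2)]

/-- A relative derivative depends only on the germ of the set, so no differentiability is needed, in
contrast to `wd_subset`. -/
theorem wd_inter {S O : Set (Pt n)} (hO : IsOpen O) (f : Pt n → V) (l : List (Fin n)) :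
    EqOn (wd (S ∩ O) l f) (wd S l f) (S ∩ O) := by
  induction l with
  | nil => exact fun x _ => rfl
  | cons α l ih =>
    intro x hx
    rw [wd_cons, wd_cons, pd_congr ih α hx, pd_inter hO _ _ hx]

theorem contDiffOn_pd {S : Set (Pt n)} (hS : UniqueDiffOn ℝ S) {f : Pt n → V} {j : ℕ}
    (hf : ContDiffOn ℝ (j + 1 : ℕ) f S) (α : Fin n) : ContDiffOn ℝ j (pd S α f) S := by
  have : ContDiffOn ℝ j (fderivWithin ℝ f S) S := hf.fderivWithin hS (by norm_cast)
  exact this.clm_apply contDiffOn_const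

theorem contDiffOn_wd {S : Set (Pt n)} (hS : UniqueDiffOn ℝ S) {f : Pt n → V} (l : List (Fin n))
    {j : ℕ} (hf : ContDiffOn ℝ (j + l.length : ℕ) f S) : ContDiffOn ℝ j (wd S l f) S := by
  induction l generalizing j with
  | nil => exact hf
  | cons α l ih =>
    refine contDiffOn_pd hS (ih ?_) α
    convert hf using 2
    simp only [List.length_cons]; ring

theorem pd_subset {S T : Set (Pt n)} (hS : UniqueDiffOn ℝ S) (hST : S ⊆ T) {f : Pt n → V}
    (hf : DifferentiableOn ℝ f T) (α : Fin n) : EqOn (pd S α f) (pd T α f) S := fun x hx => by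
  simp only [pd, fderivWithin_subset hST (hS x hx) (hf x (hST hx))]

theorem differentiableOn_wd {S : Set (Pt n)} (hS : UniqueDiffOn ℝ S) {f : Pt n → V}
    {l : List (Fin n)} {j : ℕ} (hf : ContDiffOn ℝ j f S) (hl : l.length < j) :
    DifferentiableOn ℝ (wd S l f) S := by
  have : ContDiffOn ℝ (1 : ℕ) (wd S l f) S :=
    contDiffOn_wd hS l (hf.of_le (by exact_mod_cast by omega))
  exact this.differentiableOn (by norm_num)

theorem wd_subset {S T : Set (Pt n)} (hS : UniqueDiffOn ℝ S) (hT : UniqueDiffOn ℝ T) (hST : S ⊆ T)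
    {f : Pt n → V} {j : ℕ} (hf : ContDiffOn ℝ j f T) {l : List (Fin n)} (hl : l.length ≤ j) :
    EqOn (wd S l f) (wd T l f) S := by
  induction l with
  | nil => exact fun x _ => rfl
  | cons α l ih =>
    intro x hx
    simp only [List.length_cons] at hl
    rw [wd_cons, wd_cons, pd_congr (ih (by omega)) α hx,
      pd_subset hS hST (differentiableOn_wd hT hf (by omega)) α hx]

theorem wd_eq_iteratedFDerivWithin {S : Set (Pt n)} (hS : UniqueDiffOn ℝ S) {f : Pt n → V} {j : ℕ}
    (hf : ContDiffOn ℝ j f S) {l : List (Fin n)} (hl : l.length ≤ j) {x : Pt n} (hx : x ∈ S) :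
    wd S l f x = iteratedFDerivWithin ℝ l.length f S x
      (fun i => EuclideanSpace.single (l.get i) 1) := by
  induction l generalizing x with
  | nil => simp
  | cons α l ih =>
    simp only [List.length_cons] at hl
    have hd : DifferentiableWithinAt ℝ (iteratedFDerivWithin ℝ l.length f S) S x :=
      (hf.differentiableOn_iteratedFDerivWithin (by exact_mod_cast hl) hS) x hx
    have h1 : EqOn (wd S l f) (fun y => iteratedFDerivWithin ℝ l.length f S y
      (fun i => EuclideanSpace.single (l.get i) 1)) S := fun y hy => ih (by omega) hy
    rw [wd_cons, pd_congr h1 α hx]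
    simp only [List.length_cons, iteratedFDerivWithin_succ_apply_left, pd]
    have h2 := ((ContinuousMultilinearMap.apply ℝ (fun _ : Fin l.length => Pt n) V
      (fun i => EuclideanSpace.single (l.get i) 1)).hasFDerivAt.comp_hasFDerivWithinAt x
        hd.hasFDerivWithinAt)
    have h3 := h2.fderivWithin (hS x hx)
    simp only [Function.comp_def, ContinuousMultilinearMap.apply_apply] at h3
    rw [h3]
    rfl

theorem pd_add {S : Set (Pt n)} (hS : UniqueDiffOn ℝ S) {f g : Pt n → V}
    (hf : DifferentiableOn ℝ f S) (hg : DifferentiableOn ℝ g S) (α : Fin n) :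
    EqOn (pd S α fun x => f x + g x) (fun x => pd S α f x + pd S α g x) S := fun x hx => by
  simp only [pd, fderivWithin_fun_add (hS x hx) (hf x hx) (hg x hx)]; rfl

theorem pd_sum {S : Set (Pt n)} (hS : UniqueDiffOn ℝ S) {ι : Type*} (s : Finset ι)
    {f : ι → Pt n → V} (hf : ∀ i ∈ s, DifferentiableOn ℝ (f i) S) (α : Fin n) :
    EqOn (pd S α fun x => ∑ i ∈ s, f i x) (fun x => ∑ i ∈ s, pd S α (f i) x) S := fun x hx => by
  simp only [pd, fderivWithin_fun_sum (hS x hx) fun i hi => hf i hi x hx,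
    sum_apply]

theorem pd_mul {S : Set (Pt n)} (hS : UniqueDiffOn ℝ S) {f g : Pt n → ℝ}
    (hf : DifferentiableOn ℝ f S) (hg : DifferentiableOn ℝ g S) (α : Fin n) :
    EqOn (pd S α fun x => f x * g x) (fun x => pd S α f x * g x + f x * pd S α g x) S :=
  fun x hx => by
  simp only [pd, fderivWithin_fun_mul (hS x hx) (hf x hx) (hg x hx)]
  simp [mul_comm, add_comm]

theorem pd_const {S : Set (Pt n)} (c : V) (α : Fin n) : pd S α (fun _ => c) = fun _ => 0 := by
  funext x; simp [pd]

theorem pd_clm {S : Set (Pt n)} (hS : UniqueDiffOn ℝ S) {W : Type*} [NormedAddCommGroup W]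
    [NormedSpace ℝ W] (L : V →L[ℝ] W) {f : Pt n → V} (hf : DifferentiableOn ℝ f S) (α : Fin n) :
    EqOn (pd S α fun x => L (f x)) (fun x => L (pd S α f x)) S := fun x hx => by
  have := (L.hasFDerivAt.comp_hasFDerivWithinAt x (hf x hx).hasFDerivWithinAt).fderivWithin
    (hS x hx)
  simp only [Function.comp_def] at this
  simp only [pd, this]; rfl

theorem wd_clm {S : Set (Pt n)} (hS : UniqueDiffOn ℝ S) {W : Type*} [NormedAddCommGroup W]
    [NormedSpace ℝ W] (L : V →L[ℝ] W) {f : Pt n → V} {l : List (Fin n)}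
    (hf : ContDiffOn ℝ l.length f S) :
    EqOn (wd S l fun x => L (f x)) (fun x => L (wd S l f x)) S := by
  induction l with
  | nil => exact fun x _ => rfl
  | cons α l ih =>
    intro x hx
    rw [wd_cons, pd_congr (ih (hf.of_le (by simp))) α hx,
      pd_clm hS L (differentiableOn_wd hS hf (by simp)) α hx]
    rfl

theorem wd_sum {S : Set (Pt n)} (hS : UniqueDiffOn ℝ S) {ι : Type*} (s : Finset ι)
    {f : ι → Pt n → V} {l : List (Fin n)} (hf : ∀ i ∈ s, ContDiffOn ℝ l.length (f i) S) :
    EqOn (wd S l fun x => ∑ i ∈ s, f i x) (fun x => ∑ i ∈ s, wd S l (f i) x) S := by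
  induction l with
  | nil => exact fun x _ => rfl
  | cons α l ih =>
    intro x hx
    rw [wd_cons, pd_congr (ih fun i hi => (hf i hi).of_le (by simp)) α hx,
      pd_sum hS s (fun i hi => differentiableOn_wd hS (hf i hi) (by simp)) α hx]
    rfl

theorem wd_add {S : Set (Pt n)} (hS : UniqueDiffOn ℝ S) {f g : Pt n → V} {l : List (Fin n)}
    (hf : ContDiffOn ℝ l.length f S) (hg : ContDiffOn ℝ l.length g S) :
    EqOn (wd S l fun x => f x + g x) (fun x => wd S l f x + wd S l g x) S := by
  have := wd_sum hS (Finset.univ : Finset Bool) (f := fun b => if b then f else g) (l := l)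
    (by intro b _; cases b <;> simpa)
  simpa using this

theorem wd_const_mul {S : Set (Pt n)} (hS : UniqueDiffOn ℝ S) (c : ℝ) {f : Pt n → ℝ}
    {l : List (Fin n)} (hf : ContDiffOn ℝ l.length f S) :
    EqOn (wd S l fun x => c * f x) (fun x => c * wd S l f x) S :=
  wd_clm hS (ContinuousLinearMap.mul ℝ ℝ c) hf

theorem wd_sub {S : Set (Pt n)} (hS : UniqueDiffOn ℝ S) {f g : Pt n → ℝ} {l : List (Fin n)}
    (hf : ContDiffOn ℝ l.length f S) (hg : ContDiffOn ℝ l.length g S) :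
    EqOn (wd S l fun x => f x - g x) (fun x => wd S l f x - wd S l g x) S := by
  intro x hx
  have h1 := wd_add hS hf (contDiffOn_const (c := (-1 : ℝ)) |>.mul hg) hx
  have h2 := wd_const_mul hS (-1) hg hx
  simp only [neg_mul, one_mul, ← sub_eq_add_neg] at h1 h2
  rw [h1, h2]; ring

/-- Symmetry of the second derivative is inherited from the interior, so it also holds at points of
the upper graph. -/
theorem pd_comm {S : Set (Pt n)} (hS : UniqueDiffOn ℝ S) (hcl : S ⊆ closure (interior S))
    {f : Pt n → V} (hf : ContDiffOn ℝ (2 : ℕ) f S) (α β : Fin n) :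
    EqOn (pd S α (pd S β f)) (pd S β (pd S α f)) S := by
  intro x hx
  have key : ∀ α β : Fin n, pd S α (pd S β f) x
      = fderivWithin ℝ (fderivWithin ℝ f S) S x (EuclideanSpace.single α 1)
        (EuclideanSpace.single β 1) := by
    intro α β
    have hd : DifferentiableWithinAt ℝ (fderivWithin ℝ f S) S x :=
      ((hf.fderivWithin (m := (1 : ℕ)) hS (by norm_cast)).differentiableOn (by norm_num)) x hx
    have := (hd.hasFDerivWithinAt.clm_apply (hasFDerivWithinAt_const
      (EuclideanSpace.single β (1 : ℝ)) x S)).fderivWithin (hS x hx)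
    rw [pd]
    unfold pd
    rw [this]
    simp
  rw [key, key]
  have hs := (hf x hx).isSymmSndFDerivWithinAt (by simp) hS (hcl hx) hx
  exact hs _ _

theorem wd_perm {S : Set (Pt n)} (hS : UniqueDiffOn ℝ S) (hcl : S ⊆ closure (interior S))
    {f : Pt n → V} {l l' : List (Fin n)} (h : l.Perm l') (hf : ContDiffOn ℝ l.length f S) :
    EqOn (wd S l f) (wd S l' f) S := by
  induction h with
  | nil => exact fun x _ => rfl
  | cons α _ ih => exact pd_congr (ih (hf.of_le (by simp))) α
  | swap α β l =>
    refine pd_comm hS hcl (contDiffOn_wd hS l ?_) β α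
    convert hf using 2
    simp only [List.length_cons]; ring
  | trans h1 _ ih1 ih2 => exact (ih1 hf).trans (ih2 (h1.length_eq ▸ hf))

end Words

end

section

/-! ### Hölder bounds that are uniform over a family of functions and sets. -/

section Families

/-- `|f| ≤ C` on `S` and `f` is `γ`-Hölder on `S` with constant `C`. -/
def HB {n : ℕ} (γ : ℝ) (S : Set (Pt n)) (C : ℝ) (f : Pt n → ℝ) : Prop :=
  (∀ x ∈ S, |f x| ≤ C) ∧ ∀ x ∈ S, ∀ y ∈ S, |f x - f y| ≤ C * ‖x - y‖ ^ γ

theorem HB.uniformContinuousOn {n : ℕ} {γ : ℝ} (hγ : 0 < γ) {S : Set (Pt n)} {C : ℝ} {f : Pt n → ℝ}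
    (h : HB γ S C f) : UniformContinuousOn f S := by
  have hH : HolderOnWith (Real.toNNReal C) (Real.toNNReal γ) f S := by
    intro x hx y hy
    rw [edist_dist, edist_dist, Real.coe_toNNReal _ hγ.le, ENNReal.ofReal_rpow_of_nonneg dist_nonneg
      hγ.le]
    change _ ≤ ENNReal.ofReal C * _
    rw [← ENNReal.ofReal_mul' (by positivity)]
    refine ENNReal.ofReal_le_ofReal ?_
    rw [Real.dist_eq, dist_eq_norm]
    exact h.2 x hx y hy
  exact hH.uniformContinuousOn (by simpa using hγ)

theorem HB.congr {n : ℕ} {γ : ℝ} {S : Set (Pt n)} {C : ℝ} {f g : Pt n → ℝ}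
    (h : HB γ S C f) (e : EqOn g f S) : HB γ S C g :=
  ⟨fun x hx => by rw [e hx]; exact h.1 x hx,
    fun x hx y hy => by rw [e hx, e hy]; exact h.2 x hx y hy⟩

variable {n : ℕ} {I : Type*} {γ : ℝ} {S : I → Set (Pt n)} {w : I → ℝ} {f g : I → Pt n → ℝ}

/-- The functions `f i` are `γ`-Hölder on `S i`, with norm at most a uniform multiple of `w i`. -/
def UHB (γ : ℝ) (S : I → Set (Pt n)) (w : I → ℝ) (f : I → Pt n → ℝ) : Prop :=
  ∃ C : ℝ, 0 ≤ C ∧ ∀ i, HB γ (S i) (C * w i) (f i)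

theorem UHB.congr (h : UHB γ S w f) (e : ∀ i, EqOn (g i) (f i) (S i)) : UHB γ S w g := by
  obtain ⟨C, hC, h⟩ := h
  exact ⟨C, hC, fun i => (h i).congr (e i)⟩

theorem UHB.mono_weight {w' : I → ℝ} (h : UHB γ S w f) (hw : ∀ i, w i ≤ w' i) : UHB γ S w' f := by
  obtain ⟨C, hC, h⟩ := h
  have hw' : ∀ i, C * w i ≤ C * w' i := fun i => mul_le_mul_of_nonneg_left (hw i) hC
  exact ⟨C, hC, fun i => ⟨fun x hx => ((h i).1 x hx).trans (hw' i), fun x hx y hy =>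
    ((h i).2 x hx y hy).trans (mul_le_mul_of_nonneg_right (hw' i) (by positivity))⟩⟩

theorem UHB.comp_index {J : Type*} (h : UHB γ S w f) (e : J → I) :
    UHB γ (fun j => S (e j)) (fun j => w (e j)) fun j => f (e j) := by
  obtain ⟨C, hC, h⟩ := h
  exact ⟨C, hC, fun j => h (e j)⟩

theorem UHB.subset {T : I → Set (Pt n)} (h : UHB γ S w f) (hT : ∀ i, T i ⊆ S i) :
    UHB γ T w f := by
  obtain ⟨C, hC, h⟩ := h
  exact ⟨C, hC, fun i => ⟨fun x hx => (h i).1 x (hT i hx),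
    fun x hx y hy => (h i).2 x (hT i hx) y (hT i hy)⟩⟩

theorem UHB.zero : UHB γ S w fun _ _ => 0 :=
  ⟨0, le_rfl, fun i => ⟨by simp, by simp⟩⟩

theorem UHB.const (c : ℝ) : UHB γ S (fun _ => 1) fun _ _ => c :=
  ⟨|c|, abs_nonneg c, fun i => ⟨by simp, fun x _ y _ => by simp; positivity⟩⟩

theorem UHB.add (hf : UHB γ S w f) (hg : UHB γ S w g) : UHB γ S w fun i x => f i x + g i x := by
  obtain ⟨C, hC, hf⟩ := hf
  obtain ⟨D, hD, hg⟩ := hg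
  refine ⟨C + D, by positivity, fun i => ⟨fun x hx => ?_, fun x hx y hy => ?_⟩⟩
  · have := abs_add_le (f i x) (g i x)
    linarith [(hf i).1 x hx, (hg i).1 x hx]
  · have := abs_add_le (f i x - f i y) (g i x - g i y)
    rw [show f i x + g i x - (f i y + g i y) = (f i x - f i y) + (g i x - g i y) by ring]
    linarith [(hf i).2 x hx y hy, (hg i).2 x hx y hy]

theorem UHB.sum {ι : Type*} (s : Finset ι) {F : ι → I → Pt n → ℝ}
    (hF : ∀ j ∈ s, UHB γ S w (F j)) : UHB γ S w fun i x => ∑ j ∈ s, F j i x := by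
  classical
  induction s using Finset.induction_on with
  | empty => simpa using UHB.zero
  | insert a s ha ih =>
    have := (hF a (Finset.mem_insert_self a s)).add
      (ih fun j hj => hF j (Finset.mem_insert_of_mem hj))
    simpa only [Finset.sum_insert ha] using this

theorem UHB.mul {a : I → Pt n → ℝ} (ha : UHB γ S (fun _ => 1) a) (hf : UHB γ S w f) :
    UHB γ S w fun i x => a i x * f i x := by
  obtain ⟨C, hC, ha⟩ := ha
  obtain ⟨D, hD, hf⟩ := hf
  simp only [mul_one] at ha
  refine ⟨2 * C * D, by positivity, fun i => ⟨fun x hx => ?_, fun x hx y hy => ?_⟩⟩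
  · have h1 := mul_le_mul ((ha i).1 x hx) ((hf i).1 x hx) (abs_nonneg _) hC
    have h2 := (abs_nonneg _).trans ((abs_mul _ _).le.trans h1)
    rw [abs_mul]; linarith
  · have h1 := mul_le_mul ((ha i).1 x hx) ((hf i).2 x hx y hy) (abs_nonneg _) hC
    have h2 := mul_le_mul ((ha i).2 x hx y hy) ((hf i).1 y hy) (abs_nonneg _) (by positivity)
    rw [← abs_mul] at h1 h2
    have h3 := abs_add_le (a i x * (f i x - f i y)) ((a i x - a i y) * f i y)
    rw [show a i x * f i x - a i y * f i y
      = a i x * (f i x - f i y) + (a i x - a i y) * f i y by ring]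
    linarith

theorem UHB.const_mul (c : ℝ) (hf : UHB γ S w f) : UHB γ S w fun i x => c * f i x :=
  UHB.mul (a := fun _ _ => c) (UHB.const c) hf

theorem UHB.neg (hf : UHB γ S w f) : UHB γ S w fun i x => - f i x := by
  simpa using hf.const_mul (-1)

theorem UHB.sub (hf : UHB γ S w f) (hg : UHB γ S w g) : UHB γ S w fun i x => f i x - g i x := by
  simpa only [sub_eq_add_neg] using hf.add hg.neg

theorem UHB.pow (hf : UHB γ S (fun _ => 1) f) (k : ℕ) :
    UHB γ S (fun _ => 1) fun i x => f i x ^ k := by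
  induction k with
  | zero => simpa using UHB.const 1
  | succ k ih => simpa only [pow_succ] using ih.mul hf

theorem UHB.prod {ι : Type*} (s : Finset ι) {F : ι → I → Pt n → ℝ}
    (hF : ∀ j ∈ s, UHB γ S (fun _ => 1) (F j)) :
    UHB γ S (fun _ => 1) fun i x => ∏ j ∈ s, F j i x := by
  classical
  induction s using Finset.induction_on with
  | empty => simpa using UHB.const 1
  | insert a s ha ih =>
    have := (hF a (Finset.mem_insert_self a s)).mul
      (ih fun j hj => hF j (Finset.mem_insert_of_mem hj))
    simpa only [Finset.prod_insert ha] using this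

/-- Uniform `C^{j,γ}` bounds: all iterated partial derivatives of order at most `j` of `f i`
relative to `S i` satisfy `UHB`. -/
def UC (γ : ℝ) (S : I → Set (Pt n)) (w : I → ℝ) : ℕ → (I → Pt n → ℝ) → Prop
  | 0, f => UHB γ S w f
  | j + 1, f => UHB γ S w f ∧ (∀ i, DifferentiableOn ℝ (f i) (S i)) ∧
      ∀ α, UC γ S w j fun i => pd (S i) α (f i)

theorem UC.uhb {j : ℕ} (h : UC γ S w j f) : UHB γ S w f := by
  cases j with
  | zero => exact h
  | succ j => exact h.1

theorem UC.pred {j : ℕ} (h : UC γ S w (j + 1) f) : UC γ S w j f := by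
  induction j generalizing f with
  | zero => exact h.1
  | succ j ih => exact ⟨h.1, h.2.1, fun α => ih (h.2.2 α)⟩

theorem UC.of_le {j k : ℕ} (h : UC γ S w k f) (hjk : j ≤ k) : UC γ S w j f := by
  induction hjk with
  | refl => exact h
  | step _ ih => exact ih h.pred

theorem UC.congr {j : ℕ} (h : UC γ S w j f) (e : ∀ i, EqOn (g i) (f i) (S i)) :
    UC γ S w j g := by
  induction j generalizing f g with
  | zero => exact UHB.congr h e
  | succ j ih =>
    exact ⟨h.1.congr e, fun i => (h.2.1 i).congr (e i), fun α => ih (h.2.2 α) fun i =>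
      pd_congr (e i) α⟩

theorem UC.wd {j : ℕ} (l : List (Fin n)) (h : UC γ S w (j + l.length) f) :
    UC γ S w j fun i => wd (S i) l (f i) := by
  induction l generalizing j with
  | nil => exact h
  | cons α l ih => exact (ih (j := j + 1) (by
      convert h using 1; simp only [List.length_cons]; ring)).2.2 α

theorem UC.comp_index {J : Type*} {j : ℕ} (h : UC γ S w j f) (e : J → I) :
    UC γ (fun j => S (e j)) (fun j => w (e j)) j fun j => f (e j) := by
  induction j generalizing f with
  | zero => exact UHB.comp_index h e
  | succ j ih => exact ⟨h.1.comp_index e, fun i => h.2.1 (e i), fun α => ih (h.2.2 α)⟩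

theorem UC.mono_weight {j : ℕ} {w' : I → ℝ} (h : UC γ S w j f) (hw : ∀ i, w i ≤ w' i) :
    UC γ S w' j f := by
  induction j generalizing f with
  | zero => exact UHB.mono_weight h hw
  | succ j ih => exact ⟨h.1.mono_weight hw, h.2.1, fun α => ih (h.2.2 α)⟩

theorem UC.of_words {j : ℕ}
    (h : ∀ l : List (Fin n), l.length ≤ j → UHB γ S w fun i => PiecewiseSmooth.wd (S i) l (f i))
    (hd : ∀ l : List (Fin n), l.length < j →
      ∀ i, DifferentiableOn ℝ (PiecewiseSmooth.wd (S i) l (f i)) (S i)) : UC γ S w j f := by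
  induction j generalizing f with
  | zero => exact h [] le_rfl
  | succ j ih =>
    refine ⟨h [] (Nat.zero_le _), hd [] (Nat.succ_pos _), fun α => ih (fun l hl => ?_)
      fun l hl i => ?_⟩
    · have := h (l ++ [α]) (by simpa using hl)
      simpa only [wd_concat] using this
    · have := hd (l ++ [α]) (by simpa using hl) i
      simpa only [wd_concat] using this

theorem UC.subset {j : ℕ} {T : I → Set (Pt n)} (hT : ∀ i, UniqueDiffOn ℝ (T i))
    (hTS : ∀ i, T i ⊆ S i) (h : UC γ S w j f) : UC γ T w j f := by
  induction j generalizing f with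
  | zero => exact UHB.subset h hTS
  | succ j ih =>
    exact ⟨h.1.subset hTS, fun i => (h.2.1 i).mono (hTS i), fun α => (ih (h.2.2 α)).congr fun i =>
      pd_subset (hT i) (hTS i) (h.2.1 i) α⟩

theorem UC.zero {j : ℕ} : UC γ S w j fun _ _ => 0 := by
  induction j with
  | zero => exact UHB.zero
  | succ j ih =>
    refine ⟨UHB.zero, fun i => differentiableOn_const 0, fun α => ?_⟩
    simpa only [pd_const] using ih

theorem UC.const {j : ℕ} (c : ℝ) : UC γ S (fun _ => 1) j fun _ _ => c := by
  cases j with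
  | zero => exact UHB.const c
  | succ j =>
    refine ⟨UHB.const c, fun i => differentiableOn_const c, fun α => ?_⟩
    simpa only [pd_const] using UC.zero

theorem UC.add (hS : ∀ i, UniqueDiffOn ℝ (S i)) {j : ℕ} (hf : UC γ S w j f) (hg : UC γ S w j g) :
    UC γ S w j fun i x => f i x + g i x := by
  induction j generalizing f g with
  | zero => exact UHB.add hf hg
  | succ j ih =>
    exact ⟨hf.1.add hg.1, fun i => (hf.2.1 i).add (hg.2.1 i), fun α =>
      (ih (hf.2.2 α) (hg.2.2 α)).congr fun i => pd_add (hS i) (hf.2.1 i) (hg.2.1 i) α⟩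

theorem UC.sum (hS : ∀ i, UniqueDiffOn ℝ (S i)) {j : ℕ} {ι : Type*} (s : Finset ι)
    {F : ι → I → Pt n → ℝ}
    (hF : ∀ k ∈ s, UC γ S w j (F k)) : UC γ S w j fun i x => ∑ k ∈ s, F k i x := by
  classical
  induction s using Finset.induction_on with
  | empty => simpa using UC.zero
  | insert a s ha ih =>
    have := (hF a (Finset.mem_insert_self a s)).add hS
      (ih fun j hj => hF j (Finset.mem_insert_of_mem hj))
    simpa only [Finset.sum_insert ha] using this

theorem UC.mul (hS : ∀ i, UniqueDiffOn ℝ (S i)) {j : ℕ} (hf : UC γ S (fun _ => 1) j f)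
    (hg : UC γ S w j g) : UC γ S w j fun i x => f i x * g i x := by
  induction j generalizing f g with
  | zero => exact UHB.mul hf hg
  | succ j ih =>
    exact ⟨hf.1.mul hg.1, fun i => (hf.2.1 i).mul (hg.2.1 i), fun α =>
      ((ih (hf.2.2 α) hg.pred).add hS (ih hf.pred (hg.2.2 α))).congr fun i =>
        pd_mul (hS i) (hf.2.1 i) (hg.2.1 i) α⟩

theorem UC.const_mul (hS : ∀ i, UniqueDiffOn ℝ (S i)) {j : ℕ} (c : ℝ) (hf : UC γ S w j f) :
    UC γ S w j fun i x => c * f i x :=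
  UC.mul hS (f := fun _ _ => c) (UC.const c) hf

theorem UC.neg (hS : ∀ i, UniqueDiffOn ℝ (S i)) {j : ℕ} (hf : UC γ S w j f) :
    UC γ S w j fun i x => - f i x := by
  simpa using hf.const_mul hS (-1)

theorem UC.sub (hS : ∀ i, UniqueDiffOn ℝ (S i)) {j : ℕ} (hf : UC γ S w j f) (hg : UC γ S w j g) :
    UC γ S w j fun i x => f i x - g i x := by
  simpa only [sub_eq_add_neg] using hf.add hS (hg.neg hS)

theorem UC.pow (hS : ∀ i, UniqueDiffOn ℝ (S i)) {j : ℕ} (hf : UC γ S (fun _ => 1) j f) (k : ℕ) :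
    UC γ S (fun _ => 1) j fun i x => f i x ^ k := by
  induction k with
  | zero => simpa using UC.const 1
  | succ k ih => simpa only [pow_succ] using ih.mul hS hf

theorem UC.prod (hS : ∀ i, UniqueDiffOn ℝ (S i)) {j : ℕ} {ι : Type*} (s : Finset ι)
    {F : ι → I → Pt n → ℝ} (hF : ∀ k ∈ s, UC γ S (fun _ => 1) j (F k)) :
    UC γ S (fun _ => 1) j fun i x => ∏ k ∈ s, F k i x := by
  classical
  induction s using Finset.induction_on with
  | empty => simpa using UC.const 1
  | insert a s ha ih =>
    have := (hF a (Finset.mem_insert_self a s)).mul hS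
      (ih fun j hj => hF j (Finset.mem_insert_of_mem hj))
    simpa only [Finset.prod_insert ha] using this

/-- The commutator of a top-order derivative with multiplication is of lower order. -/
theorem UHB.commutator (hS : ∀ i, UniqueDiffOn ℝ (S i))
    {a : I → Pt n → ℝ} (l : List (Fin n)) (ha : UC γ S (fun _ => 1) l.length a)
    (hf : ∀ j < l.length, UC γ S w j f)
    (hac : ∀ i, ContDiffOn ℝ l.length (a i) (S i)) (hfc : ∀ i, ContDiffOn ℝ l.length (f i) (S i)) :
    UHB γ S w fun i x => wd (S i) l (fun y => a i y * f i y) x - a i x * wd (S i) l (f i) x := by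
  induction l using List.reverseRecOn generalizing a f with
  | nil => simpa using UHB.zero
  | append_singleton l α ih =>
    simp only [List.length_append, List.length_singleton] at ha hf hac hfc
    have hfd : ∀ i, DifferentiableOn ℝ (f i) (S i) := fun i =>
      (hfc i).differentiableOn (by simp)
    have had : ∀ i, DifferentiableOn ℝ (a i) (S i) := fun i =>
      (hac i).differentiableOn (by simp)
    have hac' : ∀ i, ContDiffOn ℝ l.length (a i) (S i) := fun i => (hac i).of_le (by simp)
    have hfc' : ∀ i, ContDiffOn ℝ l.length (f i) (S i) := fun i => (hfc i).of_le (by simp)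
    have hap : ∀ i, ContDiffOn ℝ l.length (pd (S i) α (a i)) (S i) := fun i =>
      contDiffOn_pd (hS i) (hac i) α
    have hfp : ∀ i, ContDiffOn ℝ l.length (pd (S i) α (f i)) (S i) := fun i =>
      contDiffOn_pd (hS i) (hfc i) α
    -- The Leibniz rule is applied to the innermost derivative. When it falls on `a`, only
    -- `l.length` derivatives are left for `f`. The other term is the induction hypothesis for `pd α
    -- f`. The top derivative of `f` is thus never estimated.
    have h1 : UHB γ S w fun i => wd (S i) l fun y => pd (S i) α (a i) y * f i y :=
      UC.wd (j := 0) l (by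
        rw [zero_add]
        exact (ha.2.2 α).mul hS (hf _ (by omega)))
    have h2 := ih ha.pred (f := fun i => pd (S i) α (f i))
      (fun j hj => (hf (j + 1) (by omega)).2.2 α) hac' hfp
    refine (h1.add h2).congr fun i x hx => ?_
    simp only [wd_concat]
    rw [wd_congr (pd_mul (hS i) (had i) (hfd i) α) l hx,
      wd_add (hS i) ((hap i).mul (hfc' i)) ((hac' i).mul (hfp i)) hx]
    ring

end Families

end

section

/-! ### The splitting x = (x¹, x') and cubes. -/

section Coordinates

variable {d : ℕ}

@[simp] theorem prime_pt (t : ℝ) (x' : Pt d) : prime (pt t x') = x' := by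
  ext b; simp [prime, pt]

@[simp] theorem pt_zero_apply (t : ℝ) (x' : Pt d) : pt t x' 0 = t := by simp [pt]

@[simp] theorem pt_succ_apply (t : ℝ) (x' : Pt d) (b : Fin d) : pt t x' b.succ = x' b := by
  simp [pt]

@[simp] theorem prime_apply (x : Pt (d + 1)) (b : Fin d) : prime x b = x b.succ := rfl

theorem pt_prime (x : Pt (d + 1)) : pt (x 0) (prime x) = x := by
  ext i; refine Fin.cases ?_ (fun b => ?_) i <;> simp

theorem norm_sq_eq_prime (x : Pt (d + 1)) : ‖x‖ ^ 2 = x 0 ^ 2 + ‖prime x‖ ^ 2 := by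
  simp [EuclideanSpace.norm_sq_eq, Fin.sum_univ_succ]

theorem norm_prime_le (x : Pt (d + 1)) : ‖prime x‖ ≤ ‖x‖ := by
  refine le_of_sq_le_sq ?_ (norm_nonneg x) |> fun h => h
  rw [norm_sq_eq_prime x]; nlinarith [sq_nonneg (x 0)]

theorem abs_apply_le {n : ℕ} (x : Pt n) (i : Fin n) : |x i| ≤ ‖x‖ := by
  simpa using PiLp.norm_apply_le x i

theorem norm_le_add_prime (x : Pt (d + 1)) : ‖x‖ ≤ |x 0| + ‖prime x‖ := by
  refine le_of_sq_le_sq ?_ (by positivity) |> fun h => h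
  rw [norm_sq_eq_prime x]
  nlinarith [sq_abs (x 0), abs_nonneg (x 0), norm_nonneg (prime x),
    mul_nonneg (abs_nonneg (x 0)) (norm_nonneg (prime x))]

/-- The projection `x ↦ x'` as a linear map. -/
def primeL (d : ℕ) : Pt (d + 1) →L[ℝ] Pt d :=
  LinearMap.mkContinuous
    { toFun := prime
      map_add' := fun x y => by ext b; simp
      map_smul' := fun c x => by ext b; simp } 1 (fun x => by simpa using norm_prime_le x)

@[simp] theorem primeL_apply (x : Pt (d + 1)) : primeL d x = prime x := rfl

theorem continuous_prime : Continuous (prime : Pt (d + 1) → Pt d) := (primeL d).continuous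

theorem prime_sub (x y : Pt (d + 1)) : prime (x - y) = prime x - prime y := (primeL d).map_sub x y

theorem norm_pt_zero (v : Pt d) : ‖pt 0 v‖ = ‖v‖ := by
  have := norm_sq_eq_prime (pt 0 v)
  simp only [pt_zero_apply, prime_pt] at this
  rw [← abs_of_nonneg (norm_nonneg (pt 0 v)), ← abs_of_nonneg (norm_nonneg v), ← sq_eq_sq_iff_abs_eq_abs]
  linarith

/-- The embedding `x' ↦ (0, x')` as a linear map. -/
def embL (d : ℕ) : Pt d →L[ℝ] Pt (d + 1) :=
  LinearMap.mkContinuous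
    { toFun := pt 0
      map_add' := fun x y => by
        ext i; refine Fin.cases ?_ (fun b => ?_) i <;> simp
      map_smul' := fun c x => by
        ext i; refine Fin.cases ?_ (fun b => ?_) i <;> simp } 1
    (fun x => by simpa using (norm_pt_zero x).le)

@[simp] theorem embL_apply (v : Pt d) : embL d v = pt 0 v := rfl

/-- The first basis vector. -/
abbrev e0 (d : ℕ) : Pt (d + 1) := EuclideanSpace.single 0 1

theorem pt_eq (t : ℝ) (v : Pt d) : pt t v = t • e0 d + embL d v := by
  ext i; refine Fin.cases ?_ (fun b => ?_) i <;> simp [e0]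

theorem embL_single (b : Fin d) :
    embL d (EuclideanSpace.single b 1) = EuclideanSpace.single b.succ 1 := by
  ext i; refine Fin.cases ?_ (fun c => ?_) i
  · simp [(Fin.succ_ne_zero b).symm]
  · simp [Fin.succ_inj]

theorem isOpen_cube (n : ℕ) (r : ℝ) : IsOpen (cube n r) := by
  have : cube n r = ⋂ i, {x : Pt n | |x i| < r} := by ext; simp [cube]
  rw [this]
  refine isOpen_iInter_of_finite fun i => isOpen_lt ?_ continuous_const
  exact continuous_abs.comp (EuclideanSpace.proj (𝕜 := ℝ) i).continuous

theorem convex_cube (n : ℕ) (r : ℝ) : Convex ℝ (cube n r) := by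
  have : cube n r = ⋂ i, (EuclideanSpace.proj (𝕜 := ℝ) i : Pt n →L[ℝ] ℝ) ⁻¹' Ioo (-r) r := by
    ext; simp [cube, abs_lt]
  rw [this]
  exact convex_iInter fun i =>
    (convex_Ioo (-r) r).is_linear_preimage
      (EuclideanSpace.proj (𝕜 := ℝ) i : Pt n →L[ℝ] ℝ).toLinearMap.isLinear

theorem cube_mono {n : ℕ} {r s : ℝ} (h : r ≤ s) : cube n r ⊆ cube n s :=
  fun _ hx i => (hx i).trans_le h

theorem prime_mem_cube {r : ℝ} {x : Pt (d + 1)} (hx : x ∈ cube (d + 1) r) : prime x ∈ cube d r :=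
  fun b => hx b.succ

theorem mem_cube_iff {r : ℝ} {x : Pt (d + 1)} :
    x ∈ cube (d + 1) r ↔ |x 0| < r ∧ prime x ∈ cube d r :=
  ⟨fun h => ⟨h 0, prime_mem_cube h⟩, fun h i => Fin.cases h.1 h.2 i⟩

theorem norm_sub_le_of_mem_cube {n : ℕ} {x y : Pt n} (hx : x ∈ cube n 5) (hy : y ∈ cube n 5) :
    ‖x - y‖ ≤ 10 * n := by
  have h1 : ‖x - y‖ ≤ ∑ i, |(x - y) i| := by
    conv_lhs => rw [← (EuclideanSpace.basisFun (Fin n) ℝ).sum_repr (x - y)]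
    refine (norm_sum_le _ _).trans (Finset.sum_le_sum fun i _ => ?_)
    simp [norm_smul]
  refine h1.trans ?_
  have : ∀ i ∈ Finset.univ, |(x - y) i| ≤ (10 : ℝ) := fun i _ => by
    have h1 := abs_lt.1 (hx i)
    have h2 := abs_lt.1 (hy i)
    simp only [PiLp.sub_apply]
    rw [abs_le]; constructor <;> linarith
  refine (Finset.sum_le_sum this).trans ?_
  simp [mul_comm]

end Coordinates

/-! ### Quasi-convexity: from bounded gradients to Hölder bounds. -/

section QuasiConvex

variable {n : ℕ}

/-- Any two points of `S` are joined in `T` by a path of length at most `C` times their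
distance. -/
def QC (C : ℝ) (S T : Set (Pt n)) : Prop :=
  ∀ x ∈ S, ∀ y ∈ S, ∃ c c' : ℝ → Pt n, c 0 = x ∧ c 1 = y ∧ ∀ t ∈ Icc (0 : ℝ) 1,
    c t ∈ T ∧ HasDerivWithinAt c (c' t) (Icc 0 1) t ∧ ‖c' t‖ ≤ C * ‖x - y‖

theorem QC.of_convex {S T : Set (Pt n)} (hT : Convex ℝ T) (hST : S ⊆ T) : QC 1 S T := by
  intro x hx y hy
  refine ⟨fun t => x + t • (y - x), fun _ => y - x, by simp, by simp, fun t ht => ⟨?_, ?_, ?_⟩⟩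
  · exact hT.add_smul_sub_mem (hST hx) (hST hy) ht
  · have := ((hasDerivAt_id t).smul_const (y - x)).const_add x
    simpa using this.hasDerivWithinAt
  · rw [norm_sub_rev]; simp

theorem QC.norm_sub_le {C B : ℝ} {S T : Set (Pt n)} (h : QC C S T) {V : Type*}
    [NormedAddCommGroup V] [NormedSpace ℝ V] {f : Pt n → V} (hf : DifferentiableOn ℝ f T)
    (hB : ∀ x ∈ T, ‖fderivWithin ℝ f T x‖ ≤ B) {x y : Pt n} (hx : x ∈ S) (hy : y ∈ S) :
    ‖f x - f y‖ ≤ B * C * ‖x - y‖ := by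
  obtain ⟨c, c', h0, h1, hc⟩ := h x hx y hy
  have hd : ∀ t ∈ Icc (0 : ℝ) 1, HasDerivWithinAt (f ∘ c) (fderivWithin ℝ f T (c t) (c' t))
      (Icc 0 1) t := fun t ht =>
    ((hf _ (hc t ht).1).hasFDerivWithinAt).comp_hasDerivWithinAt t (hc t ht).2.1
      (fun s hs => (hc s hs).1)
  have := norm_image_sub_le_of_norm_deriv_le_segment_01' hd (C := B * C * ‖x - y‖) (fun t ht => by
    have ht' := Ico_subset_Icc_self ht
    refine (ContinuousLinearMap.le_opNorm _ _).trans ?_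
    rw [mul_assoc]
    exact mul_le_mul (hB _ (hc t ht').1) (hc t ht').2.2 (norm_nonneg _)
      ((norm_nonneg _).trans (hB _ (hc t ht').1)))
  rwa [Function.comp_apply, Function.comp_apply, h0, h1, norm_sub_rev] at this

/-- The Lipschitz bound is used for t ≤ 1 and the trivial bound for t ≥ 1. -/
theorem le_rpow_of_le {a B t γ : ℝ} (h1 : a ≤ B) (h2 : a ≤ B * t) (ht : 0 ≤ t) (hB : 0 ≤ B)
    (hγ0 : 0 ≤ γ) (hγ : γ ≤ 1) : a ≤ B * t ^ γ := by
  rcases le_total t 1 with h | h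
  · refine h2.trans (mul_le_mul_of_nonneg_left ?_ hB)
    rcases ht.eq_or_lt with rfl | ht
    · positivity
    · simpa using Real.rpow_le_rpow_of_exponent_ge ht h hγ
  · refine h1.trans (le_mul_of_one_le_right hB (Real.one_le_rpow h hγ0))

theorem HB.of_fderivWithin {C B γ : ℝ} {S T : Set (Pt n)} (h : QC C S T) (hST : S ⊆ T)
    (hγ0 : 0 ≤ γ) (hγ : γ ≤ 1) (hC : 0 ≤ C) (hB0 : 0 ≤ B) {f : Pt n → ℝ}
    (hf : DifferentiableOn ℝ f T) (hb : ∀ x ∈ T, |f x| ≤ B)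
    (hB : ∀ x ∈ T, ‖fderivWithin ℝ f T x‖ ≤ B) : HB γ S ((C + 2) * B) f := by
  refine ⟨fun x hx => (hb x (hST hx)).trans (by nlinarith), fun x hx y hy => ?_⟩
  refine le_rpow_of_le ?_ ?_ (norm_nonneg _) (by positivity) hγ0 hγ
  · have := abs_sub (f x) (f y)
    have := hb x (hST hx)
    have := hb y (hST hy)
    nlinarith
  · refine (h.norm_sub_le hf hB hx hy).trans ?_
    refine mul_le_mul_of_nonneg_right ?_ (norm_nonneg _)
    nlinarith

end QuasiConvex

/-! ### Elementary geometry of the graphs and strips. -/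

namespace Graphs

variable {d : ℕ}

/-- The geometric hypotheses on the graphs. -/
structure Admissible (G : Graphs d) : Prop where
  composite : G.IsCompositeCube 7
  lt : ∀ k ∈ G.K, ∀ x' ∈ cube d 7, G.φ k x' < G.φ (k + 1) x'
  diff : ∀ k ∈ G.Kplus, ContDiffOn ℝ (2 : ℕ) (G.φ k) (cube d 7)
  slope : ∀ k ∈ G.Kplus, ∀ x' ∈ cube d 7,
    ‖fderiv ℝ (G.φ k) x'‖ ≤ 1 / (20 * ((d + 1 : ℕ) : ℝ))

variable {G : Graphs d}

theorem mem_Kplus {k : ℤ} (hk : k ∈ G.K) : k ∈ G.Kplus := by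
  simp only [K, Kplus, Finset.mem_Icc] at *; omega

theorem succ_mem_Kplus {k : ℤ} (hk : k ∈ G.K) : k + 1 ∈ G.Kplus := by
  simp only [K, Kplus, Finset.mem_Icc] at *; omega

theorem strip_mono {r s : ℝ} (h : r ≤ s) (k : ℤ) : G.strip r k ⊆ G.strip s k :=
  fun _ hx => ⟨cube_mono h hx.1, hx.2⟩

namespace Admissible

theorem differentiableAt (hG : G.Admissible) {k : ℤ} (hk : k ∈ G.Kplus) {x' : Pt d} (hx : x' ∈ cube d 7) :
    DifferentiableAt ℝ (G.φ k) x' :=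
  ((hG.diff k hk).differentiableOn (by norm_num) x' hx).differentiableAt
    ((isOpen_cube d 7).mem_nhds hx)

theorem continuousOn (hG : G.Admissible) {k : ℤ} (hk : k ∈ G.Kplus) : ContinuousOn (G.φ k) (cube d 7) :=
  (hG.diff k hk).continuousOn

theorem abs_sub_le (hG : G.Admissible) {k : ℤ} (hk : k ∈ G.Kplus) {x' y' : Pt d} (hx : x' ∈ cube d 7)
    (hy : y' ∈ cube d 7) : |G.φ k x' - G.φ k y'| ≤ 1 / (20 * ((d + 1 : ℕ) : ℝ)) * ‖x' - y'‖ :=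
  (convex_cube d 7).norm_image_sub_le_of_norm_fderiv_le (fun _ hx => hG.differentiableAt hk hx)
    (fun x hx => hG.slope k hk x hx) hy hx

theorem slope_le (d : ℕ) : 1 / (20 * ((d + 1 : ℕ) : ℝ)) ≤ 1 / 20 := by
  have : (1 : ℝ) ≤ ((d + 1 : ℕ) : ℝ) := by push_cast; linarith [Nat.cast_nonneg (α := ℝ) d]
  exact one_div_le_one_div_of_le (by norm_num) (by linarith)

theorem abs_sub_le' (hG : G.Admissible) {k : ℤ} (hk : k ∈ G.Kplus) {x' y' : Pt d} (hx : x' ∈ cube d 7)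
    (hy : y' ∈ cube d 7) : |G.φ k x' - G.φ k y'| ≤ 1 / 20 * ‖x' - y'‖ :=
  (hG.abs_sub_le hk hx hy).trans (mul_le_mul_of_nonneg_right (slope_le d) (norm_nonneg _))

/-- The slope 1/(20n) times the diameter bound 10n. This is what keeps a graph that meets Q₅ inside
Q₇ over all of Q₅'. -/
theorem abs_sub_le_half (hG : G.Admissible) {k : ℤ} (hk : k ∈ G.Kplus) {x' y' : Pt d} (hx : x' ∈ cube d 5)
    (hy : y' ∈ cube d 5) : |G.φ k x' - G.φ k y'| ≤ 1 / 2 := by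
  refine (hG.abs_sub_le hk (cube_mono (by norm_num) hx) (cube_mono (by norm_num) hy)).trans ?_
  have h1 := norm_sub_le_of_mem_cube hx hy
  refine (mul_le_mul_of_nonneg_left h1 (by positivity)).trans ?_
  rw [div_mul_eq_mul_div, div_le_iff₀ (by positivity)]
  push_cast; linarith

/-- The strip is open except at its upper graph. As that graph has slope less than 1, a small
downward cone of slope 1 with vertex at the point stays inside. Unique differentiability and density
of the interior both follow. -/
theorem exists_cone (hG : G.Admissible) {r : ℝ} (hr : r ≤ 7) {k : ℤ} (hk : k ∈ G.K) {x : Pt (d + 1)}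
    (hx : x ∈ G.strip r k) : ∃ C : Set (Pt (d + 1)), C ⊆ G.strip r k ∧ Convex ℝ C ∧
      (interior C).Nonempty ∧ x ∈ C := by
  have hU : IsOpen (cube (d + 1) r ∩ (fun y => y 0 - G.φ k (prime y)) ⁻¹' Ioi 0) := by
    refine ContinuousOn.isOpen_inter_preimage ?_ (isOpen_cube _ _) isOpen_Ioi
    refine ((EuclideanSpace.proj (𝕜 := ℝ) (0 : Fin (d + 1))).continuous.continuousOn).sub ?_
    exact (hG.continuousOn (mem_Kplus hk)).comp continuous_prime.continuousOn
      fun y hy => cube_mono hr (prime_mem_cube hy)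
  obtain ⟨ε, hε, hb⟩ := Metric.isOpen_iff.1 hU x ⟨hx.1, by simpa using hx.2.1⟩
  set g : Pt (d + 1) → ℝ := fun y => y 0 + ‖prime y - prime x‖ with hg
  have hgc : Continuous g := ((EuclideanSpace.proj (𝕜 := ℝ) (0 : Fin (d + 1))).continuous).add
    (continuous_prime.sub continuous_const).norm
  have hconv : ConvexOn ℝ univ g := by
    refine ConvexOn.add ?_ ?_
    · exact (EuclideanSpace.proj (𝕜 := ℝ) (0 : Fin (d + 1))).toLinearMap.convexOn convex_univ
    · have := (convexOn_norm (convex_univ (𝕜 := ℝ) (E := Pt d))).comp_affineMap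
        (((primeL d).toLinearMap.toAffineMap) - AffineMap.const ℝ _ (prime x))
      simpa [Function.comp_def] using this
  refine ⟨Metric.ball x ε ∩ {y | g y ≤ x 0}, ?_, ?_, ?_, ?_⟩
  · rintro y ⟨hy1, hy2⟩
    have h1 := hb hy1
    have h2 : 0 < y 0 - G.φ k (prime y) := h1.2
    refine ⟨h1.1, by linarith, ?_⟩
    have h3 := abs_le.1 (hG.abs_sub_le' (succ_mem_Kplus hk) (cube_mono hr (prime_mem_cube h1.1))
      (cube_mono hr (prime_mem_cube hx.1)))
    have h4 : y 0 + ‖prime y - prime x‖ ≤ x 0 := hy2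
    have h5 := hx.2.2
    linarith [norm_nonneg (prime y - prime x)]
  · refine (convex_ball x ε).inter ?_
    have := hconv.convex_le (x 0)
    simpa using this
  · have ho : IsOpen (Metric.ball x ε ∩ {y | g y < x 0}) :=
      Metric.isOpen_ball.inter (isOpen_lt hgc continuous_const)
    have hsub : Metric.ball x ε ∩ {y | g y < x 0} ⊆ Metric.ball x ε ∩ {y | g y ≤ x 0} :=
      fun y hy => ⟨hy.1, (show g y < x 0 from hy.2).le⟩
    refine ⟨x - (ε / 2) • e0 d, interior_maximal hsub ho ⟨?_, ?_⟩⟩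
    · simp only [Metric.mem_ball, dist_eq_norm, sub_sub_cancel_left, norm_neg, norm_smul]
      simp [e0, abs_of_pos hε, hε]
    · have : prime (x - (ε / 2) • e0 d) = prime x := by ext b; simp [e0]
      simp [hg, this, hε]
  · exact ⟨Metric.mem_ball_self hε, by simp [hg]⟩

theorem uniqueDiffOn_strip (hG : G.Admissible) {r : ℝ} (hr : r ≤ 7) {k : ℤ} (hk : k ∈ G.K) :
    UniqueDiffOn ℝ (G.strip r k) := fun x hx => by
  obtain ⟨C, hC, hc, hi, hxC⟩ := hG.exists_cone hr hk hx
  exact (uniqueDiffWithinAt_convex hc hi (subset_closure hxC)).mono hC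

theorem strip_subset_closure (hG : G.Admissible) {r : ℝ} (hr : r ≤ 7) {k : ℤ} (hk : k ∈ G.K) :
    G.strip r k ⊆ closure (interior (G.strip r k)) := fun x hx => by
  obtain ⟨C, hC, hc, hi, hxC⟩ := hG.exists_cone hr hk hx
  have := hc.closure_interior_eq_closure_of_nonempty_interior hi
  exact closure_mono (interior_mono hC) (this ▸ subset_closure hxC)

end Admissible

end Graphs

end

section

/-! ### Neighbouring strips, the coordinate T, and paths inside a strip. -/

namespace Graphs

variable {d : ℕ} {G : Graphs d}

/-- The part of `Q₇^k` over `Q₅'` with `|x¹| < 6`. -/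
def slab (d : ℕ) : Set (Pt (d + 1)) := {x | |x 0| < 6 ∧ prime x ∈ cube d 5}

theorem isOpen_slab (d : ℕ) : IsOpen (slab d) :=
  (isOpen_lt (continuous_abs.comp (EuclideanSpace.proj (𝕜 := ℝ) (0 : Fin (d + 1))).continuous)
    continuous_const).inter ((isOpen_cube d 5).preimage continuous_prime)

/-- The part of `Q₇^k` over `Q₅'` with `|x¹| < 6`. -/
def mid (G : Graphs d) (k : ℤ) : Set (Pt (d + 1)) := G.strip 7 k ∩ slab d

theorem mid_subset (k : ℤ) : G.mid k ⊆ G.strip 7 k := inter_subset_left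

theorem strip_five_eq (k : ℤ) : G.strip 5 k = G.strip 7 k ∩ cube (d + 1) 5 := by
  ext x
  refine ⟨fun h => ⟨strip_mono (by norm_num) k h, h.1⟩, fun h => ⟨h.2, h.1.2⟩⟩

theorem strip_five_subset_mid (k : ℤ) : G.strip 5 k ⊆ G.mid k := fun x hx =>
  ⟨strip_mono (by norm_num) k hx, (mem_cube_iff.1 hx.1).1.trans (by norm_num),
    prime_mem_cube hx.1⟩

theorem mem_strip_unique (hG : G.Admissible) {k l : ℤ} (hk : k ∈ G.K) (hl : l ∈ G.K)
    {x : Pt (d + 1)} (hxk : x ∈ G.strip 7 k) (hxl : x ∈ G.strip 7 l) : k = l := by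
  by_contra h
  exact Set.disjoint_left.1 (hG.composite.disjoint hk hl h) hxk hxl

theorem glue_apply (hG : G.Admissible) {V : Type*} [AddCommMonoid V] (f : ℤ → Pt (d + 1) → V)
    {k : ℤ} (hk : k ∈ G.K) {x : Pt (d + 1)} (hx : x ∈ G.strip 7 k) : G.glue f x = f k x := by
  rw [glue, Finset.sum_eq_single_of_mem k hk, indicator_of_mem hx]
  intro l hl hlk
  exact indicator_of_notMem (fun h => hlk (mem_strip_unique hG hl hk h hx)) _

theorem exists_strip (hG : G.Admissible) {r : ℝ} (hr : r ≤ 7) {x : Pt (d + 1)}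
    (hx : x ∈ cube (d + 1) r) : ∃ k ∈ G.K, x ∈ G.strip r k := by
  have h := cube_mono hr hx
  rw [hG.composite.cover] at h
  simp only [mem_iUnion, exists_prop] at h
  obtain ⟨k, hk, h⟩ := h
  exact ⟨k, hk, hx, h.2⟩

theorem φ_lt_of_lt (hG : G.Admissible) {x' : Pt d} (hx : x' ∈ cube d 7) {k l : ℤ}
    (hk : k ∈ G.Kplus) (hl : l ∈ G.Kplus) (hkl : k < l) : G.φ k x' < G.φ l x' := by
  have : ∀ j : ℕ, k + 1 + j ∈ G.Kplus → G.φ k x' < G.φ (k + 1 + j) x' := by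
    intro j
    induction j with
    | zero =>
      intro h
      simp only [Kplus, Finset.mem_Icc, Nat.cast_zero, add_zero] at h hk ⊢
      exact hG.lt k (by simp only [K, Finset.mem_Icc]; omega) x' hx
    | succ j ih =>
      intro h
      simp only [Kplus, Finset.mem_Icc, Nat.cast_succ] at h hk ih ⊢
      refine (ih (by omega)).trans ?_
      have := hG.lt (k + 1 + j) (by simp only [K, Finset.mem_Icc]; omega) x' hx
      rwa [show k + 1 + ((j : ℤ) + 1) = k + 1 + j + 1 by ring]
  have h := this (l - k - 1).toNat
  rw [show k + 1 + ((l - k - 1).toNat : ℤ) = l by omega] at h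
  exact h hl

theorem φ_le_of_le (hG : G.Admissible) {x' : Pt d} (hx : x' ∈ cube d 7) {k l : ℤ}
    (hk : k ∈ G.Kplus) (hl : l ∈ G.Kplus) (hkl : k ≤ l) : G.φ k x' ≤ G.φ l x' := by
  rcases hkl.eq_or_lt with rfl | h
  · exact le_rfl
  · exact (φ_lt_of_lt hG hx hk hl h).le

theorem mem_Kminus {k : ℤ} : k ∈ G.Kminus ↔
    k ∈ G.K ∧ ∃ x' ∈ cube d 5, G.graphPt k x' ∈ cube (d + 1) 5 := by
  classical
  simp [Kminus]

theorem Kminus_mem {k : ℤ} (hk : k ∈ G.Kminus) : k ∈ G.K := (mem_Kminus.1 hk).1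

/-- A point of the graph in Q₅ belongs to some strip, whose lower graph lies strictly below it.
Hence a graph that meets Q₅ is never the lowest one and has strips on both sides. -/
theorem Kminus_pred_mem (hG : G.Admissible) {k : ℤ} (hk : k ∈ G.Kminus) : k - 1 ∈ G.K := by
  obtain ⟨hkK, x', -, hg⟩ := mem_Kminus.1 hk
  obtain ⟨l, hl, hx⟩ := exists_strip hG (r := 5) (by norm_num) hg
  have hx7 : x' ∈ cube d 7 := by
    have := prime_mem_cube hg
    rw [graphPt, prime_pt] at this
    exact cube_mono (by norm_num) this
  have h1 := hx.2.1
  simp only [graphPt, prime_pt, pt_zero_apply] at h1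
  have hlk : l < k := by
    by_contra h
    exact absurd (φ_le_of_le hG hx7 (mem_Kplus hkK) (mem_Kplus hl) (not_lt.1 h)) (not_le.2 h1)
  simp only [K, Finset.mem_Icc] at *; omega

/-- The constant is 5 + 1/2, leaving room for vertical shifts by less than 1/2 inside the slab |x¹|
< 6. -/
theorem abs_graph_lt (hG : G.Admissible) {k : ℤ} (hk : k ∈ G.Kminus) {x' : Pt d}
    (hx : x' ∈ cube d 5) : |G.φ k x'| < 11 / 2 := by
  obtain ⟨hkK, y', hy, hg⟩ := mem_Kminus.1 hk
  have h1 := (mem_cube_iff.1 hg).1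
  simp only [graphPt, pt_zero_apply] at h1
  have h2 := hG.abs_sub_le_half (mem_Kplus hkK) hx hy
  rw [abs_lt] at h1 ⊢
  rw [abs_le] at h2
  constructor <;> linarith

/-- Strips contain their upper graph, so piecewise objects evaluated on the k-th graph take their
value from strip k - 1, where T = 1. -/
theorem graphPt_mem_strip (hG : G.Admissible) {k : ℤ} (hk : k ∈ G.Kminus) {x' : Pt d}
    (hx : x' ∈ cube d 5) : G.graphPt k x' ∈ G.strip 7 (k - 1) := by
  refine ⟨mem_cube_iff.2 ⟨?_, ?_⟩, ?_, ?_⟩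
  · simpa [graphPt] using (abs_graph_lt hG hk hx).trans (by norm_num)
  · simpa [graphPt] using cube_mono (by norm_num) hx
  · have := hG.lt (k - 1) (Kminus_pred_mem hG hk) x' (cube_mono (by norm_num) hx)
    simpa [graphPt] using this
  · simp [graphPt]

theorem graphPt_mem_slab (hG : G.Admissible) {k : ℤ} (hk : k ∈ G.Kminus) {x' : Pt d}
    (hx : x' ∈ cube d 5) : G.graphPt k x' ∈ slab d :=
  ⟨by simpa [graphPt] using (abs_graph_lt hG hk hx).trans (by norm_num), by simpa [graphPt] using hx⟩

/-- The thickness `φ_{k+1} - φ_k`. -/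
def gap (G : Graphs d) (k : ℤ) (x' : Pt d) : ℝ := G.φ (k + 1) x' - G.φ k x'

theorem gap_pos (hG : G.Admissible) {k : ℤ} (hk : k ∈ G.K) {x' : Pt d} (hx : x' ∈ cube d 7) :
    0 < G.gap k x' := sub_pos.2 (hG.lt k hk x' hx)

theorem T_mul_gap (hG : G.Admissible) {k : ℤ} (hk : k ∈ G.K) {x : Pt (d + 1)}
    (hx : prime x ∈ cube d 7) : G.T k x * G.gap k (prime x) = x 0 - G.φ k (prime x) :=
  div_mul_cancel₀ _ (gap_pos hG hk hx).ne'

theorem T_pos (hG : G.Admissible) {k : ℤ} (hk : k ∈ G.K) {x : Pt (d + 1)}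
    (hx : x ∈ G.strip 7 k) : 0 < G.T k x :=
  div_pos (sub_pos.2 hx.2.1) (gap_pos hG hk (prime_mem_cube hx.1))

theorem T_le_one (hG : G.Admissible) {k : ℤ} (hk : k ∈ G.K) {x : Pt (d + 1)}
    (hx : x ∈ G.strip 7 k) : G.T k x ≤ 1 := by
  refine (div_le_one (gap_pos hG hk (prime_mem_cube hx.1))).2 ?_
  have := hx.2.2
  simp only [gap]
  linarith

theorem abs_gap_sub_le (hG : G.Admissible) {k : ℤ} (hk : k ∈ G.K) {x' y' : Pt d}
    (hx : x' ∈ cube d 7) (hy : y' ∈ cube d 7) :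
    |G.gap k x' - G.gap k y'| ≤ 1 / 10 * ‖x' - y'‖ := by
  have h1 := hG.abs_sub_le' (mem_Kplus hk) hx hy
  have h2 := hG.abs_sub_le' (succ_mem_Kplus hk) hx hy
  rw [abs_le] at *
  simp only [gap]
  constructor <;> linarith

/-- T has slope of order 1/gap. Multiplied by the gap it is Lipschitz uniformly in the thickness,
because T · gap = x¹ - φ_k and T ≤ 1. -/
theorem T_sub_mul_gap_le (hG : G.Admissible) {k : ℤ} (hk : k ∈ G.K) {x y : Pt (d + 1)}
    (hx : x ∈ G.strip 7 k) (hy : y ∈ G.strip 7 k) :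
    |G.T k x - G.T k y| * G.gap k (prime y) ≤ 2 * ‖x - y‖ := by
  have hx' := prime_mem_cube hx.1
  have hy' := prime_mem_cube hy.1
  rw [← abs_of_pos (gap_pos hG hk hy'), ← abs_mul]
  have e : (G.T k x - G.T k y) * G.gap k (prime y) = (x 0 - y 0) -
      (G.φ k (prime x) - G.φ k (prime y)) - G.T k x * (G.gap k (prime x) - G.gap k (prime y)) := by
    linear_combination T_mul_gap hG hk hx' - T_mul_gap hG hk hy'
  have h1 : |x 0 - y 0| ≤ ‖x - y‖ := abs_apply_le (x - y) 0
  have hp : ‖prime x - prime y‖ ≤ ‖x - y‖ := by rw [← prime_sub]; exact norm_prime_le _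
  have h2 := hG.abs_sub_le' (mem_Kplus hk) hx' hy'
  have h3 := abs_gap_sub_le hG hk hx' hy'
  have h4 : |G.T k x * (G.gap k (prime x) - G.gap k (prime y))| ≤ 1 / 10 * ‖prime x - prime y‖ := by
    rw [abs_mul, abs_of_pos (T_pos hG hk hx)]
    exact (mul_le_of_le_one_left (abs_nonneg _) (T_le_one hG hk hx)).trans h3
  rw [e]
  have h5 := abs_sub ((x 0 - y 0) - (G.φ k (prime x) - G.φ k (prime y)))
    (G.T k x * (G.gap k (prime x) - G.gap k (prime y)))
  have h6 := abs_sub (x 0 - y 0) (G.φ k (prime x) - G.φ k (prime y))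
  linarith [norm_nonneg (x - y)]

theorem hasDerivWithinAt_φ_comp (hG : G.Admissible) {k : ℤ} (hk : k ∈ G.Kplus) {a v : Pt d}
    {t : ℝ} (h : a + t • v ∈ cube d 7) (s : Set ℝ) :
    HasDerivWithinAt (fun t => G.φ k (a + t • v)) (fderiv ℝ (G.φ k) (a + t • v) v) s t := by
  have h1 : HasDerivAt (fun t : ℝ => a + t • v) v t := by
    simpa using ((hasDerivAt_id t).smul_const v).const_add a
  exact ((hG.differentiableAt hk h).hasFDerivAt.comp_hasDerivAt t h1).hasDerivWithinAt

/-- The path moves x' and the relative height T linearly in time, so it cannot leave the strip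
through a graph. Its vertical speed is the change of T times the gap plus terms with small slopes,
hence at most 3|x - y|; the horizontal speed is at most |x - y|. -/
theorem qc_mid (hG : G.Admissible) {k : ℤ} (hk : k ∈ G.K) : QC 4 (G.mid k) (G.strip 7 k) := by
  intro x hx y hy
  have hkp := mem_Kplus hk
  have hkp' := succ_mem_Kplus hk
  set v := prime y - prime x with hv
  set τ := G.T k y - G.T k x with hτ
  have hx5 : prime x ∈ cube d 5 := hx.2.2
  have hy5 : prime y ∈ cube d 5 := hy.2.2
  have hX5 : ∀ t ∈ Icc (0 : ℝ) 1, prime x + t • v ∈ cube d 5 := fun t ht =>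
    (convex_cube d 5).add_smul_sub_mem hx5 hy5 ht
  have h57 : cube d 5 ⊆ cube d 7 := cube_mono (by norm_num)
  set X : ℝ → ℝ := fun t => G.φ k (prime x + t • v) +
    (G.T k x + t * τ) * (G.φ (k + 1) (prime x + t • v) - G.φ k (prime x + t • v)) with hX
  set X' : ℝ → ℝ := fun t => fderiv ℝ (G.φ k) (prime x + t • v) v +
    (τ * (G.φ (k + 1) (prime x + t • v) - G.φ k (prime x + t • v)) + (G.T k x + t * τ) *
      (fderiv ℝ (G.φ (k + 1)) (prime x + t • v) v - fderiv ℝ (G.φ k) (prime x + t • v) v)) with hX'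
  have hT0 := T_pos hG hk hx.1
  have hT1 := T_le_one hG hk hx.1
  have hS0 := T_pos hG hk hy.1
  have hS1 := T_le_one hG hk hy.1
  have hvx : ‖v‖ ≤ ‖x - y‖ := by
    rw [hv, norm_sub_rev, ← prime_sub]; exact norm_prime_le _
  refine ⟨fun t => X t • e0 d + embL d (prime x + t • v), fun t => X' t • e0 d + embL d v,
    ?_, ?_, fun t ht => ?_⟩
  · have h1 := T_mul_gap hG hk (h57 hx5)
    simp only [gap] at h1
    have : X 0 = x 0 := by simp [hX]; linarith
    simp only [this, zero_smul, add_zero]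
    rw [← pt_eq, pt_prime]
  · have h1 := T_mul_gap hG hk (h57 hy5)
    simp only [gap] at h1
    have h2 : prime x + v = prime y := by simp [hv]
    have : X 1 = y 0 := by simp [hX, h2, hτ]; linarith
    simp only [this, one_smul, h2]
    rw [← pt_eq, pt_prime]
  have hp5 := hX5 t ht
  have hp7 := h57 hp5
  have hTt0 : 0 < G.T k x + t * τ := by
    rcases ht.1.eq_or_lt with h | h
    · simpa [← h] using hT0
    · nlinarith [mul_nonneg (sub_nonneg.2 ht.2) hT0.le, mul_pos h hS0]
  have hTt1 : G.T k x + t * τ ≤ 1 := by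
    nlinarith [mul_nonneg (sub_nonneg.2 ht.2) (sub_nonneg.2 hT1),
      mul_nonneg ht.1 (sub_nonneg.2 hS1)]
  have hgap := hG.lt k hk _ hp7
  refine ⟨?_, ?_, ?_⟩
  · beta_reduce
    rw [← pt_eq]
    refine ⟨mem_cube_iff.2 ⟨?_, by simpa using hp7⟩, ?_, ?_⟩
    · rw [pt_zero_apply]
      have e1 := T_mul_gap hG hk (h57 hx5)
      have e2 := T_mul_gap hG hk (h57 hy5)
      simp only [gap] at e1 e2
      have a1 := abs_le.1 (hG.abs_sub_le_half hkp hp5 hx5)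
      have a2 := abs_le.1 (hG.abs_sub_le_half hkp' hp5 hx5)
      have a3 := abs_le.1 (hG.abs_sub_le_half hkp hp5 hy5)
      have a4 := abs_le.1 (hG.abs_sub_le_half hkp' hp5 hy5)
      have hx6 := abs_lt.1 hx.2.1
      have hy6 := abs_lt.1 hy.2.1
      have b1 : ∀ a b s : ℝ, 0 ≤ s → s ≤ 1 → |a| ≤ 1 / 2 → |b| ≤ 1 / 2 →
          |(1 - s) * a + s * b| ≤ 1 / 2 := by
        intro a b s h0 h1 ha hb
        rw [abs_le] at *
        constructor <;> nlinarith
      have c1 := abs_le.1 (b1 _ _ _ hT0.le hT1 (hG.abs_sub_le_half hkp hp5 hx5)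
        (hG.abs_sub_le_half hkp' hp5 hx5))
      have c2 := abs_le.1 (b1 _ _ _ hS0.le hS1 (hG.abs_sub_le_half hkp hp5 hy5)
        (hG.abs_sub_le_half hkp' hp5 hy5))
      set P := G.φ k (prime x + t • v)
      set R := G.φ (k + 1) (prime x + t • v)
      -- Moving x' at a fixed relative height changes x¹ by at most 1/2, so the end points with |x¹|
      -- < 6 lead to heights below 7; the path height is a convex combination of two of these.
      have d1 : |(1 - G.T k x) * P + G.T k x * R| < 7 := by rw [abs_lt]; constructor <;> linarith
      have d2 : |(1 - G.T k y) * P + G.T k y * R| < 7 := by rw [abs_lt]; constructor <;> linarith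
      have e3 : X t = (1 - t) * ((1 - G.T k x) * P + G.T k x * R)
          + t * ((1 - G.T k y) * P + G.T k y * R) := by
        simp only [hX, hτ]; ring
      rw [e3]
      rw [abs_lt] at d1 d2 ⊢
      have := (convex_Ioo (-7 : ℝ) 7) d1 d2 (sub_nonneg.2 ht.2) ht.1 (by ring)
      simpa using this
    · rw [pt_zero_apply, prime_pt]
      have := mul_pos hTt0 (sub_pos.2 hgap)
      simp only [hX]; linarith
    · rw [pt_zero_apply, prime_pt]
      have := mul_le_mul_of_nonneg_right hTt1 (sub_pos.2 hgap).le
      simp only [hX]; linarith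
  · have h1 := hasDerivWithinAt_φ_comp hG hkp hp7 (Icc 0 1)
    have h2 := hasDerivWithinAt_φ_comp hG hkp' hp7 (Icc 0 1)
    have h3 : HasDerivWithinAt (fun t : ℝ => G.T k x + t * τ) τ (Icc 0 1) t := by
      simpa using (((hasDerivAt_id t).mul_const τ).const_add (G.T k x)).hasDerivWithinAt
    have hXd : HasDerivWithinAt X (X' t) (Icc 0 1) t := h1.add (h3.mul (h2.sub h1))
    have h4 : HasDerivAt (fun t : ℝ => embL d (prime x + t • v)) (embL d v) t := by
      have : HasDerivAt (fun t : ℝ => prime x + t • v) v t := by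
        simpa using ((hasDerivAt_id t).smul_const v).const_add (prime x)
      exact (embL d).hasFDerivAt.comp_hasDerivAt t this
    exact (hXd.smul_const (e0 d)).add h4.hasDerivWithinAt
  · have hD : ∀ j ∈ G.Kplus, |fderiv ℝ (G.φ j) (prime x + t • v) v| ≤ 1 / 20 * ‖v‖ := by
      intro j hj
      rw [← Real.norm_eq_abs]
      refine (ContinuousLinearMap.le_opNorm _ _).trans ?_
      exact mul_le_mul_of_nonneg_right ((hG.slope j hj _ hp7).trans (Admissible.slope_le d))
        (norm_nonneg _)
    have hg := abs_le.1 (abs_gap_sub_le hG hk hp7 (h57 hy5))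
    have hty : ‖prime x + t • v - prime y‖ ≤ ‖v‖ := by
      have : prime x + t • v - prime y = (t - 1) • v := by rw [hv]; module
      rw [this, norm_smul, Real.norm_eq_abs]
      refine mul_le_of_le_one_left (norm_nonneg _) ?_
      rw [abs_le]; constructor <;> linarith [ht.1, ht.2]
    have h1 := T_sub_mul_gap_le hG hk hx.1 hy.1
    have hτ' : |τ| = |G.T k x - G.T k y| := abs_sub_comm _ _
    have hτ1 : |τ| ≤ 1 := by rw [hτ, abs_le]; constructor <;> linarith
    have h2 : |τ * (G.φ (k + 1) (prime x + t • v) - G.φ k (prime x + t • v))| ≤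
        2 * ‖x - y‖ + 1 / 10 * ‖x - y‖ := by
      rw [abs_mul, abs_of_pos (sub_pos.2 hgap)]
      change |τ| * G.gap k (prime x + t • v) ≤ _
      -- The bound for τ is weighted by the gap at the end point y. Passing to the gap at the moving
      -- point costs its Lipschitz constant, as |τ| ≤ 1.
      have : |τ| * (G.gap k (prime x + t • v) - G.gap k (prime y)) ≤ 1 / 10 * ‖x - y‖ := by
        have h0 : G.gap k (prime x + t • v) - G.gap k (prime y) ≤ 1 / 10 * ‖x - y‖ := by
          linarith [hg.2]
        refine (mul_le_mul_of_nonneg_left h0 (abs_nonneg _)).trans ?_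
        exact mul_le_of_le_one_left (by positivity) hτ1
      rw [hτ'] at this ⊢
      linarith
    have hd1 := hD k hkp
    have hd2 := hD _ hkp'
    have h3 : |(G.T k x + t * τ) * (fderiv ℝ (G.φ (k + 1)) (prime x + t • v) v
        - fderiv ℝ (G.φ k) (prime x + t • v) v)| ≤ 1 / 10 * ‖v‖ := by
      rw [abs_mul, abs_of_pos hTt0]
      refine (mul_le_of_le_one_left (abs_nonneg _) hTt1).trans ((abs_sub _ _).trans ?_)
      linarith
    have h4 : |X' t| ≤ 3 * ‖x - y‖ := by
      refine (abs_add_le _ _).trans ?_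
      have := abs_add_le (τ * (G.φ (k + 1) (prime x + t • v) - G.φ k (prime x + t • v)))
        ((G.T k x + t * τ) * (fderiv ℝ (G.φ (k + 1)) (prime x + t • v) v
        - fderiv ℝ (G.φ k) (prime x + t • v) v))
      linarith [norm_nonneg (x - y)]
    refine (norm_add_le _ _).trans ?_
    have h5 : ‖X' t • e0 d‖ = |X' t| := by simp [norm_smul, e0]
    rw [h5, embL_apply, norm_pt_zero]
    linarith

end Graphs

end

section

/-! ### From the Hölder norms to uniform bounds for partial derivatives. -/

section Holder

variable {n : ℕ} {V : Type*} [NormedAddCommGroup V] [NormedSpace ℝ V]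
  {m : ℕ} {γ : ℝ≥0} {T S : Set (Pt n)} {f : Pt n → V} {B : ℝ}

theorem norm_iteratedFDerivWithin_le (hB : holderENorm m γ T f ≤ ENNReal.ofReal B) (hB0 : 0 ≤ B)
    {j : ℕ} (hj : j ≤ m) {x : Pt n} (hx : x ∈ T) : ‖iteratedFDerivWithin ℝ j f T x‖ ≤ B := by
  have h1 : ‖iteratedFDerivWithin ℝ j f T x‖ₑ ≤ holderENorm m γ T f := by
    refine le_trans ?_ le_self_add
    refine le_trans ?_ (Finset.single_le_sum (f := fun j => ⨆ x ∈ T, ‖iteratedFDerivWithin ℝ j f T x‖ₑ)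
      (fun _ _ => zero_le) (Finset.mem_range.2 (Nat.lt_succ_of_le hj)))
    exact le_iSup₂ (f := fun x (_ : x ∈ T) => ‖iteratedFDerivWithin ℝ j f T x‖ₑ) x hx
  have h2 := h1.trans hB
  rw [← ofReal_norm] at h2
  exact (ENNReal.ofReal_le_ofReal_iff hB0).1 h2

theorem norm_iteratedFDerivWithin_sub_le (hB : holderENorm m γ T f ≤ ENNReal.ofReal B)
    (hB0 : 0 ≤ B) {x y : Pt n} (hx : x ∈ T) (hy : y ∈ T) :
    ‖iteratedFDerivWithin ℝ m f T x - iteratedFDerivWithin ℝ m f T y‖ ≤ B * ‖x - y‖ ^ (γ : ℝ) := by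
  have h1 : eHolderNorm γ (T.domRestrict (iteratedFDerivWithin ℝ m f T)) ≤ ENNReal.ofReal B :=
    le_trans le_add_self hB
  have h2 : MemHolder γ (T.domRestrict (iteratedFDerivWithin ℝ m f T)) :=
    eHolderNorm_lt_top.1 (h1.trans_lt ENNReal.ofReal_lt_top)
  have h3 := h2.holderWith ⟨x, hx⟩ ⟨y, hy⟩
  have h4 := h3.trans (mul_le_mul_left ((coe_nnHolderNorm_le_eHolderNorm).trans h1) _)
  simp only [Set.domRestrict_apply, edist_dist, Subtype.dist_eq, dist_eq_norm] at h4
  rw [ENNReal.ofReal_rpow_of_nonneg (norm_nonneg _) γ.coe_nonneg, ← ENNReal.ofReal_mul hB0] at h4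
  exact (ENNReal.ofReal_le_ofReal_iff (by positivity)).1 h4

theorem norm_single_prod {j : ℕ} (e : Fin j → Fin n) :
    ∏ i, ‖(EuclideanSpace.single (e i) (1 : ℝ) : Pt n)‖ = 1 := by simp

theorem norm_wd_le (hT : UniqueDiffOn ℝ T) (hf : ContDiffOn ℝ m f T)
    (hB : holderENorm m γ T f ≤ ENNReal.ofReal B) (hB0 : 0 ≤ B) {l : List (Fin n)}
    (hl : l.length ≤ m) {x : Pt n} (hx : x ∈ T) : ‖wd T l f x‖ ≤ B := by
  rw [wd_eq_iteratedFDerivWithin hT hf hl hx]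
  refine (ContinuousMultilinearMap.le_opNorm _ _).trans ?_
  rw [norm_single_prod, mul_one]
  exact norm_iteratedFDerivWithin_le hB hB0 hl hx

theorem norm_wd_sub_le (hT : UniqueDiffOn ℝ T) (hf : ContDiffOn ℝ m f T)
    (hB : holderENorm m γ T f ≤ ENNReal.ofReal B) (hB0 : 0 ≤ B) {l : List (Fin n)}
    (hl : l.length = m) {x y : Pt n} (hx : x ∈ T) (hy : y ∈ T) :
    ‖wd T l f x - wd T l f y‖ ≤ B * ‖x - y‖ ^ (γ : ℝ) := by
  subst hl
  rw [wd_eq_iteratedFDerivWithin hT hf le_rfl hx, wd_eq_iteratedFDerivWithin hT hf le_rfl hy,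
    ← sub_apply]
  refine (ContinuousMultilinearMap.le_opNorm _ _).trans ?_
  rw [norm_single_prod, mul_one]
  exact norm_iteratedFDerivWithin_sub_le hB hB0 hx hy

theorem norm_fderivWithin_wd_le (hT : UniqueDiffOn ℝ T) (hf : ContDiffOn ℝ m f T)
    (hB : holderENorm m γ T f ≤ ENNReal.ofReal B) (hB0 : 0 ≤ B) {l : List (Fin n)}
    (hl : l.length < m) {x : Pt n} (hx : x ∈ T) : ‖fderivWithin ℝ (wd T l f) T x‖ ≤ B := by
  have hd : DifferentiableWithinAt ℝ (iteratedFDerivWithin ℝ l.length f T) T x :=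
    (hf.differentiableOn_iteratedFDerivWithin (by exact_mod_cast hl) hT) x hx
  have h1 : EqOn (wd T l f) (fun y => iteratedFDerivWithin ℝ l.length f T y
      (fun i => EuclideanSpace.single (l.get i) 1)) T :=
    fun y hy => wd_eq_iteratedFDerivWithin hT hf hl.le hy
  rw [fderivWithin_congr h1 (h1 hx)]
  have h2 := ((ContinuousMultilinearMap.apply ℝ (fun _ : Fin l.length => Pt n) V
      (fun i => EuclideanSpace.single (l.get i) 1)).hasFDerivAt.comp_hasFDerivWithinAt x
        hd.hasFDerivWithinAt)
  have h3 := h2.fderivWithin (hT x hx)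
  simp only [Function.comp_def, ContinuousMultilinearMap.apply_apply] at h3
  rw [h3]
  refine ContinuousLinearMap.opNorm_le_bound _ hB0 fun v => ?_
  change ‖(fderivWithin ℝ (iteratedFDerivWithin ℝ l.length f T) T x v)
    (fun i => EuclideanSpace.single (l.get i) 1)‖ ≤ _
  refine (ContinuousMultilinearMap.le_opNorm _ _).trans ?_
  rw [norm_single_prod, mul_one]
  refine (ContinuousLinearMap.le_opNorm _ _).trans ?_
  rw [norm_fderivWithin_iteratedFDerivWithin]
  exact mul_le_mul_of_nonneg_right (norm_iteratedFDerivWithin_le hB hB0 hl hx) (norm_nonneg _)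

/-- The norm contains a Hölder seminorm only at order m. At lower orders the next derivative is
bounded, and quasi-convexity turns this into a Lipschitz, hence Hölder, bound. -/
theorem HB.of_holderENorm {C : ℝ} (hT : UniqueDiffOn ℝ T) (hST : S ⊆ T) (hC : 0 ≤ C)
    (hqc : QC C S T) (hγ : γ ≤ 1) (hf : ContDiffOn ℝ m f T)
    (hB : holderENorm m γ T f ≤ ENNReal.ofReal B) (hB0 : 0 ≤ B) (L : V →L[ℝ] ℝ) (hL : ‖L‖ ≤ 1)
    {l : List (Fin n)} (hl : l.length ≤ m) :
    HB γ S ((C + 2) * B) (wd T l fun x => L (f x)) := by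
  have hLv : ∀ v, |L v| ≤ ‖v‖ := fun v =>
    (L.le_opNorm v).trans (mul_le_of_le_one_left (norm_nonneg _) hL)
  have hfl : ContDiffOn ℝ l.length f T := hf.of_le (by exact_mod_cast hl)
  have hBC : B ≤ (C + 2) * B := by nlinarith
  have hcomp := wd_clm hT L hfl
  rcases hl.lt_or_eq with hl' | hl'
  · have hd := differentiableOn_wd hT hf hl'
    have hd' : DifferentiableOn ℝ (fun x => L (wd T l f x)) T :=
      L.differentiable.comp_differentiableOn hd
    refine HB.congr (HB.of_fderivWithin hqc hST γ.2 (by exact_mod_cast hγ) hC hB0 hd'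
      (fun x hx => (hLv _).trans (norm_wd_le hT hf hB hB0 hl hx)) fun x hx => ?_)
      (hcomp.mono hST)
    have := (L.hasFDerivAt.comp_hasFDerivWithinAt x (hd x hx).hasFDerivWithinAt).fderivWithin
      (hT x hx)
    simp only [Function.comp_def] at this
    rw [this]
    refine (ContinuousLinearMap.opNorm_comp_le _ _).trans ?_
    refine (mul_le_of_le_one_left (norm_nonneg _) hL).trans ?_
    exact norm_fderivWithin_wd_le hT hf hB hB0 hl' hx
  · refine HB.congr ⟨fun x hx => ?_, fun x hx y hy => ?_⟩ (hcomp.mono hST)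
    · exact ((hLv _).trans (norm_wd_le hT hf hB hB0 hl (hST hx))).trans hBC
    · rw [← map_sub]
      refine ((hLv _).trans (norm_wd_sub_le hT hf hB hB0 hl' (hST hx) (hST hy))).trans ?_
      exact mul_le_mul_of_nonneg_right hBC (by positivity)

end Holder

/-- The set `T i` carries the norm and contains the joining paths, while estimates are obtained on
the smaller `S i`. The functional `L` picks out a component. -/
theorem UC.of_holderENorm {n : ℕ} {I : Type*} {V : Type*} [NormedAddCommGroup V] [NormedSpace ℝ V]
    {m : ℕ} {γ : ℝ≥0} (hγ : γ ≤ 1) {S T : I → Set (Pt n)} {w : I → ℝ} {f : I → Pt n → V}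
    (hS : ∀ i, UniqueDiffOn ℝ (S i)) (hT : ∀ i, UniqueDiffOn ℝ (T i)) (hST : ∀ i, S i ⊆ T i)
    {C : ℝ} (hC : 0 ≤ C) (hqc : ∀ i, QC C (S i) (T i)) (hf : ∀ i, ContDiffOn ℝ m (f i) (T i))
    (B : ℝ) (hB0 : 0 ≤ B) (hw : ∀ i, 0 ≤ w i)
    (hB : ∀ i, holderENorm m γ (T i) (f i) ≤ ENNReal.ofReal (B * w i))
    (L : V →L[ℝ] ℝ) (hL : ‖L‖ ≤ 1) : UC γ S w m fun i x => L (f i x) := by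
  have hLf : ∀ i, ContDiffOn ℝ m (fun x => L (f i x)) (T i) := fun i => L.contDiff.comp_contDiffOn (hf i)
  refine UC.of_words (fun l hl => ⟨(C + 2) * B, by positivity, fun i => ?_⟩) fun l hl i => ?_
  · have := HB.of_holderENorm (hT i) (hST i) hC (hqc i) hγ (hf i) (hB i)
      (mul_nonneg hB0 (hw i)) L hL hl
    rw [← mul_assoc] at this
    exact this.congr (wd_subset (hS i) (hT i) (hST i) (hLf i) hl)
  · exact differentiableOn_wd (hS i) ((hLf i).mono (hST i)) hl

/-! ### Index types of all admissible data, and the uniform bounds for φ, A, u, F. -/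

/-- The data of the problem, with all hypotheses. -/
structure Setting (d N m : ℕ) (γ : ℝ≥0) (lam Lam M : ℝ) where
  G : Graphs d
  A : Coeff N (d + 1)
  F : Pt (d + 1) → Mat N (d + 1)
  u : Pt (d + 1) → Pt N
  composite : G.IsCompositeCube 7
  lt : ∀ k ∈ G.K, ∀ x' ∈ cube d 7, G.φ k x' < G.φ (k + 1) x'
  holder_φ : ∀ k ∈ G.Kplus, MemCHolder (m + 1) γ (cube d 7) (G.φ k) ∧
    holderENorm (m + 1) γ (cube d 7) (G.φ k) ≤ ENNReal.ofReal M
  slope : ∀ k ∈ G.Kplus, ∀ x' ∈ cube d 7, ‖fderiv ℝ (G.φ k) x'‖ ≤ 1 / (20 * ((d + 1 : ℕ) : ℝ))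
  elliptic : ∀ k ∈ G.K, ∀ x, ∀ ζ : Mat N (d + 1),
    lam * ‖ζ‖ ^ 2 ≤ ∑ i, ∑ j, ∑ α, ∑ β, A k α β i j x * ζ (i, α) * ζ (j, β)
  bounded : ∀ k ∈ G.K, ∀ α β i j x, |A k α β i j x| ≤ Lam
  holder_A : ∀ k ∈ G.K, ∀ α β i j, MemCHolder m γ Set.univ (A k α β i j) ∧
    holderENorm m γ Set.univ (A k α β i j) ≤ ENNReal.ofReal M
  holder_F : ∀ k ∈ G.K, MemCHolder m γ (G.strip 7 k) F
  holder_u : ∀ k ∈ G.K, MemCHolder m γ (G.strip 7 k) u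
  smooth : ∀ k ∈ G.K, ContDiffOn ℝ (m + 1 : ℕ) u (G.strip 5 k)
  weak : IsWeakSolution (cube (d + 1) 7) (G.coeff A) F u
  one_le : 1 ≤ m

/-- A setting with the index of a subregion. -/
structure StripIdx (d N m : ℕ) (γ : ℝ≥0) (lam Lam M : ℝ) extends Setting d N m γ lam Lam M where
  k : ℤ
  hk : k ∈ G.K

/-- A setting with the index of a graph. -/
structure PlusIdx (d N m : ℕ) (γ : ℝ≥0) (lam Lam M : ℝ) extends Setting d N m γ lam Lam M where
  k : ℤ
  hk : k ∈ G.Kplus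

/-- A setting with the index of a graph which meets `Q₅`. -/
structure GraphIdx (d N m : ℕ) (γ : ℝ≥0) (lam Lam M : ℝ) extends Setting d N m γ lam Lam M where
  k : ℤ
  hk : k ∈ G.Kminus

variable {d N m : ℕ} {γ : ℝ≥0} {lam Lam M : ℝ}

theorem Setting.adm (s : Setting d N m γ lam Lam M) : s.G.Admissible where
  composite := s.composite
  lt := s.lt
  diff k hk := (s.holder_φ k hk).1.1.of_le (by
    have := s.one_le
    exact_mod_cast (by omega : 2 ≤ m + 1))
  slope := s.slope

/-- The data norm on one subregion. -/
def Setting.E (s : Setting d N m γ lam Lam M) (k : ℤ) : ℝ :=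
  (holderENorm m γ (s.G.strip 7 k) s.u + holderENorm m γ (s.G.strip 7 k) s.F).toReal

theorem Setting.E_nonneg (s : Setting d N m γ lam Lam M) (k : ℤ) : 0 ≤ s.E k :=
  ENNReal.toReal_nonneg

theorem Setting.ofReal_E (s : Setting d N m γ lam Lam M) {k : ℤ} (hk : k ∈ s.G.K) :
    ENNReal.ofReal (s.E k) =
      holderENorm m γ (s.G.strip 7 k) s.u + holderENorm m γ (s.G.strip 7 k) s.F :=
  ENNReal.ofReal_toReal (ENNReal.add_ne_top.2 ⟨(s.holder_u k hk).2, (s.holder_F k hk).2⟩)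

/-- The data norm. -/
abbrev Setting.Etot (s : Setting d N m γ lam Lam M) : ℝ := s.G.dataNorm s.F s.u m γ

theorem Setting.Etot_eq (s : Setting d N m γ lam Lam M) : s.Etot = ∑ k ∈ s.G.K, s.E k :=
  ENNReal.toReal_sum fun k hk =>
    ENNReal.add_ne_top.2 ⟨(s.holder_u k hk).2, (s.holder_F k hk).2⟩

theorem Setting.E_le (s : Setting d N m γ lam Lam M) {k : ℤ} (hk : k ∈ s.G.K) :
    s.E k ≤ s.Etot := by
  rw [s.Etot_eq]
  exact Finset.single_le_sum (fun k _ => s.E_nonneg k) hk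

theorem Setting.Etot_nonneg (s : Setting d N m γ lam Lam M) : 0 ≤ s.Etot :=
  ENNReal.toReal_nonneg

theorem uniqueDiffOn_cube (n : ℕ) (r : ℝ) : UniqueDiffOn ℝ (cube n r) :=
  (isOpen_cube n r).uniqueDiffOn

theorem StripIdx.uniqueDiffOn_mid (s : StripIdx d N m γ lam Lam M) :
    UniqueDiffOn ℝ (s.G.mid s.k) :=
  (s.adm.uniqueDiffOn_strip le_rfl s.hk).inter (Graphs.isOpen_slab d)

theorem StripIdx.uniqueDiffOn_five (s : StripIdx d N m γ lam Lam M) :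
    UniqueDiffOn ℝ (s.G.strip 5 s.k) := s.adm.uniqueDiffOn_strip (by norm_num) s.hk

theorem StripIdx.uniqueDiffOn_seven (s : StripIdx d N m γ lam Lam M) :
    UniqueDiffOn ℝ (s.G.strip 7 s.k) := s.adm.uniqueDiffOn_strip le_rfl s.hk

theorem ofReal_M_le (M : ℝ) : ENNReal.ofReal M ≤ ENNReal.ofReal (|M| * 1) :=
  ENNReal.ofReal_le_ofReal (by simpa using le_abs_self M)

theorem uc_φ (hγ : γ ≤ 1) : UC γ (fun _ : PlusIdx d N m γ lam Lam M => cube d 5) (fun _ => 1) (m + 1)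
    fun s => s.G.φ s.k :=
  UC.of_holderENorm hγ (T := fun _ => cube d 7) (fun _ => uniqueDiffOn_cube d 5)
    (fun _ => uniqueDiffOn_cube d 7) (fun _ => cube_mono (by norm_num)) zero_le_one
    (fun _ => QC.of_convex (convex_cube d 7) (cube_mono (by norm_num)))
    (fun s => (s.holder_φ s.k s.hk).1.1) |M| (abs_nonneg M) (fun _ => zero_le_one)
    (fun s => (s.holder_φ s.k s.hk).2.trans (ofReal_M_le M)) (ContinuousLinearMap.id ℝ ℝ)
    ContinuousLinearMap.norm_id_le

theorem uc_A_univ (hγ : γ ≤ 1) (α β : Fin (d + 1)) (i j : Fin N) :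
    UC γ (fun _ : StripIdx d N m γ lam Lam M => univ) (fun _ => 1) m
      fun s => s.A s.k α β i j :=
  UC.of_holderENorm hγ (T := fun _ => univ) (fun _ => uniqueDiffOn_univ)
    (fun _ => uniqueDiffOn_univ) (fun _ => subset_rfl) zero_le_one
    (fun _ => QC.of_convex convex_univ subset_rfl)
    (fun s => (s.holder_A s.k s.hk α β i j).1.1) |M| (abs_nonneg M) (fun _ => zero_le_one)
    (fun s => (s.holder_A s.k s.hk α β i j).2.trans (ofReal_M_le M)) (ContinuousLinearMap.id ℝ ℝ)
    ContinuousLinearMap.norm_id_le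

theorem uc_A (hγ : γ ≤ 1) (α β : Fin (d + 1)) (i j : Fin N) :
    UC γ (fun s : StripIdx d N m γ lam Lam M => s.G.mid s.k) (fun _ => 1) m
      fun s => s.A s.k α β i j :=
  (uc_A_univ hγ α β i j).subset (fun s => s.uniqueDiffOn_mid) fun _ => subset_univ _

theorem norm_proj_le {ι : Type*} [Fintype ι] (i : ι) :
    ‖(EuclideanSpace.proj (𝕜 := ℝ) i : EuclideanSpace ℝ ι →L[ℝ] ℝ)‖ ≤ 1 :=
  ContinuousLinearMap.opNorm_le_bound _ zero_le_one fun x => by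
    simpa using PiLp.norm_apply_le x i

theorem uc_u (hγ : γ ≤ 1) (j : Fin N) :
    UC γ (fun s : StripIdx d N m γ lam Lam M => s.G.mid s.k) (fun s => s.E s.k) m
      fun s x => s.u x j :=
  UC.of_holderENorm hγ (T := fun s => s.G.strip 7 s.k) (fun s => s.uniqueDiffOn_mid)
    (fun s => s.uniqueDiffOn_seven) (fun s => Graphs.mid_subset _) (by norm_num)
    (fun s => Graphs.qc_mid s.adm s.hk) (fun s => (s.holder_u s.k s.hk).1) 1 zero_le_one
    (fun s => s.E_nonneg s.k) (fun s => by rw [one_mul, s.ofReal_E s.hk]; exact le_self_add)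
    (EuclideanSpace.proj j) (norm_proj_le j)

theorem uc_F (hγ : γ ≤ 1) (i : Fin N) (α : Fin (d + 1)) :
    UC γ (fun s : StripIdx d N m γ lam Lam M => s.G.mid s.k) (fun s => s.E s.k) m
      fun s x => s.F x (i, α) :=
  UC.of_holderENorm hγ (T := fun s => s.G.strip 7 s.k) (fun s => s.uniqueDiffOn_mid)
    (fun s => s.uniqueDiffOn_seven) (fun s => Graphs.mid_subset _) (by norm_num)
    (fun s => Graphs.qc_mid s.adm s.hk) (fun s => (s.holder_F s.k s.hk).1) 1 zero_le_one
    (fun s => s.E_nonneg s.k) (fun s => by rw [one_mul, s.ofReal_E s.hk]; exact le_add_self)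
    (EuclideanSpace.proj (i, α)) (norm_proj_le (i, α))

/-- The flux contains Du, so the data norm pays for only m - 1 of its derivatives. -/
theorem uc_flux (hγ : γ ≤ 1) (i : Fin N) (α : Fin (d + 1)) {r : ℕ} (hr : r + 1 ≤ m) :
    UC γ (fun s : StripIdx d N m γ lam Lam M => s.G.mid s.k) (fun s => s.E s.k) r
      fun s => s.G.flux s.A s.F s.u i α s.k := by
  have hu : ∀ j β, UC γ (fun s : StripIdx d N m γ lam Lam M => s.G.mid s.k) (fun s => s.E s.k) r
      fun s => pd (s.G.strip 7 s.k) β (fun y => s.u y j) := fun j β =>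
    (((uc_u hγ j).of_le hr).2.2 β).congr fun s x hx =>
      (pd_inter (Graphs.isOpen_slab d) _ β hx).symm
  exact (UC.sum (fun s => s.uniqueDiffOn_mid) _ fun j _ =>
    UC.sum (fun s => s.uniqueDiffOn_mid) _ fun β _ =>
      ((uc_A hγ α β i j).of_le (by omega)).mul (fun s => s.uniqueDiffOn_mid) (hu j β)).sub
        (fun s => s.uniqueDiffOn_mid) ((uc_F hγ i α).of_le (by omega))

end

section

/-! ### Traces on a graph and their tangential derivatives. -/

open Filter Topology

/-- The graph of `φ` over `Q₅'` is approached from inside `T`, locally uniformly, by the shifts of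
the graph by `σ ε`, `ε → 0+`. -/
structure Approach {d : ℕ} (φ : Pt d → ℝ) (T : Set (Pt (d + 1))) (σ : ℝ) : Prop where
  abs_le : |σ| ≤ 1
  differentiableAt : ∀ x ∈ cube d 5, DifferentiableAt ℝ φ x
  lip : ∀ x ∈ cube d 5, ∀ y ∈ cube d 5, |φ x - φ y| ≤ ‖x - y‖
  mem_slab : ∀ x ∈ cube d 5, pt (φ x) x ∈ Graphs.slab d
  near : ∀ x₀ ∈ cube d 5, ∃ r > 0, ∃ ε₀ > 0, ∀ x ∈ Metric.ball x₀ r, x ∈ cube d 5 ∧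
    ∀ ε ∈ Ioo (0 : ℝ) ε₀, pt (φ x + σ * ε) x ∈ interior (T ∩ Graphs.slab d)

theorem clm_eq_sum {d : ℕ} {V : Type*} [NormedAddCommGroup V] [NormedSpace ℝ V] (L : Pt d →L[ℝ] V) :
    L = ∑ b, (EuclideanSpace.proj (𝕜 := ℝ) b : Pt d →L[ℝ] ℝ).smulRight
      (L (EuclideanSpace.single b 1)) := by
  ext v
  conv_lhs => rw [← (EuclideanSpace.basisFun (Fin d) ℝ).sum_repr v]
  simp [map_sum]

namespace Approach

variable {d : ℕ} {φ : Pt d → ℝ} {T : Set (Pt (d + 1))} {σ : ℝ}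

/-- Traces are taken from the whole strip but estimates hold in the slab only. The slab is an open
neighbourhood of the graph point, so the limits agree. -/
theorem nhdsWithin_eq (h : Approach φ T σ) {x : Pt d} (hx : x ∈ cube d 5) :
    𝓝[T ∩ Graphs.slab d] (pt (φ x) x) = 𝓝[T] (pt (φ x) x) :=
  nhdsWithin_inter_of_mem' (mem_nhdsWithin_of_mem_nhds
    ((Graphs.isOpen_slab d).mem_nhds (h.mem_slab x hx)))

theorem eventually_mem (h : Approach φ T σ) {x : Pt d} (hx : x ∈ cube d 5) :
    ∀ᶠ ε in 𝓝[>] (0 : ℝ), pt (φ x + σ * ε) x ∈ T ∩ Graphs.slab d := by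
  obtain ⟨r, hr, ε₀, hε₀, hb⟩ := h.near x hx
  filter_upwards [Ioo_mem_nhdsGT hε₀] with ε hε
  exact interior_subset ((hb x (Metric.mem_ball_self hr)).2 ε hε)

theorem tendsto_shift (h : Approach φ T σ) {x : Pt d} (hx : x ∈ cube d 5) :
    Tendsto (fun ε => pt (φ x + σ * ε) x) (𝓝[>] (0 : ℝ)) (𝓝[T ∩ Graphs.slab d] (pt (φ x) x)) := by
  refine tendsto_nhdsWithin_iff.2 ⟨?_, h.eventually_mem hx⟩
  have hc : Continuous fun ε : ℝ => (φ x + σ * ε) • e0 d + embL d x := by fun_prop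
  have := hc.tendsto 0
  simp only [← pt_eq, mul_zero, add_zero] at this
  exact this.mono_left nhdsWithin_le_nhds

theorem extendFrom_congr (h : Approach φ T σ) {f g : Pt (d + 1) → ℝ}
    (e : EqOn f g (T ∩ Graphs.slab d)) {x : Pt d} (hx : x ∈ cube d 5) :
    extendFrom T f (pt (φ x) x) = extendFrom T g (pt (φ x) x) := by
  have : f =ᶠ[𝓝[T] (pt (φ x) x)] g := by
    rw [← h.nhdsWithin_eq hx]
    exact e.eventuallyEq_of_mem self_mem_nhdsWithin
  simp only [extendFrom, limUnder, Filter.map_congr this]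

/-- Hölder continuity is uniform continuity, so `f` maps the neighbourhood filter to a Cauchy
filter. Thus `extendFrom` is a genuine limit, and can be computed along vertical shifts. -/
theorem tendsto_trace (h : Approach φ T σ) {γ C : ℝ} (hγ : 0 < γ) {f : Pt (d + 1) → ℝ}
    (hf : HB γ (T ∩ Graphs.slab d) C f) {x : Pt d} (hx : x ∈ cube d 5) :
    Tendsto (fun ε => f (pt (φ x + σ * ε) x)) (𝓝[>] (0 : ℝ))
      (𝓝 (extendFrom T f (pt (φ x) x))) := by
  have hne : (𝓝[T ∩ Graphs.slab d] (pt (φ x) x)).NeBot := (h.tendsto_shift hx).neBot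
  have hc : Cauchy (map f (𝓝[T ∩ Graphs.slab d] (pt (φ x) x))) :=
    (cauchy_nhds.mono nhdsWithin_le_nhds).map_of_le (hf.uniformContinuousOn hγ)
      (le_principal_iff.2 self_mem_nhdsWithin)
  obtain ⟨y, hy⟩ := CompleteSpace.complete hc
  have : Tendsto f (𝓝[T] (pt (φ x) x)) (𝓝 (extendFrom T f (pt (φ x) x))) := by
    refine tendsto_extendFrom ⟨y, ?_⟩
    rw [← h.nhdsWithin_eq hx]
    exact hy
  rw [← h.nhdsWithin_eq hx] at this
  exact this.comp (h.tendsto_shift hx)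

theorem pt_sub_pt (a b : ℝ) (x y : Pt d) : ‖pt a x - pt b y‖ ≤ |a - b| + ‖x - y‖ := by
  refine (norm_le_add_prime _).trans ?_
  rw [prime_sub]; simp

/-- Two points shifted by the same amount are at distance at most 2|x - y|, the graph being
1-Lipschitz. The estimate passes to the limit; the factor 2 dominates 2^γ. -/
theorem hb_trace (h : Approach φ T σ) {γ C : ℝ} (hγ : 0 < γ) (hγ1 : γ ≤ 1) (hC : 0 ≤ C)
    {f : Pt (d + 1) → ℝ} (hf : HB γ (T ∩ Graphs.slab d) C f) :
    HB γ (cube d 5) (2 * C) fun x => extendFrom T f (pt (φ x) x) := by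
  refine ⟨fun x hx => ?_, fun x hx y hy => ?_⟩
  · have h1 : |extendFrom T f (pt (φ x) x)| ≤ C :=
      le_of_tendsto (h.tendsto_trace hγ hf hx).abs
        ((h.eventually_mem hx).mono fun ε hε => hf.1 _ hε)
    linarith
  · refine le_of_tendsto ((h.tendsto_trace hγ hf hx).sub (h.tendsto_trace hγ hf hy)).abs ?_
    filter_upwards [h.eventually_mem hx, h.eventually_mem hy] with ε h1 h2
    refine (hf.2 _ h1 _ h2).trans ?_
    have h3 : ‖pt (φ x + σ * ε) x - pt (φ y + σ * ε) y‖ ≤ 2 * ‖x - y‖ := by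
      refine (pt_sub_pt _ _ _ _).trans ?_
      have := h.lip x hx y hy
      rw [add_sub_add_right_eq_sub]; linarith
    have h4 : ‖pt (φ x + σ * ε) x - pt (φ y + σ * ε) y‖ ^ γ ≤ 2 * ‖x - y‖ ^ γ := by
      refine (Real.rpow_le_rpow (norm_nonneg _) h3 hγ.le).trans ?_
      rw [Real.mul_rpow (by norm_num) (norm_nonneg _)]
      refine mul_le_mul_of_nonneg_right ?_ (by positivity)
      calc (2 : ℝ) ^ γ ≤ 2 ^ (1 : ℝ) := Real.rpow_le_rpow_of_exponent_le (by norm_num) hγ1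
        _ = 2 := by norm_num
    nlinarith [mul_le_mul_of_nonneg_left h4 hC]

theorem abs_sub_trace_le (h : Approach φ T σ) {γ C : ℝ} (hγ : 0 < γ) {f : Pt (d + 1) → ℝ}
    (hC : 0 ≤ C) (hf : HB γ (T ∩ Graphs.slab d) C f) {x : Pt d} (hx : x ∈ cube d 5) {ε : ℝ}
    (hε : 0 < ε) (hm : pt (φ x + σ * ε) x ∈ T ∩ Graphs.slab d) :
    |f (pt (φ x + σ * ε) x) - extendFrom T f (pt (φ x) x)| ≤ C * ε ^ γ := by
  refine le_of_tendsto ((h.tendsto_trace hγ hf hx).const_sub _).abs ?_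
  filter_upwards [h.eventually_mem hx, Ioo_mem_nhdsGT hε] with δ h1 h2
  refine (hf.2 _ hm _ h1).trans (mul_le_mul_of_nonneg_left ?_ hC)
  refine Real.rpow_le_rpow (norm_nonneg _) ((pt_sub_pt _ _ _ _).trans ?_) hγ.le
  rw [sub_self, norm_zero, add_zero, add_sub_add_left_eq_sub, ← mul_sub, abs_mul,
    abs_of_pos (sub_pos.2 h2.2)]
  have h3 := mul_le_of_le_one_left (sub_pos.2 h2.2).le h.abs_le
  have h4 : 0 < δ := h2.1
  linarith

/-- On the graph shifted into the interior this is the chain rule. The derivatives converge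
uniformly at rate ε^γ as the shift tends to zero, so the limit may be differentiated. -/
theorem hasFDerivAt_trace (h : Approach φ T σ) {γ C : ℝ} (hγ : 0 < γ) (hC : 0 ≤ C)
    {f : Pt (d + 1) → ℝ} (hf : HB γ (T ∩ Graphs.slab d) C f)
    (hd : DifferentiableOn ℝ f (T ∩ Graphs.slab d))
    (hf' : ∀ α, HB γ (T ∩ Graphs.slab d) C (pd (T ∩ Graphs.slab d) α f)) {x₀ : Pt d}
    (hx₀ : x₀ ∈ cube d 5) :
    HasFDerivAt (fun x => extendFrom T f (pt (φ x) x))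
      (∑ b, (EuclideanSpace.proj (𝕜 := ℝ) b : Pt d →L[ℝ] ℝ).smulRight
        (extendFrom T (pd (T ∩ Graphs.slab d) b.succ f) (pt (φ x₀) x₀) +
          pd univ b φ x₀ * extendFrom T (pd (T ∩ Graphs.slab d) 0 f) (pt (φ x₀) x₀))) x₀ := by
  set W := T ∩ Graphs.slab d with hW
  obtain ⟨r, hr, ε₀, hε₀, hb⟩ := h.near x₀ hx₀
  -- The denominator n + 2 makes every shift strictly smaller than ε₀, including n = 0.
  set ε : ℕ → ℝ := fun n => ε₀ / (n + 2) with hε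
  have hεpos : ∀ n, ε n ∈ Ioo 0 ε₀ := fun n => by
    refine ⟨by positivity, ?_⟩
    rw [hε]
    exact div_lt_self hε₀ (by have : (0 : ℝ) ≤ n := n.cast_nonneg; linarith)
  have hεlim : Tendsto ε atTop (𝓝 0) :=
    tendsto_const_nhds.div_atTop (tendsto_atTop_add_const_right _ _ tendsto_natCast_atTop_atTop)
  have hεlim' : Tendsto ε atTop (𝓝[>] 0) :=
    tendsto_nhdsWithin_iff.2 ⟨hεlim, Eventually.of_forall fun n => (hεpos n).1⟩
  set Q : ℕ → Pt d → Pt (d + 1) := fun n x => pt (φ x + σ * ε n) x with hQ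
  have hQW : ∀ n, ∀ x ∈ Metric.ball x₀ r, Q n x ∈ interior W := fun n x hx =>
    (hb x hx).2 _ (hεpos n)
  refine hasFDerivAt_of_tendstoUniformlyOn (l := atTop) (s := Metric.ball x₀ r) Metric.isOpen_ball
    (f := fun n x => f (Q n x)) (f' := fun n x =>
      ∑ b, (EuclideanSpace.proj (𝕜 := ℝ) b : Pt d →L[ℝ] ℝ).smulRight
        (pd W b.succ f (Q n x) + pd univ b φ x * pd W 0 f (Q n x)))
    (g' := fun x => ∑ b, (EuclideanSpace.proj (𝕜 := ℝ) b : Pt d →L[ℝ] ℝ).smulRight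
        (extendFrom T (pd W b.succ f) (pt (φ x) x) +
          pd univ b φ x * extendFrom T (pd W 0 f) (pt (φ x) x))) ?_ ?_ ?_
    (Metric.mem_ball_self hr)
  · have hφb : ∀ x ∈ Metric.ball x₀ r, ∀ b, |pd univ b φ x| ≤ 1 := by
      intro x hx b
      have hxc := (hb x hx).1
      have hl : ‖fderiv ℝ φ x‖ ≤ 1 := by
        refine (h.differentiableAt x hxc).hasFDerivAt.le_of_lip' zero_le_one ?_
        filter_upwards [(isOpen_cube d 5).mem_nhds hxc] with y hy
        simpa using h.lip y hy x hxc
      rw [pd, fderivWithin_univ, ← Real.norm_eq_abs]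
      refine (ContinuousLinearMap.le_opNorm _ _).trans ?_
      simpa using hl
    rw [Metric.tendstoUniformlyOn_iff]
    intro η hη
    have hlim : Tendsto (fun n => (d : ℝ) * (2 * (C * ε n ^ γ))) atTop (𝓝 0) := by
      have := hεlim.rpow_const (p := γ) (Or.inr hγ.le)
      rw [Real.zero_rpow hγ.ne'] at this
      simpa using ((this.const_mul C).const_mul 2).const_mul (d : ℝ)
    filter_upwards [hlim.eventually_lt_const hη] with n hn x hx
    refine lt_of_le_of_lt ?_ hn
    rw [dist_comm, dist_eq_norm, ← Finset.sum_sub_distrib]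
    refine (norm_sum_le _ _).trans ?_
    have hterm : ∀ b ∈ Finset.univ, ‖(EuclideanSpace.proj (𝕜 := ℝ) b : Pt d →L[ℝ] ℝ).smulRight
        (pd W b.succ f (Q n x) + pd univ b φ x * pd W 0 f (Q n x)) -
        (EuclideanSpace.proj (𝕜 := ℝ) b : Pt d →L[ℝ] ℝ).smulRight
        (extendFrom T (pd W b.succ f) (pt (φ x) x) +
          pd univ b φ x * extendFrom T (pd W 0 f) (pt (φ x) x))‖ ≤ 2 * (C * ε n ^ γ) := by
      intro b _
      have hxc := (hb x hx).1
      have hm := interior_subset (hQW n x hx)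
      have h1 := h.abs_sub_trace_le hγ hC (hf' b.succ) hxc (hεpos n).1 hm
      have h2 := h.abs_sub_trace_le hγ hC (hf' 0) hxc (hεpos n).1 hm
      have h3 := mul_le_mul (hφb x hx b) h2 (abs_nonneg _) zero_le_one
      rw [← abs_mul] at h3
      refine ContinuousLinearMap.opNorm_le_bound _
        (mul_nonneg zero_le_two (mul_nonneg hC (Real.rpow_nonneg (hεpos n).1.le _))) fun v => ?_
      rw [sub_apply, ContinuousLinearMap.smulRight_apply,
        ContinuousLinearMap.smulRight_apply, ← smul_sub, norm_smul, mul_comm]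
      refine mul_le_mul ?_ (abs_apply_le v b) (norm_nonneg _)
        (mul_nonneg zero_le_two (mul_nonneg hC (Real.rpow_nonneg (hεpos n).1.le _)))
      rw [Real.norm_eq_abs]
      have h4 := abs_add_le (pd W b.succ f (Q n x) - extendFrom T (pd W b.succ f) (pt (φ x) x))
        (pd univ b φ x * (pd W 0 f (Q n x) - extendFrom T (pd W 0 f) (pt (φ x) x)))
      refine le_trans (le_of_eq ?_) (h4.trans ?_)
      · congr 1; ring
      · linarith
    refine (Finset.sum_le_sum hterm).trans ?_
    simp
  · intro n x hx
    have hxc := (hb x hx).1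
    have hn : W ∈ 𝓝 (Q n x) := mem_interior_iff_mem_nhds.1 (hQW n x hx)
    have h1 : HasFDerivAt f (fderivWithin ℝ f W (Q n x)) (Q n x) :=
      (hd _ (interior_subset (hQW n x hx))).hasFDerivWithinAt.hasFDerivAt hn
    have h2 : HasFDerivAt (Q n) ((fderiv ℝ φ x).smulRight (e0 d) + embL d) x := by
      have h3 := ((h.differentiableAt x hxc).hasFDerivAt.add_const (σ * ε n)).smul_const (e0 d)
      have h4 := h3.add (embL d).hasFDerivAt
      refine h4.congr_of_eventuallyEq (Eventually.of_forall fun y => ?_)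
      simp only [hQ]
      rw [pt_eq]; rfl
    refine (h1.comp x h2).congr_fderiv ?_
    rw [clm_eq_sum ((fderivWithin ℝ f W (Q n x)).comp ((fderiv ℝ φ x).smulRight (e0 d) + embL d))]
    refine Finset.sum_congr rfl fun b _ => ?_
    congr 1
    rw [ContinuousLinearMap.comp_apply, add_apply, map_add, embL_single,
      ContinuousLinearMap.smulRight_apply, map_smul, pd, pd, pd, fderivWithin_univ, smul_eq_mul,
      add_comm]
  · intro x hx
    exact (h.tendsto_trace hγ hf (hb x hx).1).comp hεlim'

end Approach

theorem GraphIdx.hkK {d N m : ℕ} {γ : ℝ≥0} {lam Lam M : ℝ} (s : GraphIdx d N m γ lam Lam M) :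
    s.k ∈ s.G.K := Graphs.Kminus_mem s.hk

section

variable {d N m : ℕ} {γ : ℝ≥0} {lam Lam M : ℝ}

/-- The graph as an index in `K₊`. -/
def GraphIdx.plus (s : GraphIdx d N m γ lam Lam M) : PlusIdx d N m γ lam Lam M :=
  { s.toSetting with k := s.k, hk := Graphs.mem_Kplus s.hkK }

/-- The subregion above the graph. -/
def GraphIdx.above (s : GraphIdx d N m γ lam Lam M) : StripIdx d N m γ lam Lam M :=
  { s.toSetting with k := s.k, hk := s.hkK }

/-- The subregion below the graph. -/
def GraphIdx.below (s : GraphIdx d N m γ lam Lam M) : StripIdx d N m γ lam Lam M :=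
  { s.toSetting with k := s.k - 1, hk := Graphs.Kminus_pred_mem s.adm s.hk }

theorem mem_interior_mid {G : Graphs d} (hG : G.Admissible) {k : ℤ} (hk : k ∈ G.K) {t : ℝ}
    {x : Pt d} (hx : x ∈ cube d 5) (h6 : |t| < 6) (h1 : G.φ k x < t) (h2 : t < G.φ (k + 1) x) :
    pt t x ∈ interior (G.strip 7 k ∩ Graphs.slab d) := by
  have hc : ∀ j ∈ G.Kplus, ContinuousOn (fun y : Pt (d + 1) => G.φ j (prime y)) (Graphs.slab d) :=
    fun j hj => (hG.continuousOn hj).comp continuous_prime.continuousOn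
      fun y hy => cube_mono (by norm_num) hy.2
  have h0 : ContinuousOn (fun y : Pt (d + 1) => y 0) (Graphs.slab d) :=
    (EuclideanSpace.proj (𝕜 := ℝ) (0 : Fin (d + 1))).continuous.continuousOn
  have o1 := (h0.sub (hc k (Graphs.mem_Kplus hk))).isOpen_inter_preimage (Graphs.isOpen_slab d)
    (isOpen_Ioi (a := (0 : ℝ)))
  have o2 := ((hc _ (Graphs.succ_mem_Kplus hk)).sub h0).isOpen_inter_preimage (Graphs.isOpen_slab d)
    (isOpen_Ioi (a := (0 : ℝ)))
  refine interior_maximal ?_ (o1.inter o2) ⟨⟨⟨by simpa using h6, by simpa using hx⟩, ?_⟩,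
    ⟨⟨by simpa using h6, by simpa using hx⟩, ?_⟩⟩
  · rintro y ⟨⟨hy, hy1⟩, -, hy2⟩
    simp only [mem_preimage, Pi.sub_apply, mem_Ioi, sub_pos] at hy1 hy2
    exact ⟨⟨mem_cube_iff.2 ⟨hy.1.trans (by norm_num), cube_mono (by norm_num) hy.2⟩, hy1, hy2.le⟩, hy⟩
  · simpa using h1
  · simpa using h2

theorem GraphIdx.lip (s : GraphIdx d N m γ lam Lam M) : ∀ x ∈ cube d 5, ∀ y ∈ cube d 5,
    |s.G.φ s.k x - s.G.φ s.k y| ≤ ‖x - y‖ := fun x hx y hy =>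
  (s.adm.abs_sub_le' (Graphs.mem_Kplus s.hkK) (cube_mono (by norm_num) hx)
    (cube_mono (by norm_num) hy)).trans (by linarith [norm_nonneg (x - y)])

/-- The gap is Lipschitz with constant 1/10, so on a ball of radius at most gap(x₀) it exceeds half
its value at the centre. -/
theorem approach_near {G : Graphs d} (hG : G.Admissible) {j : ℤ} (hj : j ∈ G.K) {x₀ : Pt d}
    (hx₀ : x₀ ∈ cube d 5) : ∃ r > 0, ∃ ε₀ > 0, ∀ x ∈ Metric.ball x₀ r, x ∈ cube d 5 ∧
      ∀ ε ∈ Ioo (0 : ℝ) ε₀, ε < 1 / 2 ∧ ε < G.gap j x := by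
  have h57 : cube d 5 ⊆ cube d 7 := cube_mono (by norm_num)
  have hg := Graphs.gap_pos hG hj (h57 hx₀)
  obtain ⟨r, hr, hb⟩ := Metric.isOpen_iff.1 (isOpen_cube d 5) x₀ hx₀
  refine ⟨min r (G.gap j x₀), lt_min hr hg, min (1 / 2) (G.gap j x₀ / 2), by positivity, ?_⟩
  intro x hx
  rw [Metric.mem_ball, lt_min_iff] at hx
  have hxc := hb (Metric.mem_ball.2 hx.1)
  refine ⟨hxc, fun ε hε => ?_⟩
  have h1 := lt_min_iff.1 hε.2
  have h2 := abs_le.1 (Graphs.abs_gap_sub_le hG hj (h57 hxc) (h57 hx₀))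
  rw [dist_eq_norm] at hx
  exact ⟨h1.1, by linarith⟩

theorem GraphIdx.approach_above (s : GraphIdx d N m γ lam Lam M) :
    Approach (s.G.φ s.k) (s.G.strip 7 s.k) 1 where
  abs_le := by simp
  differentiableAt x hx := s.adm.differentiableAt (Graphs.mem_Kplus s.hkK)
    (cube_mono (by norm_num) hx)
  lip := s.lip
  mem_slab x hx := Graphs.graphPt_mem_slab s.adm s.hk hx
  near x₀ hx₀ := by
    obtain ⟨r, hr, ε₀, hε₀, hb⟩ := approach_near s.adm s.hkK hx₀
    refine ⟨r, hr, ε₀, hε₀, fun x hx => ⟨(hb x hx).1, fun ε hε => ?_⟩⟩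
    obtain ⟨h1, h2⟩ := (hb x hx).2 ε hε
    have h3 := abs_lt.1 (Graphs.abs_graph_lt s.adm s.hk (hb x hx).1)
    have h4 : 0 < ε := hε.1
    simp only [Graphs.gap] at h2
    refine mem_interior_mid s.adm s.hkK (hb x hx).1 ?_ (by linarith) (by linarith)
    rw [abs_lt]; constructor <;> linarith

theorem GraphIdx.approach_below (s : GraphIdx d N m γ lam Lam M) :
    Approach (s.G.φ s.k) (s.G.strip 7 (s.k - 1)) (-1) where
  abs_le := by simp
  differentiableAt x hx := s.adm.differentiableAt (Graphs.mem_Kplus s.hkK)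
    (cube_mono (by norm_num) hx)
  lip := s.lip
  mem_slab x hx := Graphs.graphPt_mem_slab s.adm s.hk hx
  near x₀ hx₀ := by
    obtain ⟨r, hr, ε₀, hε₀, hb⟩ := approach_near s.adm (Graphs.Kminus_pred_mem s.adm s.hk) hx₀
    refine ⟨r, hr, ε₀, hε₀, fun x hx => ⟨(hb x hx).1, fun ε hε => ?_⟩⟩
    obtain ⟨h1, h2⟩ := (hb x hx).2 ε hε
    have h3 := abs_lt.1 (Graphs.abs_graph_lt s.adm s.hk (hb x hx).1)
    have h4 : 0 < ε := hε.1
    simp only [Graphs.gap, sub_add_cancel] at h2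
    refine mem_interior_mid s.adm (Graphs.Kminus_pred_mem s.adm s.hk) (hb x hx).1 ?_ (by linarith)
      (by rw [sub_add_cancel]; linarith)
    rw [abs_lt]; constructor <;> linarith

theorem uc_φ_graph (hγ : γ ≤ 1) :
    UC γ (fun _ : GraphIdx d N m γ lam Lam M => cube d 5) (fun _ => 1) (m + 1)
      fun s => s.G.φ s.k := (uc_φ hγ).comp_index GraphIdx.plus

/-- Traces on a graph of functions with uniform bounds on an adjacent subregion. -/
theorem UC.trace (hγ0 : 0 < γ) (hγ : γ ≤ 1) (e : GraphIdx d N m γ lam Lam M → StripIdx d N m γ lam Lam M)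
    {σ : ℝ} (he : ∀ s, Approach (s.G.φ s.k) ((e s).G.strip 7 (e s).k) σ) {r : ℕ} (hr : r ≤ m)
    {f : StripIdx d N m γ lam Lam M → Pt (d + 1) → ℝ}
    (hf : UC γ (fun s => s.G.mid s.k) (fun s => s.E s.k) r f) :
    UC γ (fun _ => cube d 5) (fun s => (e s).E (e s).k) r
      fun s x => extendFrom ((e s).G.strip 7 (e s).k) (f (e s)) (s.G.graphPt s.k x) := by
  have hbase : ∀ {f : StripIdx d N m γ lam Lam M → Pt (d + 1) → ℝ},
      UHB γ (fun s => s.G.mid s.k) (fun s => s.E s.k) f →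
      UHB γ (fun _ => cube d 5) (fun s => (e s).E (e s).k)
      fun s x => extendFrom ((e s).G.strip 7 (e s).k) (f (e s)) (s.G.graphPt s.k x) := by
    rintro f ⟨C, hC, h⟩
    refine ⟨2 * C, by positivity, fun s => ?_⟩
    rw [mul_assoc]
    exact (he s).hb_trace hγ0 (by exact_mod_cast hγ) (mul_nonneg hC ((e s).E_nonneg _)) (h (e s))
  induction r generalizing f with
  | zero => exact hbase hf
  | succ r ih =>
    have hder : ∀ s, ∀ x ∈ cube d 5, HasFDerivAt
        (fun x => extendFrom ((e s).G.strip 7 (e s).k) (f (e s)) (s.G.graphPt s.k x))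
        (∑ b, (EuclideanSpace.proj (𝕜 := ℝ) b : Pt d →L[ℝ] ℝ).smulRight
        (extendFrom ((e s).G.strip 7 (e s).k) (pd ((e s).G.mid (e s).k) b.succ (f (e s)))
          (s.G.graphPt s.k x) + pd univ b (s.G.φ s.k) x * extendFrom ((e s).G.strip 7 (e s).k)
            (pd ((e s).G.mid (e s).k) 0 (f (e s))) (s.G.graphPt s.k x))) x := by
      intro s x hx
      obtain ⟨C, hC, h⟩ := hf.1
      choose D hD h' using fun α => (hf.2.2 α).uhb
      set B := (C + ∑ α, D α) * (e s).E (e s).k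
      have hE := (e s).E_nonneg (e s).k
      have hDs : ∀ α, D α ≤ ∑ α, D α := fun α =>
        Finset.single_le_sum (fun α _ => hD α) (Finset.mem_univ α)
      have hmono : ∀ {A B : ℝ} {g : Pt (d + 1) → ℝ}, A ≤ B → HB γ ((e s).G.mid (e s).k) A g →
          HB γ ((e s).G.mid (e s).k) B g := fun hAB hg => ⟨fun x hx => (hg.1 x hx).trans hAB,
        fun x hx y hy => (hg.2 x hx y hy).trans (mul_le_mul_of_nonneg_right hAB (by positivity))⟩
      have hsum : 0 ≤ ∑ α, D α := Finset.sum_nonneg fun α _ => hD α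
      refine (he s).hasFDerivAt_trace hγ0 (C := B) (by positivity)
        (hmono (mul_le_mul_of_nonneg_right (by linarith) hE) (h (e s)))
        (hf.2.1 (e s)) (fun α => hmono (mul_le_mul_of_nonneg_right (by linarith [hDs α]) hE)
          (h' α (e s))) hx
    refine ⟨hbase hf.1, fun s x hx => (hder s x hx).differentiableAt.differentiableWithinAt,
      fun b => ?_⟩
    have hφ : UC γ (fun _ : GraphIdx d N m γ lam Lam M => cube d 5) (fun _ => 1) r
        fun s => pd (cube d 5) b (s.G.φ s.k) := ((uc_φ_graph hγ).2.2 b).of_le (by omega)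
    have hS : ∀ _ : GraphIdx d N m γ lam Lam M, UniqueDiffOn ℝ (cube d 5) :=
      fun _ => uniqueDiffOn_cube d 5
    -- The tangential derivative is again built from traces, of functions with one derivative fewer,
    -- and from Dφ, which has m bounded derivatives.
    refine ((ih (by omega) (hf.2.2 b.succ)).add hS
      (hφ.mul hS (ih (by omega) (hf.2.2 0)))).congr fun s x hx => ?_
    have hn := (isOpen_cube d 5).mem_nhds hx
    simp only [pd, fderivWithin_of_mem_nhds hn, (hder s x hx).fderiv, fderivWithin_univ]
    simp [sum_apply]

end

end

section

/-! ### The jump terms G are of lower order, uniformly in the number of graphs. -/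

variable {d N m : ℕ} {γ : ℝ≥0} {lam Lam M : ℝ}

theorem sum_sub_le {d : ℕ} {p q : Fin d → ℕ} (h : q ≤ p) : ∑ b, (p - q) b + order q = order p := by
  rw [order, order, ← Finset.sum_add_distrib]
  exact Finset.sum_congr rfl fun b _ => Nat.sub_add_cancel (h b)

theorem order_pos {d : ℕ} {q : Fin d → ℕ} (h : 0 < q) : 0 < order q := by
  obtain ⟨-, b, hb⟩ := Pi.lt_def.1 h
  exact Finset.sum_pos' (fun _ _ => Nat.zero_le _) ⟨b, Finset.mem_univ b, hb⟩

theorem wd_univ_eq {n : ℕ} {O : Set (Pt n)} (hO : IsOpen O) {V : Type*} [NormedAddCommGroup V]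
    [NormedSpace ℝ V] (l : List (Fin n)) (f : Pt n → V) : EqOn (wd univ l f) (wd O l f) O := by
  have := wd_inter (S := univ) hO f l
  rw [univ_inter] at this
  exact this.symm

theorem uniqueDiffOn_base : ∀ _ : GraphIdx d N m γ lam Lam M, UniqueDiffOn ℝ (cube d 5) :=
  fun _ => uniqueDiffOn_cube d 5

/-- The sum of the data norms on the two sides of a graph. -/
def GraphIdx.W (s : GraphIdx d N m γ lam Lam M) : ℝ := s.E (s.k - 1) + s.E s.k

theorem uc_jump (hγ0 : 0 < γ) (hγ : γ ≤ 1) {f : Setting d N m γ lam Lam M → ℤ → Pt (d + 1) → ℝ}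
    (ξ : Fin (d + 1) → ℕ) {r : ℕ} (hr : r ≤ m)
    (hf : UC γ (fun s : StripIdx d N m γ lam Lam M => s.G.mid s.k) (fun s => s.E s.k)
      (r + ∑ α, ξ α) fun s => f s.toSetting s.k) :
    UC γ (fun _ : GraphIdx d N m γ lam Lam M => cube d 5) GraphIdx.W r
      fun s => s.G.jump s.k ξ (f s.toSetting) := by
  have hw := UC.wd (word ξ) (by rwa [length_word])
  have h1 := UC.trace hγ0 hγ GraphIdx.below (fun s => s.approach_below) hr hw
  have h2 := UC.trace hγ0 hγ GraphIdx.above (fun s => s.approach_above) hr hw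
  have h1' : UC γ (fun _ : GraphIdx d N m γ lam Lam M => cube d 5) GraphIdx.W r _ :=
    h1.mono_weight fun s => le_add_of_nonneg_right (s.E_nonneg s.k)
  have h2' : UC γ (fun _ : GraphIdx d N m γ lam Lam M => cube d 5) GraphIdx.W r _ :=
    h2.mono_weight fun s => le_add_of_nonneg_left (s.E_nonneg (s.k - 1))
  refine (h1'.sub uniqueDiffOn_base h2').congr fun s x hx => ?_
  simp only [Graphs.jump, Graphs.trace, mpd_eq_wd]
  congr 1
  · exact s.approach_below.extendFrom_congr
      (wd_inter (Graphs.isOpen_slab d) (f s.toSetting (s.k - 1)) (word ξ)).symm hx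
  · exact s.approach_above.extendFrom_congr
      (wd_inter (Graphs.isOpen_slab d) (f s.toSetting s.k) (word ξ)).symm hx

theorem GraphIdx.T_graphPt (s : GraphIdx d N m γ lam Lam M) {x : Pt d} (hx : x ∈ cube d 5) :
    s.G.T (s.k - 1) (s.G.graphPt s.k x) = 1 := by
  have := s.lt (s.k - 1) (Graphs.Kminus_pred_mem s.adm s.hk) x (cube_mono (by norm_num) hx)
  rw [sub_add_cancel] at this
  simp only [Graphs.T, Graphs.graphPt, prime_pt, pt_zero_apply, sub_add_cancel]
  exact div_self (sub_pos.2 this).ne'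

/-- On a graph the interpolation between neighbouring slopes disappears, since T = 1 there. Hence π
on a graph is as smooth as Dφ_k, although in the strip it is merely Hölder continuous uniformly. -/
theorem GraphIdx.vpi_succ_graphPt (s : GraphIdx d N m γ lam Lam M) {x : Pt d} (hx : x ∈ cube d 5)
    (b : Fin d) : s.G.vpi b.succ (s.G.graphPt s.k x) = pd univ b (s.G.φ s.k) x := by
  simp only [Graphs.vpi, Fin.cases_succ]
  rw [Graphs.glue_apply s.adm _ (Graphs.Kminus_pred_mem s.adm s.hk)
    (Graphs.graphPt_mem_strip s.adm s.hk hx), s.T_graphPt hx]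
  simp [Graphs.dφ, Graphs.graphPt]

theorem GraphIdx.flow_graphPt (s : GraphIdx d N m γ lam Lam M) {x : Pt d} (hx : x ∈ cube d 5)
    (t : Pt d) : s.G.flow (s.G.graphPt s.k x) t = s.G.φ s.k (x + t) - s.G.φ s.k x := by
  simp only [Graphs.flow]
  rw [Graphs.glue_apply s.adm _ (Graphs.Kminus_pred_mem s.adm s.hk)
    (Graphs.graphPt_mem_strip s.adm s.hk hx), s.T_graphPt hx]
  simp [Graphs.graphPt]

theorem uc_dφ (hγ : γ ≤ 1) (b : Fin d) :
    UC γ (fun _ : GraphIdx d N m γ lam Lam M => cube d 5) (fun _ => 1) m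
      fun s => pd univ b (s.G.φ s.k) :=
  ((uc_φ_graph hγ).2.2 b).congr fun s => by
    have := wd_univ_eq (isOpen_cube d 5) [b] (s.G.φ s.k)
    exact this

theorem uc_vpi_graph (hγ : γ ≤ 1) (α : Fin (d + 1)) :
    UC γ (fun _ : GraphIdx d N m γ lam Lam M => cube d 5) (fun _ => 1) m
      fun s x => s.G.vpi α (s.G.graphPt s.k x) := by
  refine Fin.cases ?_ (fun b => ?_) α
  · exact (UC.const (-1)).congr fun s x _ => rfl
  · exact (uc_dφ hγ b).congr fun s x hx => s.vpi_succ_graphPt hx b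

theorem uc_vpiPow_graph (hγ : γ ≤ 1) (q : Fin d → ℕ) :
    UC γ (fun _ : GraphIdx d N m γ lam Lam M => cube d 5) (fun _ => 1) m
      fun s x => s.G.vpiPow q (s.G.graphPt s.k x) :=
  UC.prod uniqueDiffOn_base _ fun b _ => (uc_vpi_graph hγ b.succ).pow uniqueDiffOn_base (q b)

theorem wd_comp_add {n : ℕ} (l : List (Fin n)) (h : Pt n → ℝ) (x : Pt n) :
    wd univ l (fun t => h (x + t)) = fun t => wd univ l h (x + t) := by
  induction l with
  | nil => rfl
  | cons α l ih =>
    rw [wd_cons, ih]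
    funext t
    simp only [pd, fderivWithin_univ, wd_cons]
    rw [fderiv_comp_add_left]

/-- On the graph the flow is φ(x + t) - φ(x). Expanding its power separates the frozen φ(x) from
derivatives of powers of φ of order at most m. As φ has m + 1 bounded derivatives, one is left over,
which `oph` needs. -/
theorem uc_P_graph (hγ : γ ≤ 1) (p : Fin d → ℕ) (hp : order p = m) (ξ : Fin (d + 1) → ℕ) :
    UC γ (fun _ : GraphIdx d N m γ lam Lam M => cube d 5) (fun _ => 1) 1
      fun s x => s.G.P p ξ (s.G.graphPt s.k x) := by
  set a := ξ 0 with ha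
  set l := word (p - Fin.tail ξ) with hl
  have hlen : l.length ≤ m := by
    rw [hl, length_word, ← hp]
    exact Finset.sum_le_sum fun b _ => Nat.sub_le _ _
  have hφ : UC γ (fun _ : GraphIdx d N m γ lam Lam M => cube d 5) (fun _ => 1) (m + 1)
      fun s => s.G.φ s.k := uc_φ_graph hγ
  have hc : ∀ s : GraphIdx d N m γ lam Lam M, ContDiffOn ℝ l.length (s.G.φ s.k) (cube d 5) :=
    fun s => ((s.holder_φ s.k (Graphs.mem_Kplus s.hkK)).1.1.mono
      (cube_mono (by norm_num))).of_le (by exact_mod_cast (by omega : l.length ≤ m + 1))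
  have hterm : ∀ j ∈ Finset.range (a + 1), UC γ (fun _ : GraphIdx d N m γ lam Lam M => cube d 5)
      (fun _ => 1) 1 fun s x => ((-(s.G.φ s.k x)) ^ (a - j) * (a.choose j : ℝ)) *
        wd (cube d 5) l (fun y => s.G.φ s.k y ^ j) x := by
    intro j _
    have h1 : UC γ (fun _ : GraphIdx d N m γ lam Lam M => cube d 5) (fun _ => 1) 1
        fun s => wd (cube d 5) l (fun y => s.G.φ s.k y ^ j) :=
      UC.wd l ((hφ.pow uniqueDiffOn_base j).of_le (by omega))
    have h2 := ((hφ.neg uniqueDiffOn_base).pow uniqueDiffOn_base (a - j)).of_le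
      (by omega : 1 ≤ m + 1)
    exact (h2.mul uniqueDiffOn_base (UC.const _)).mul uniqueDiffOn_base h1
  refine (((UC.sum uniqueDiffOn_base _ hterm).const_mul uniqueDiffOn_base
    (binom p (Fin.tail ξ) / (a.factorial : ℝ)))).congr fun s x hx => ?_
  simp only [Graphs.P]
  congr 1
  simp only [s.flow_graphPt hx, mpd_eq_wd]
  rw [wd_comp_add l (fun y => (s.G.φ s.k y - s.G.φ s.k x) ^ a) x]
  simp only [add_zero]
  rw [wd_univ_eq (isOpen_cube d 5) l _ hx]
  have e : (fun y => (s.G.φ s.k y - s.G.φ s.k x) ^ a) = fun y => ∑ j ∈ Finset.range (a + 1),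
      ((-(s.G.φ s.k x)) ^ (a - j) * (a.choose j : ℝ)) * s.G.φ s.k y ^ j := by
    funext y
    rw [sub_eq_add_neg, add_pow]
    exact Finset.sum_congr rfl fun j _ => by ring
  rw [e, wd_sum (uniqueDiffOn_cube d 5) _ (fun j _ => contDiffOn_const.mul ((hc s).pow j)) hx]
  exact Finset.sum_congr rfl fun j _ =>
    wd_const_mul (uniqueDiffOn_cube d 5) _ ((hc s).pow j) hx

/-- Only m - 1 derivatives of the flux jump occur: |ξ| < m in the first sum, and q ≠ 0 in the
second. -/
theorem uhb_opg (hγ0 : 0 < γ) (hγ : γ ≤ 1) (hm : 1 ≤ m) (p : Fin d → ℕ) (hp : order p = m)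
    (α : Fin (d + 1)) {f : Setting d N m γ lam Lam M → ℤ → Pt (d + 1) → ℝ}
    (hf : UC γ (fun s : StripIdx d N m γ lam Lam M => s.G.mid s.k) (fun s => s.E s.k)
      (m - 1) fun s => f s.toSetting s.k) :
    UHB γ (fun _ : GraphIdx d N m γ lam Lam M => cube d 5) GraphIdx.W
      fun s => s.G.opg p s.k α (f s.toSetting) := by
  refine UHB.add (UHB.sum _ fun j hj => UHB.sum _ fun ξ hξ => ?_) (UHB.sum _ fun q hq => ?_)
  · have hξ' : ∑ β, ξ β = j := (Finset.mem_piAntidiag.1 hξ).1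
    rw [Finset.mem_range, hp] at hj
    have h1 := uc_jump hγ0 hγ ξ (Nat.zero_le m) (hf.of_le (by omega))
    exact ((uc_vpi_graph hγ α).uhb.mul (uc_P_graph hγ p hp ξ).uhb).mul h1.uhb
  · obtain ⟨hq0, hqp⟩ := Finset.mem_Ioc.1 hq
    have hqo := order_pos hq0
    have hs := sum_sub_le hqp
    have h1 : UHB γ (fun _ : GraphIdx d N m γ lam Lam M => cube d 5) (fun _ => 1)
        fun s => mpd univ q (s.G.dφ s.k α) := by
      refine Fin.cases ?_ (fun b => ?_) α
      · have : UC γ (fun _ : GraphIdx d N m γ lam Lam M => cube d 5) (fun _ => 1)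
          (0 + (word q).length) fun _ _ => 0 := UC.const 0
        exact (UC.wd (word q) this).uhb.congr fun s x hx => by
          rw [mpd_eq_wd]
          exact wd_univ_eq (isOpen_cube d 5) _ _ hx
      · have : UC γ (fun _ : GraphIdx d N m γ lam Lam M => cube d 5) (fun _ => 1)
          (0 + (word q).length) fun s => pd univ b (s.G.φ s.k) := (uc_dφ hγ b).of_le (by
            rw [length_word]; change 0 + order q ≤ m; omega)
        exact (UC.wd (word q) this).uhb.congr fun s x hx => by
          rw [mpd_eq_wd]
          exact wd_univ_eq (isOpen_cube d 5) _ _ hx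
    have h2 : UHB γ (fun _ : GraphIdx d N m γ lam Lam M => cube d 5) GraphIdx.W
        fun s => mpd univ (p - q) (s.G.jump s.k 0 (f s.toSetting)) := by
      have := uc_jump hγ0 hγ 0 (r := 0 + (word (p - q)).length)
        (by rw [length_word]; omega) (hf.of_le (by
          rw [length_word]
          simp only [Pi.zero_apply, Finset.sum_const_zero]
          omega))
      exact (UC.wd (word (p - q)) this).uhb.congr fun s x hx => by
        rw [mpd_eq_wd]
        exact wd_univ_eq (isOpen_cube d 5) _ _ hx
    exact (h1.const_mul (binom p q)).mul h2

theorem uhb_pd_univ {f : GraphIdx d N m γ lam Lam M → Pt d → ℝ} {w : GraphIdx d N m γ lam Lam M → ℝ}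
    (hf : UC γ (fun _ => cube d 5) w 1 f) (b : Fin d) :
    UHB γ (fun _ => cube d 5) w fun s => pd univ b (f s) :=
  (hf.2.2 b).uhb.congr fun s => wd_univ_eq (isOpen_cube d 5) [b] (f s)

/-- Derivatives of order at most m of the jump of u occur: order exactly m undifferentiated in the
first sum, and order below m with one further tangential derivative in the second. -/
theorem uhb_oph (hγ0 : 0 < γ) (hγ : γ ≤ 1) (hm : 1 ≤ m) (p : Fin d → ℕ) (hp : order p = m)
    (b : Fin d) {f : Setting d N m γ lam Lam M → ℤ → Pt (d + 1) → ℝ}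
    (hf : UC γ (fun s : StripIdx d N m γ lam Lam M => s.G.mid s.k) (fun s => s.E s.k)
      m fun s => f s.toSetting s.k) :
    UHB γ (fun _ : GraphIdx d N m γ lam Lam M => cube d 5) GraphIdx.W
      fun s => s.G.oph p s.k b (f s.toSetting) := by
  refine UHB.add (UHB.sum _ fun q hq => ?_) (UHB.sum _ fun j hj => UHB.sum _ fun ξ hξ => ?_)
  · have hqp := (Finset.mem_Icc.1 hq).2
    have hs := sum_sub_le hqp
    have h1 := uhb_pd_univ ((uc_vpiPow_graph (N := N) (m := m) (lam := lam) (Lam := Lam) (M := M)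
      hγ q).of_le hm) b
    have h2 := uc_jump hγ0 hγ (mi (order q) (p - q)) (Nat.zero_le m) (hf.of_le (by
      simp only [mi, Fin.sum_univ_succ, Fin.cons_zero, Fin.cons_succ]
      omega))
    exact (h1.const_mul (binom p q)).mul h2.uhb
  · have hξ' : ∑ β, ξ β = j := (Finset.mem_piAntidiag.1 hξ).1
    rw [Finset.mem_range, hp] at hj
    have h1 := uc_jump hγ0 hγ ξ hm (hf.of_le (by omega))
    exact uhb_pd_univ ((uc_P_graph hγ p hp ξ).mul uniqueDiffOn_base h1) b

theorem StripIdx.heaviside_eq (s : StripIdx d N m γ lam Lam M) {x : Pt (d + 1)}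
    (hx : x ∈ s.G.strip 7 s.k) (l : ℤ) : s.G.heaviside l x = if l ≤ s.k then 1 else 0 := by
  classical
  unfold Graphs.heaviside
  refine if_congr ⟨?_, fun h => ⟨s.k, s.hk, h, hx⟩⟩ rfl rfl
  rintro ⟨j, hj, hlj, hxj⟩
  rwa [← Graphs.mem_strip_unique s.adm hj s.hk hxj hx]

/-- Each strip is counted at most twice, once for each of its bounding graphs. This makes the
constants independent of the number of graphs. -/
theorem Setting.sum_E_le (s : Setting d N m γ lam Lam M) :
    ∑ l ∈ s.G.Kminus, (s.E (l - 1) + s.E l) ≤ 2 * s.Etot := by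
  rw [Finset.sum_add_distrib, two_mul, s.Etot_eq]
  refine add_le_add ?_ ?_
  · rw [← Finset.sum_image (f := s.E) (g := fun l => l - 1) (s := s.G.Kminus)
      (fun a _ b _ h => by simpa using h)]
    refine Finset.sum_le_sum_of_subset_of_nonneg ?_ fun k _ _ => s.E_nonneg k
    intro k hk
    obtain ⟨l, hl, rfl⟩ := Finset.mem_image.1 hk
    exact Graphs.Kminus_pred_mem s.adm hl
  · exact Finset.sum_le_sum_of_subset_of_nonneg (fun k hk => Graphs.Kminus_mem hk)
      fun k _ _ => s.E_nonneg k

/-- Superposition of functions on the graphs. -/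
theorem uhb_sum_graphs {op : Setting d N m γ lam Lam M → ℤ → Pt d → ℝ}
    (h : UHB γ (fun _ : GraphIdx d N m γ lam Lam M => cube d 5) GraphIdx.W
      fun s => op s.toSetting s.k) :
    UHB γ (fun s : StripIdx d N m γ lam Lam M => s.G.strip 5 s.k) (fun s => s.Etot)
      fun s x => ∑ l ∈ s.G.Kminus, op s.toSetting l (prime x) * s.G.heaviside l x := by
  obtain ⟨C, hC, h⟩ := h
  have key : ∀ s : StripIdx d N m γ lam Lam M, ∀ l ∈ s.G.Kminus,
      HB γ (cube d 5) (C * (s.E (l - 1) + s.E l)) (op s.toSetting l) := fun s l hl =>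
    h { s.toSetting with k := l, hk := hl }
  have hh : ∀ s : StripIdx d N m γ lam Lam M, ∀ l, ∀ x ∈ s.G.strip 5 s.k,
      s.G.heaviside l x = if l ≤ s.k then 1 else 0 := fun s l x hx =>
    s.heaviside_eq (Graphs.strip_mono (by norm_num) _ hx) l
  refine ⟨2 * C, by positivity, fun s => ⟨fun x hx => ?_, fun x hx y hy => ?_⟩⟩
  · refine (Finset.abs_sum_le_sum_abs _ _).trans ?_
    have : ∀ l ∈ s.G.Kminus, |op s.toSetting l (prime x) * s.G.heaviside l x| ≤
        C * (s.E (l - 1) + s.E l) := fun l hl => by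
      have h1 := (key s l hl).1 _ (prime_mem_cube hx.1)
      rw [hh s l x hx]
      split_ifs
      · simpa using h1
      · simpa using (abs_nonneg _).trans h1
    refine (Finset.sum_le_sum this).trans ?_
    rw [← Finset.mul_sum]
    nlinarith [mul_le_mul_of_nonneg_left s.sum_E_le hC]
  · rw [← Finset.sum_sub_distrib]
    refine (Finset.abs_sum_le_sum_abs _ _).trans ?_
    have : ∀ l ∈ s.G.Kminus, |op s.toSetting l (prime x) * s.G.heaviside l x -
        op s.toSetting l (prime y) * s.G.heaviside l y| ≤
        C * (s.E (l - 1) + s.E l) * ‖x - y‖ ^ (γ : ℝ) := fun l hl => by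
      have h1 := (key s l hl).2 _ (prime_mem_cube hx.1) _ (prime_mem_cube hy.1)
      have hE : 0 ≤ C * (s.E (l - 1) + s.E l) :=
        mul_nonneg hC (add_nonneg (s.E_nonneg _) (s.E_nonneg _))
      -- The points lie in the same strip, so the Heaviside factors coincide and produce no jump.
      rw [hh s l x hx, hh s l y hy]
      split_ifs
      · rw [mul_one, mul_one]
        refine h1.trans (mul_le_mul_of_nonneg_left ?_ hE)
        rw [← prime_sub]
        exact Real.rpow_le_rpow (norm_nonneg _) (norm_prime_le _) γ.coe_nonneg
      · simpa using mul_nonneg hE (by positivity)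
    refine (Finset.sum_le_sum this).trans ?_
    rw [← Finset.sum_mul, ← Finset.mul_sum]
    refine mul_le_mul_of_nonneg_right ?_ (by positivity)
    nlinarith [mul_le_mul_of_nonneg_left s.sum_E_le hC]

theorem uhb_bigG (hγ0 : 0 < γ) (hγ : γ ≤ 1) (hm : 1 ≤ m) (p : Fin d → ℕ) (hp : order p = m)
    (i : Fin N) (α : Fin (d + 1)) :
    UHB γ (fun s : StripIdx d N m γ lam Lam M => s.G.strip 5 s.k) (fun s => s.Etot)
      fun s => s.G.bigG s.A s.F s.u p i α := by
  refine Fin.cases ?_ (fun b => ?_) α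
  · refine (uhb_sum_graphs
      (op := fun s l x => ∑ α', s.G.opg p l α' (s.G.flux s.A s.F s.u i α') x)
      (UHB.sum _ fun α' _ => uhb_opg hγ0 hγ hm p hp α'
        (f := fun s => s.G.flux s.A s.F s.u i α') (uc_flux hγ i α' (by omega)))).congr
      fun s x _ => ?_
    simp only [Graphs.bigG, Fin.cases_zero, Finset.sum_mul]
  · exact uhb_sum_graphs (op := fun s l x => s.G.oph p l b (fun _ y => s.u y i) x)
      (uhb_oph hγ0 hγ hm p hp b (f := fun s _ y => s.u y i) (uc_u hγ i))

end

section

/-! ### Weak formulations and classical derivatives on open sets. -/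

section TestFunctions

variable {n : ℕ} {O : Set (Pt n)} {η : Pt n → ℝ}

theorem fderiv_eq_zero_of_notMem {x : Pt n} (hx : x ∉ tsupport η) (v : Pt n) :
    fderiv ℝ η x v = 0 := by
  have : fderiv ℝ η x = 0 := by
    by_contra h
    exact hx (support_fderiv_subset ℝ h)
  simp [this]

theorem continuous_mul_of_tsupport (hO : IsOpen O) {v θ : Pt n → ℝ} (hv : ContinuousOn v O)
    (hθ : Continuous θ) (hs : tsupport θ ⊆ O) : Continuous fun x => v x * θ x := by
  refine continuous_of_tsupport fun x hx => ?_
  have hx' : x ∈ tsupport θ := closure_mono (fun y hy => right_ne_zero_of_mul hy) hx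
  exact (hv.continuousAt (hO.mem_nhds (hs hx'))).mul hθ.continuousAt

theorem integrable_mul_of_tsupport (hO : IsOpen O) {v θ : Pt n → ℝ} (hv : ContinuousOn v O)
    (hθ : Continuous θ) (hc : HasCompactSupport θ) (hs : tsupport θ ⊆ O) :
    Integrable fun x => v x * θ x :=
  (continuous_mul_of_tsupport hO hv hθ hs).integrable_of_hasCompactSupport hc.mul_left

theorem continuous_fderiv_test (hη : ContDiff ℝ ∞ η) (e : Pt n) :
    Continuous fun x => fderiv ℝ η x e :=
  (hη.continuous_fderiv (by simp)).clm_apply continuous_const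

theorem tsupport_fderiv_test (e : Pt n) : tsupport (fun x => fderiv ℝ η x e) ⊆ tsupport η :=
  closure_minimal (fun x hx => by
    by_contra h
    exact hx (fderiv_eq_zero_of_notMem h e)) (isClosed_tsupport η)

theorem hasCompactSupport_fderiv_test (hc : HasCompactSupport η) (e : Pt n) :
    HasCompactSupport fun x => fderiv ℝ η x e :=
  hc.of_isClosed_subset (isClosed_tsupport _) (tsupport_fderiv_test e)

/-- Integration by parts needs `v` only near the support of η, so its values outside O are
irrelevant. -/
theorem integral_mul_fderiv_test (hO : IsOpen O) {v : Pt n → ℝ} (hv : ContDiffOn ℝ 1 v O)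
    (hη : ContDiff ℝ ∞ η) (hc : HasCompactSupport η) (hs : tsupport η ⊆ O) (e : Pt n) :
    ∫ x, v x * fderiv ℝ η x e = - ∫ x, fderiv ℝ v x e * η x := by
  have hd : ContinuousOn (fun x => fderiv ℝ v x e) O :=
    (hv.continuousOn_fderiv_of_isOpen hO le_rfl).clm_apply continuousOn_const
  refine integral_mul_fderiv_eq_neg_fderiv_mul_of_integrable ?_ ?_ ?_ (fun x hx => ?_) fun x _ => ?_
  · exact integrable_mul_of_tsupport hO hd hη.continuous hc hs
  · exact integrable_mul_of_tsupport hO hv.continuousOn (continuous_fderiv_test hη e)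
      (hasCompactSupport_fderiv_test hc e) ((tsupport_fderiv_test e).trans hs)
  · exact integrable_mul_of_tsupport hO hv.continuousOn hη.continuous hc hs
  · exact (hv.differentiableOn (by norm_num) x (hs hx)).differentiableAt (hO.mem_nhds (hs hx))
  · exact hη.contDiffAt.differentiableAt (by simp)

/-- A weak gradient agrees with the classical one where the function is `C¹`. -/
theorem IsWeakGradient.ae_eq {N : ℕ} {S : Set (Pt n)} {u : Pt n → Pt N} {g : Pt n → Mat N n}
    (hg : IsWeakGradient S u g) (hO : IsOpen O) (hOS : O ⊆ S) (hfin : volume S ≠ ⊤)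
    (hgL : MemLp g 2 (volume.restrict S)) (i : Fin N) (hu : ContDiffOn ℝ 1 (fun x => u x i) O)
    (α : Fin n) : ∀ᵐ x, x ∈ O →
      g x (i, α) - fderiv ℝ (fun x => u x i) x (EuclideanSpace.single α 1) = 0 := by
  have hfin' : IsFiniteMeasure (volume.restrict S) := ⟨by simpa using hfin.lt_top⟩
  have hgi : IntegrableOn (fun x => g x (i, α)) S := by
    have := (EuclideanSpace.proj (𝕜 := ℝ) (i, α)).integrable_comp
      (hgL.integrable (by norm_num : (1 : ℝ≥0∞) ≤ 2))
    exact this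
  have hd : ContinuousOn (fun x => fderiv ℝ (fun x => u x i) x (EuclideanSpace.single α 1)) O :=
    (hu.continuousOn_fderiv_of_isOpen hO le_rfl).clm_apply continuousOn_const
  refine hO.ae_eq_zero_of_integral_contDiff_smul_eq_zero ?_ fun η hη hc hs => ?_
  · exact ((hgi.mono_set hOS).locallyIntegrableOn).sub (hd.locallyIntegrableOn hO.measurableSet)
  · have h1 := hg i α η hη hc (hs.trans hOS)
    have hz : ∀ x, x ∉ S → η x = 0 := fun x hx => by
      by_contra h
      exact hx (hOS (hs (subset_tsupport η h)))
    rw [setIntegral_eq_integral_of_forall_compl_eq_zero (fun x hx => by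
        rw [fderiv_eq_zero_of_notMem (fun h => hx (hOS (hs h))), mul_zero]),
      setIntegral_eq_integral_of_forall_compl_eq_zero (fun x hx => by
        rw [hz x hx, mul_zero]), integral_mul_fderiv_test hO hu hη hc hs] at h1
    have hi1 : Integrable fun x => g x (i, α) * η x := by
      have : IntegrableOn (fun x => g x (i, α) * η x) S := by
        obtain ⟨C, hC⟩ := hη.continuous.bounded_above_of_compact_support hc
        exact hgi.mul_bdd hη.continuous.aestronglyMeasurable (Filter.Eventually.of_forall hC)
      rw [integrableOn_iff_integrable_of_support_subset] at this
      · exact this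
      · intro x hx
        by_contra h
        exact hx (by simp [hz x h])
    have hi2 := integrable_mul_of_tsupport hO hd hη.continuous hc hs
    have e : (fun x => η x • (g x (i, α) - fderiv ℝ (fun x => u x i) x (EuclideanSpace.single α 1)))
        = fun x => g x (i, α) * η x - fderiv ℝ (fun x => u x i) x (EuclideanSpace.single α 1) * η x := by
      funext x; simp only [smul_eq_mul]; ring
    rw [e, integral_sub hi1 hi2]
    linarith

/-- A weak solution of an equation in divergence form with `C¹` flux solves it classically. -/
theorem sum_fderiv_eq_zero_of_weak (hO : IsOpen O) {U : Fin n → Pt n → ℝ}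
    (hU : ∀ α, ContDiffOn ℝ 1 (U α) O)
    (h : ∀ η : Pt n → ℝ, ContDiff ℝ ∞ η → HasCompactSupport η → tsupport η ⊆ O →
      ∫ x, ∑ α, U α x * fderiv ℝ η x (EuclideanSpace.single α 1) = 0) :
    ∀ x ∈ O, ∑ α, fderiv ℝ (U α) x (EuclideanSpace.single α 1) = 0 := by
  have hd : ContinuousOn (fun x => ∑ α, fderiv ℝ (U α) x (EuclideanSpace.single α 1)) O :=
    continuousOn_finsetSum _ fun α _ =>
      ((hU α).continuousOn_fderiv_of_isOpen hO le_rfl).clm_apply continuousOn_const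
  have hae : ∀ᵐ x, x ∈ O → ∑ α, fderiv ℝ (U α) x (EuclideanSpace.single α 1) = 0 := by
    refine hO.ae_eq_zero_of_integral_contDiff_smul_eq_zero
      (hd.locallyIntegrableOn hO.measurableSet) fun η hη hc hs => ?_
    have h1 := h η hη hc hs
    have hd' : ∀ α, ContinuousOn (fun x => fderiv ℝ (U α) x (EuclideanSpace.single α 1)) O :=
      fun α => ((hU α).continuousOn_fderiv_of_isOpen hO le_rfl).clm_apply continuousOn_const
    rw [integral_finsetSum _ fun α _ => integrable_mul_of_tsupport hO (hU α).continuousOn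
      (continuous_fderiv_test hη _) (hasCompactSupport_fderiv_test hc _)
      ((tsupport_fderiv_test _).trans hs)] at h1
    simp_rw [integral_mul_fderiv_test hO (hU _) hη hc hs] at h1
    have e : (fun x => η x • ∑ α, fderiv ℝ (U α) x (EuclideanSpace.single α 1))
        = fun x => ∑ α, fderiv ℝ (U α) x (EuclideanSpace.single α 1) * η x := by
      funext x; rw [smul_eq_mul, mul_comm, Finset.sum_mul]
    rw [e, integral_finsetSum _ fun α _ =>
      integrable_mul_of_tsupport hO (hd' α) hη.continuous hc hs]
    rw [Finset.sum_neg_distrib] at h1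
    linarith
  have hae' : (fun x => ∑ α, fderiv ℝ (U α) x (EuclideanSpace.single α 1))
      =ᵐ[volume.restrict O] fun _ => 0 :=
    (ae_restrict_iff' hO.measurableSet).2 hae
  -- A continuous function that vanishes almost everywhere on an open set vanishes there
  -- identically.
  exact Measure.eqOn_open_of_ae_eq hae' hO hd continuousOn_const

end TestFunctions

/-! ### The equation holds pointwise in each strip. -/

variable {d N m : ℕ} {γ : ℝ≥0} {lam Lam M : ℝ}

theorem volume_cube_ne_top (n : ℕ) (r : ℝ) : volume (cube n r) ≠ ⊤ := by
  have : Bornology.IsBounded (cube n r) := by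
    refine (Metric.isBounded_iff_subset_closedBall 0).2 ⟨∑ _ : Fin n, r, fun x hx => ?_⟩
    rw [mem_closedBall_zero_iff]
    conv_lhs => rw [← (EuclideanSpace.basisFun (Fin n) ℝ).sum_repr x]
    refine (norm_sum_le _ _).trans (Finset.sum_le_sum fun i _ => ?_)
    simpa [norm_smul] using (hx i).le
  exact this.measure_lt_top.ne

/-- The flux relative to `Q₅^k`. -/
def StripIdx.flux5 (s : StripIdx d N m γ lam Lam M) (i : Fin N) (α : Fin (d + 1))
    (x : Pt (d + 1)) : ℝ :=
  (∑ j, ∑ β, s.A s.k α β i j x * pd (s.G.strip 5 s.k) β (fun y => s.u y j) x) - s.F x (i, α)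

theorem StripIdx.contDiffOn_A (s : StripIdx d N m γ lam Lam M) (α β : Fin (d + 1)) (i j : Fin N) :
    ContDiffOn ℝ m (s.A s.k α β i j) (s.G.strip 5 s.k) :=
  (s.holder_A s.k s.hk α β i j).1.1.mono (subset_univ _)

theorem StripIdx.contDiffOn_u (s : StripIdx d N m γ lam Lam M) (j : Fin N) :
    ContDiffOn ℝ (m + 1 : ℕ) (fun y => s.u y j) (s.G.strip 5 s.k) :=
  (EuclideanSpace.proj (𝕜 := ℝ) j).contDiff.comp_contDiffOn (s.smooth s.k s.hk)

theorem StripIdx.contDiffOn_F (s : StripIdx d N m γ lam Lam M) (i : Fin N) (α : Fin (d + 1)) :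
    ContDiffOn ℝ m (fun y => s.F y (i, α)) (s.G.strip 5 s.k) :=
  (EuclideanSpace.proj (𝕜 := ℝ) (i, α)).contDiff.comp_contDiffOn
    ((s.holder_F s.k s.hk).1.mono (Graphs.strip_mono (by norm_num) _))

theorem StripIdx.contDiffOn_flux (s : StripIdx d N m γ lam Lam M) (i : Fin N) (α : Fin (d + 1)) :
    ContDiffOn ℝ m (s.flux5 i α) (s.G.strip 5 s.k) :=
  (ContDiffOn.sum fun j _ => ContDiffOn.sum fun β _ =>
    (s.contDiffOn_A α β i j).mul (contDiffOn_pd s.uniqueDiffOn_five (s.contDiffOn_u j) β)).sub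
    (s.contDiffOn_F i α)

/-- For test functions supported in the interior of one strip, the coefficients are those of the
strip and the weak gradient is the classical one. The flux is C^m with m ≥ 1, so its divergence
vanishes classically. -/
theorem StripIdx.pde_interior (s : StripIdx d N m γ lam Lam M) (i : Fin N) :
    ∀ x ∈ interior (s.G.strip 5 s.k),
      ∑ α, fderiv ℝ (s.flux5 i α) x (EuclideanSpace.single α 1) = 0 := by
  set S := s.G.strip 5 s.k with hS
  have hO : IsOpen (interior S) := isOpen_interior
  have hOS : interior S ⊆ S := interior_subset
  have hS7 : S ⊆ s.G.strip 7 s.k := Graphs.strip_mono (by norm_num) _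
  have hOc : interior S ⊆ cube (d + 1) 7 := fun x hx => (hS7 (hOS hx)).1
  have hm1 : (1 : WithTop ℕ∞) ≤ (m : ℕ) := by exact_mod_cast s.one_le
  obtain ⟨g, -, hgL, hg, hw⟩ := s.weak
  have hU : ∀ α, ContDiffOn ℝ 1 (s.flux5 i α) (interior S) := fun α =>
    ((s.contDiffOn_flux i α).of_le hm1).mono hOS
  have hu1 : ∀ j, ContDiffOn ℝ 1 (fun y => s.u y j) (interior S) := fun j =>
    ((s.contDiffOn_u j).of_le (by exact_mod_cast (by omega : 1 ≤ m + 1))).mono hOS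
  refine sum_fderiv_eq_zero_of_weak hO hU fun η hη hc hs => ?_
  have h1 := hw i η hη hc (hs.trans hOc)
  have hgae : ∀ᵐ x, ∀ j β, x ∈ interior S →
      g x (j, β) - fderiv ℝ (fun y => s.u y j) x (EuclideanSpace.single β 1) = 0 := by
    rw [ae_all_iff]; intro j
    rw [ae_all_iff]; intro β
    exact hg.ae_eq hO hOc (volume_cube_ne_top _ _) hgL j (hu1 j) β
  have hz : ∀ α x, x ∉ interior S → fderiv ℝ η x (EuclideanSpace.single α 1) = 0 :=
    fun α x hx => fderiv_eq_zero_of_notMem (fun h => hx (hs h)) _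
  have hpd : ∀ x ∈ interior S, ∀ j β, pd S β (fun y => s.u y j) x
      = fderiv ℝ (fun y => s.u y j) x (EuclideanSpace.single β 1) := fun x hx j β => by
    rw [pd, fderivWithin_of_mem_nhds (mem_interior_iff_mem_nhds.1 hx)]
  have e1 : ∫ x in cube (d + 1) 7, ∑ α, (∑ j, ∑ β, s.G.coeff s.A α β i j x * g x (j, β)) *
      fderiv ℝ η x (EuclideanSpace.single α 1) = ∫ x, ∑ α, (∑ j, ∑ β, s.A s.k α β i j x *
        pd S β (fun y => s.u y j) x) * fderiv ℝ η x (EuclideanSpace.single α 1) := by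
    rw [setIntegral_eq_integral_of_forall_compl_eq_zero fun x hx =>
      Finset.sum_eq_zero fun α _ => by rw [hz α x (fun h => hx (hOc h)), mul_zero]]
    refine integral_congr_ae (hgae.mono fun x hx => ?_)
    refine Finset.sum_congr rfl fun α _ => ?_
    by_cases hxO : x ∈ interior S
    · congr 1
      refine Finset.sum_congr rfl fun j _ => Finset.sum_congr rfl fun β _ => ?_
      rw [hpd x hxO, ← sub_eq_zero.1 (hx j β hxO), Graphs.coeff,
        Graphs.glue_apply s.adm _ s.hk (hS7 (hOS hxO))]
    · rw [hz α x hxO, mul_zero, mul_zero]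
  rw [e1, setIntegral_eq_integral_of_forall_compl_eq_zero fun x hx =>
      Finset.sum_eq_zero fun α _ => by rw [hz α x (fun h => hx (hOc h)), mul_zero]] at h1
  have hAu : ∀ α, ContinuousOn (fun x => ∑ j, ∑ β, s.A s.k α β i j x *
      pd S β (fun y => s.u y j) x) (interior S) := fun α =>
    (continuousOn_finsetSum _ fun j _ => continuousOn_finsetSum _ fun β _ =>
      (s.contDiffOn_A α β i j).continuousOn.mul
        (contDiffOn_pd s.uniqueDiffOn_five (s.contDiffOn_u j) β).continuousOn).mono hOS
  have hF : ∀ α, ContinuousOn (fun x => s.F x (i, α)) (interior S) := fun α =>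
    (s.contDiffOn_F i α).continuousOn.mono hOS
  have hi : ∀ v : Pt (d + 1) → ℝ, ContinuousOn v (interior S) → ∀ α, Integrable fun x =>
      v x * fderiv ℝ η x (EuclideanSpace.single α 1) := fun v hv α =>
    integrable_mul_of_tsupport hO hv (continuous_fderiv_test hη _)
      (hasCompactSupport_fderiv_test hc _) ((tsupport_fderiv_test _).trans hs)
  have e2 : (fun x => ∑ α, s.flux5 i α x * fderiv ℝ η x (EuclideanSpace.single α 1)) = fun x =>
      (∑ α, (∑ j, ∑ β, s.A s.k α β i j x * pd S β (fun y => s.u y j) x) *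
        fderiv ℝ η x (EuclideanSpace.single α 1)) -
      ∑ α, s.F x (i, α) * fderiv ℝ η x (EuclideanSpace.single α 1) := by
    funext x
    rw [← Finset.sum_sub_distrib]
    exact Finset.sum_congr rfl fun α _ => by rw [StripIdx.flux5]; ring
  rw [e2, integral_sub (integrable_finsetSum _ fun α _ => hi _ (hAu α) α)
    (integrable_finsetSum _ fun α _ => hi _ (hF α) α), h1, sub_self]

/-- The equation holds pointwise on `Q₅^k`. -/
theorem StripIdx.pde (s : StripIdx d N m γ lam Lam M) (i : Fin N) :
    EqOn (fun x => ∑ α, pd (s.G.strip 5 s.k) α (s.flux5 i α) x) (fun _ => 0) (s.G.strip 5 s.k) := by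
  have hc : ContinuousOn (fun x => ∑ α, pd (s.G.strip 5 s.k) α (s.flux5 i α) x)
      (s.G.strip 5 s.k) := continuousOn_finsetSum _ fun α _ =>
    (contDiffOn_pd (j := 0) s.uniqueDiffOn_five ((s.contDiffOn_flux i α).of_le
      (by exact_mod_cast s.one_le)) α).continuousOn
  -- The one-sided derivatives are continuous up to the upper graph, and the strip lies in the
  -- closure of its interior.
  refine EqOn.of_subset_closure (s := interior (s.G.strip 5 s.k)) (fun x hx => ?_) hc
    continuousOn_const interior_subset (s.adm.strip_subset_closure (by norm_num) s.hk)
  rw [← s.pde_interior i x hx]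
  refine Finset.sum_congr rfl fun α _ => ?_
  rw [pd, fderivWithin_of_mem_nhds (mem_interior_iff_mem_nhds.1 hx)]

end

section

/-! ### Hölder continuity of π, uniform in the thickness of the strips. -/

section Pi

/-- A positive function with Lipschitz derivative has derivative controlled by its square root. -/
theorem abs_deriv_le_sqrt {g g' : ℝ → ℝ} {B : ℝ} (hB : 0 ≤ B)
    (hg : ∀ t ∈ Icc (-1 : ℝ) 1, HasDerivWithinAt g (g' t) (Icc (-1) 1) t)
    (hg' : ∀ t ∈ Icc (-1 : ℝ) 1, |g' t - g' 0| ≤ B * |t|) (h0 : |g' 0| ≤ B)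
    (hpos : ∀ t ∈ Icc (-1 : ℝ) 1, 0 ≤ g t) : |g' 0| ≤ (1 + B) * √(g 0) := by
  -- First-order Taylor expansion at ±h, with the sign for which g decreases, combined with g ≥ 0.
  have key : ∀ h : ℝ, 0 < h → h ≤ 1 → h * |g' 0| ≤ g 0 + B * h * h := by
    intro h hh hh1
    have hsub : Icc (-h) h ⊆ Icc (-1 : ℝ) 1 := Icc_subset_Icc (by linarith) hh1
    have hd : ∀ t ∈ Icc (-h) h,
        HasDerivWithinAt (fun t => g t - t * g' 0) (g' t - g' 0) (Icc (-h) h) t := fun t ht => by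
      have := ((hg t (hsub ht)).mono hsub).sub ((hasDerivWithinAt_id t (Icc (-h) h)).mul_const (g' 0))
      rw [one_mul] at this
      exact this
    have hb : ∀ t ∈ Icc (-h) h, ‖g' t - g' 0‖ ≤ B * h := fun t ht =>
      (hg' t (hsub ht)).trans (mul_le_mul_of_nonneg_left (abs_le.2 ht) hB)
    have m0 : (0 : ℝ) ∈ Icc (-h) h := ⟨by linarith, hh.le⟩
    have mp : h ∈ Icc (-h) h := ⟨by linarith, le_rfl⟩
    have mn : -h ∈ Icc (-h) h := ⟨le_rfl, by linarith⟩
    have e1 := (convex_Icc (-h) h).norm_image_sub_le_of_norm_hasDerivWithin_le hd hb m0 mp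
    have e2 := (convex_Icc (-h) h).norm_image_sub_le_of_norm_hasDerivWithin_le hd hb m0 mn
    simp only [zero_mul, sub_zero, Real.norm_eq_abs, abs_neg, abs_of_pos hh] at e1 e2
    have p1 := hpos h (hsub mp)
    have p2 := hpos (-h) (hsub mn)
    rw [abs_le] at e1 e2
    rcases abs_cases (g' 0) with ⟨e, -⟩ | ⟨e, -⟩ <;> rw [e] <;> nlinarith
  have hg0 := hpos 0 ⟨by norm_num, by norm_num⟩
  rcases hg0.eq_or_lt with hz | hp
  · rw [← hz, Real.sqrt_zero, mul_zero]
    by_contra hne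
    push Not at hne
    have h1 : |g' 0| ≤ B := h0
    -- If g(0) = 0, then |g'(0)| ≤ B h for every admissible h. This h is proportional to |g'(0)|
    -- with a ratio that contradicts it.
    have h2 := key (|g' 0| / (2 * (B + 1))) (by positivity)
      ((div_le_one (by positivity)).2 (by linarith))
    rw [← hz, zero_add] at h2
    set h := |g' 0| / (2 * (B + 1)) with hh
    have hhp : 0 < h := by positivity
    have h3 : |g' 0| ≤ B * h := by
      have : h * |g' 0| ≤ h * (B * h) := by linarith
      exact le_of_mul_le_mul_left this hhp
    have h4 : |g' 0| = h * (2 * (B + 1)) := by rw [hh]; field_simp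
    nlinarith
  · have hs := Real.sqrt_pos.2 hp
    -- The choice h = √g(0) balances the two terms and is admissible if it is at most 1. Otherwise
    -- the a priori bound |g'(0)| ≤ B suffices.
    rcases le_total (√(g 0)) 1 with h1 | h1
    · have h2 := key _ hs h1
      have h3 := Real.mul_self_sqrt hp.le
      have h4 : √(g 0) * |g' 0| ≤ √(g 0) * ((1 + B) * √(g 0)) := by nlinarith
      exact le_of_mul_le_mul_left h4 hs
    · nlinarith

variable {d N m : ℕ} {γ : ℝ≥0} {lam Lam M : ℝ}

theorem Setting.abs_pd_φ_le (s : Setting d N m γ lam Lam M) {k : ℤ} (hk : k ∈ s.G.Kplus)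
    {x : Pt d} (hx : x ∈ cube d 7) (b : Fin d) : |pd univ b (s.G.φ k) x| ≤ 1 := by
  rw [pd, fderivWithin_univ, ← Real.norm_eq_abs]
  refine (ContinuousLinearMap.le_opNorm _ _).trans ?_
  have h1 := (s.slope k hk x hx).trans (Graphs.Admissible.slope_le d)
  simp only [PiLp.norm_single, norm_one, mul_one]
  linarith

theorem Setting.pd_φ_lip (s : Setting d N m γ lam Lam M) {k : ℤ} (hk : k ∈ s.G.Kplus)
    {x y : Pt d} (hx : x ∈ cube d 7) (hy : y ∈ cube d 7) (b : Fin d) :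
    |pd univ b (s.G.φ k) x - pd univ b (s.G.φ k) y| ≤ |M| * ‖x - y‖ := by
  have hf := (s.holder_φ k hk).1.1
  have hB := (s.holder_φ k hk).2.trans (ofReal_M_le M)
  rw [mul_one] at hB
  have hlen : [b].length < m + 1 := by have := s.one_le; simp only [List.length_singleton]; omega
  have h1 := (QC.of_convex (convex_cube d 7) subset_rfl).norm_sub_le
    (differentiableOn_wd (uniqueDiffOn_cube d 7) hf hlen)
    (fun x hx => norm_fderivWithin_wd_le (uniqueDiffOn_cube d 7) hf hB (abs_nonneg M) hlen hx)
    hx hy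
  have e := wd_univ_eq (isOpen_cube d 7) [b] (s.G.φ k)
  rw [← e hx, ← e hy, mul_one] at h1
  exact h1

/-- The square root estimate is applied along the b-th axis. The unit segment around a point of Q₅'
stays in Q₇', where the gap is positive. In B, 2|M| is the Lipschitz constant of the derivative and
2 bounds its value at the centre. -/
theorem StripIdx.abs_pd_gap_le (s : StripIdx d N m γ lam Lam M) {x : Pt d} (hx : x ∈ cube d 5)
    (b : Fin d) : |pd univ b (s.G.φ (s.k + 1)) x - pd univ b (s.G.φ s.k) x| ≤
      (1 + (2 * |M| + 2)) * √(s.G.gap s.k x) := by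
  set e : Pt d := EuclideanSpace.single b 1 with he
  have hk1 := Graphs.mem_Kplus s.hk
  have hk2 := Graphs.succ_mem_Kplus s.hk
  have hm : ∀ t ∈ Icc (-1 : ℝ) 1, x + t • e ∈ cube d 7 := fun t ht i => by
    have h1 := abs_lt.1 (hx i)
    have h2 : |(t • e) i| ≤ 1 := by
      refine (abs_apply_le _ i).trans ?_
      simpa [norm_smul, he] using abs_le.2 ht
    rw [abs_le] at h2
    simp only [PiLp.add_apply]
    rw [abs_lt]; constructor <;> linarith
  have hnorm : ∀ t : ℝ, ‖x + t • e - (x + (0 : ℝ) • e)‖ = |t| := fun t => by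
    simp [norm_smul, he]
  have h0 : (0 : ℝ) ∈ Icc (-1 : ℝ) 1 := ⟨by norm_num, by norm_num⟩
  have := abs_deriv_le_sqrt (B := 2 * |M| + 2) (g := fun t => s.G.gap s.k (x + t • e))
    (g' := fun t => pd univ b (s.G.φ (s.k + 1)) (x + t • e) - pd univ b (s.G.φ s.k) (x + t • e))
    (by positivity) (fun t ht => ?_) (fun t ht => ?_) ?_ fun t ht =>
      (Graphs.gap_pos s.adm s.hk (hm t ht)).le
  · simpa using this
  · have h1 := Graphs.hasDerivWithinAt_φ_comp s.adm hk1 (hm t ht) (Icc (-1) 1)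
    have h2 := Graphs.hasDerivWithinAt_φ_comp s.adm hk2 (hm t ht) (Icc (-1) 1)
    simp only [pd, fderivWithin_univ]
    exact h2.sub h1
  · have h1 := s.pd_φ_lip hk1 (hm t ht) (hm 0 h0) b
    have h2 := s.pd_φ_lip hk2 (hm t ht) (hm 0 h0) b
    rw [hnorm, abs_le] at h1 h2
    rw [abs_le]
    constructor <;> nlinarith [abs_nonneg t]
  · have h1 := abs_le.1 (s.abs_pd_φ_le hk1 (hm 0 h0) b)
    have h2 := abs_le.1 (s.abs_pd_φ_le hk2 (hm 0 h0) b)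
    rw [abs_le]
    constructor <;> linarith [abs_nonneg M]

theorem StripIdx.vpi_succ (s : StripIdx d N m γ lam Lam M) {x : Pt (d + 1)}
    (hx : x ∈ s.G.strip 7 s.k) (b : Fin d) : s.G.vpi b.succ x = pd univ b (s.G.φ s.k) (prime x) +
      (pd univ b (s.G.φ (s.k + 1)) (prime x) - pd univ b (s.G.φ s.k) (prime x)) * s.G.T s.k x := by
  simp only [Graphs.vpi, Fin.cases_succ]
  rw [Graphs.glue_apply s.adm _ s.hk hx]
  simp only [Graphs.dφ, Fin.cases_succ]
  ring

theorem sqrt_le_rpow {t γ : ℝ} (ht : 0 ≤ t) (ht1 : t ≤ 1) (hγ : 0 < γ) (hγ1 : γ ≤ 1 / 2) :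
    √t ≤ t ^ γ := by
  rw [Real.sqrt_eq_rpow]
  rcases ht.eq_or_lt with rfl | h
  · rw [Real.zero_rpow (by norm_num), Real.zero_rpow hγ.ne']
  · exact Real.rpow_le_rpow_of_exponent_ge h ht1 hγ1

/-- The delicate term is the gradient of the gap times a difference of T. The first is O(√gap) and
the second at most O(|x - y|/gap) and at most 1, so the product is O(√|x - y|) whatever the gap. The
remaining differences are Lipschitz. -/
theorem uhb_vpi (hγ0 : 0 < γ) (hγ : γ ≤ 1 / 4) (α : Fin (d + 1)) :
    UHB γ (fun s : StripIdx d N m γ lam Lam M => s.G.mid s.k) (fun _ => 1) fun s => s.G.vpi α := by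
  refine Fin.cases (UHB.const (-1)) (fun b => ?_) α
  set B := 1 + (2 * |M| + 2) with hB
  have hBp : 0 < B := by positivity
  have hγ0' : (0 : ℝ) < γ := by exact_mod_cast hγ0
  have hγ' : (γ : ℝ) ≤ 1 / 4 := by exact_mod_cast hγ
  refine ⟨5 * B, by positivity, fun s => ⟨fun x hx => ?_, fun x hx y hy => ?_⟩⟩
  · beta_reduce
    rw [s.vpi_succ hx.1]
    have hp := prime_mem_cube hx.1.1
    have h1 := abs_le.1 (s.abs_pd_φ_le (Graphs.mem_Kplus s.hk) hp b)
    have h2 := abs_le.1 (s.abs_pd_φ_le (Graphs.succ_mem_Kplus s.hk) hp b)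
    have hT := Graphs.T_pos s.adm s.hk hx.1
    have hT1 := Graphs.T_le_one s.adm s.hk hx.1
    have h3 := abs_nonneg M
    rw [abs_le]
    constructor <;> nlinarith
  · beta_reduce
    rw [s.vpi_succ hx.1, s.vpi_succ hy.1, mul_one]
    have hpx := prime_mem_cube hx.1.1
    have hpy := prime_mem_cube hy.1.1
    set D₀ := pd univ b (s.G.φ s.k)
    set D₁ := pd univ b (s.G.φ (s.k + 1))
    set τ := s.G.T s.k x
    set σ := s.G.T s.k y
    have hτ := Graphs.T_pos s.adm s.hk hx.1
    have hτ1 := Graphs.T_le_one s.adm s.hk hx.1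
    have hσ := Graphs.T_pos s.adm s.hk hy.1
    have hσ1 := Graphs.T_le_one s.adm s.hk hy.1
    have ht0 : 0 ≤ ‖x - y‖ := norm_nonneg _
    have hpp : ‖prime x - prime y‖ ≤ ‖x - y‖ := by rw [← prime_sub]; exact norm_prime_le _
    have hBM : |M| ≤ B := by have := abs_nonneg M; rw [hB]; linarith
    have hB2 : 2 ≤ B := by have := abs_nonneg M; rw [hB]; linarith
    have hlip : ∀ j ∈ s.G.Kplus, |pd univ b (s.G.φ j) (prime x) - pd univ b (s.G.φ j) (prime y)|
        ≤ B * ‖x - y‖ ^ (γ : ℝ) := fun j hj => by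
      refine le_rpow_of_le ?_ ?_ ht0 hBp.le hγ0'.le (by linarith)
      · have h1 := s.abs_pd_φ_le hj hpx b
        have h2 := s.abs_pd_φ_le hj hpy b
        exact (abs_sub _ _).trans (by linarith)
      · exact (s.pd_φ_lip hj hpx hpy b).trans (mul_le_mul hBM hpp (norm_nonneg _) hBp.le)
    have a0 := hlip _ (Graphs.mem_Kplus s.hk)
    have a1 := hlip _ (Graphs.succ_mem_Kplus s.hk)
    have a2 : |(D₁ (prime y) - D₀ (prime y)) * (τ - σ)| ≤ 2 * B * ‖x - y‖ ^ (γ : ℝ) := by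
      rw [abs_mul]
      have hg := s.abs_pd_gap_le hy.2.2 b
      have hT := Graphs.T_sub_mul_gap_le s.adm s.hk hx.1 hy.1
      have hτσ : |τ - σ| ≤ 1 := by rw [abs_le]; constructor <;> linarith
      rcases le_total ‖x - y‖ 1 with h1 | h1
      · have hgp := Graphs.gap_pos s.adm s.hk hpy
        -- Half of the decay of T is given up in order to match √gap exactly.
        have b1 : |τ - σ| ≤ √|τ - σ| :=
          Real.le_sqrt_of_sq_le (by nlinarith [abs_nonneg (τ - σ)])
        have b2 : √(s.G.gap s.k (prime y)) * √|τ - σ| ≤ 2 * √‖x - y‖ := by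
          rw [← Real.sqrt_mul hgp.le, mul_comm]
          refine (Real.sqrt_le_sqrt hT).trans ?_
          rw [Real.sqrt_mul zero_le_two]
          refine mul_le_mul_of_nonneg_right ?_ (Real.sqrt_nonneg _)
          rw [Real.sqrt_le_left (by norm_num)]; norm_num
        have b3 := sqrt_le_rpow ht0 h1 hγ0' (by linarith)
        calc |D₁ (prime y) - D₀ (prime y)| * |τ - σ|
            ≤ (B * √(s.G.gap s.k (prime y))) * √|τ - σ| :=
              mul_le_mul hg b1 (abs_nonneg _) (by positivity)
          _ = B * (√(s.G.gap s.k (prime y)) * √|τ - σ|) := by ring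
          _ ≤ B * (2 * √‖x - y‖) := mul_le_mul_of_nonneg_left b2 hBp.le
          _ ≤ 2 * B * ‖x - y‖ ^ (γ : ℝ) := by nlinarith
      · have h2 := s.abs_pd_φ_le (Graphs.mem_Kplus s.hk) hpy b
        have h3 := s.abs_pd_φ_le (Graphs.succ_mem_Kplus s.hk) hpy b
        have h4 : |D₁ (prime y) - D₀ (prime y)| ≤ 2 := (abs_sub _ _).trans (by linarith)
        have h5 := Real.one_le_rpow h1 hγ0'.le
        have h6 := mul_le_mul h4 hτσ (abs_nonneg _) zero_le_two
        nlinarith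
    have a3 : |((D₁ (prime x) - D₁ (prime y)) - (D₀ (prime x) - D₀ (prime y))) * τ| ≤
        2 * B * ‖x - y‖ ^ (γ : ℝ) := by
      rw [abs_mul, abs_of_pos hτ]
      refine (mul_le_of_le_one_right (abs_nonneg _) hτ1).trans ((abs_sub _ _).trans ?_)
      linarith
    have e : D₀ (prime x) + (D₁ (prime x) - D₀ (prime x)) * τ -
        (D₀ (prime y) + (D₁ (prime y) - D₀ (prime y)) * σ) = (D₀ (prime x) - D₀ (prime y)) +
        ((D₁ (prime x) - D₁ (prime y)) - (D₀ (prime x) - D₀ (prime y))) * τ +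
        (D₁ (prime y) - D₀ (prime y)) * (τ - σ) := by ring
    rw [e]
    refine (abs_add_le _ _).trans ?_
    have := abs_add_le (D₀ (prime x) - D₀ (prime y))
      (((D₁ (prime x) - D₁ (prime y)) - (D₀ (prime x) - D₀ (prime y))) * τ)
    linarith

end Pi

/-! ### Simultaneous control of values and differences. -/

section Control

variable {n : ℕ} {I : Type*} {γ : ℝ} {S : I → Set (Pt n)} {R₀ : I → Pt n → ℝ}
  {R₁ : I → Pt n → Pt n → ℝ} {f g : I → Pt n → ℝ}

/-- Values of `f i` on `S i` are bounded by `R₀ i`, and differences by `R₁ i`. -/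
def Ctrl (S : I → Set (Pt n)) (R₀ : I → Pt n → ℝ) (R₁ : I → Pt n → Pt n → ℝ)
    (f : I → Pt n → ℝ) : Prop :=
  ∃ C : ℝ, 0 ≤ C ∧ ∀ i, ∀ z ∈ S i, |f i z| ≤ C * R₀ i z ∧
    ∀ w ∈ S i, |f i w - f i z| ≤ C * R₁ i w z

theorem Ctrl.congr (h : Ctrl S R₀ R₁ f) (e : ∀ i, EqOn (g i) (f i) (S i)) : Ctrl S R₀ R₁ g := by
  obtain ⟨C, hC, h⟩ := h
  exact ⟨C, hC, fun i z hz => ⟨by rw [e i hz]; exact (h i z hz).1, fun w hw => by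
    rw [e i hz, e i hw]; exact (h i z hz).2 w hw⟩⟩

theorem Ctrl.zero : Ctrl S R₀ R₁ fun _ _ => 0 := ⟨0, le_rfl, by simp⟩

theorem Ctrl.add (hf : Ctrl S R₀ R₁ f) (hg : Ctrl S R₀ R₁ g) :
    Ctrl S R₀ R₁ fun i x => f i x + g i x := by
  obtain ⟨C, hC, hf⟩ := hf
  obtain ⟨D, hD, hg⟩ := hg
  refine ⟨C + D, by positivity, fun i z hz => ⟨?_, fun w hw => ?_⟩⟩
  · have := abs_add_le (f i z) (g i z)
    linarith [(hf i z hz).1, (hg i z hz).1]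
  · have := abs_add_le (f i w - f i z) (g i w - g i z)
    rw [show f i w + g i w - (f i z + g i z) = (f i w - f i z) + (g i w - g i z) by ring]
    linarith [(hf i z hz).2 w hw, (hg i z hz).2 w hw]

theorem Ctrl.sum {ι : Type*} (s : Finset ι) {F : ι → I → Pt n → ℝ}
    (hF : ∀ j ∈ s, Ctrl S R₀ R₁ (F j)) : Ctrl S R₀ R₁ fun i x => ∑ j ∈ s, F j i x := by
  classical
  induction s using Finset.induction_on with
  | empty => simpa using Ctrl.zero
  | insert a s ha ih =>
    have := (hF a (Finset.mem_insert_self a s)).add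
      (ih fun j hj => hF j (Finset.mem_insert_of_mem hj))
    simpa only [Finset.sum_insert ha] using this

/-- Compatibility of the control functions with Hölder continuous factors. -/
structure Compat (γ : ℝ) (S : I → Set (Pt n)) (R₀ : I → Pt n → ℝ)
    (R₁ : I → Pt n → Pt n → ℝ) : Prop where
  nonneg : ∀ i, ∀ z ∈ S i, 0 ≤ R₀ i z
  le : ∀ i, ∀ z ∈ S i, ∀ w ∈ S i, ‖w - z‖ ^ γ * R₀ i z ≤ R₁ i w z

/-- The variation of the factor contributes |w - z|^γ R₀(z), which `Compat` absorbs into R₁. -/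
theorem Ctrl.mul (hR : Compat γ S R₀ R₁) {a : I → Pt n → ℝ} (ha : UHB γ S (fun _ => 1) a)
    (hf : Ctrl S R₀ R₁ f) : Ctrl S R₀ R₁ fun i x => a i x * f i x := by
  obtain ⟨C, hC, ha⟩ := ha
  obtain ⟨D, hD, hf⟩ := hf
  simp only [mul_one] at ha
  refine ⟨2 * C * D, by positivity, fun i z hz => ⟨?_, fun w hw => ?_⟩⟩
  · have h1 := mul_le_mul ((ha i).1 z hz) (hf i z hz).1 (abs_nonneg _) hC
    have h2 := (abs_nonneg _).trans ((abs_mul _ _).le.trans h1)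
    rw [abs_mul]; linarith
  · have h1 := mul_le_mul ((ha i).1 w hw) ((hf i z hz).2 w hw) (abs_nonneg _) hC
    have h2 := mul_le_mul ((ha i).2 w hw z hz) (hf i z hz).1 (abs_nonneg _) (by positivity)
    rw [← abs_mul] at h1 h2
    have h3 := abs_add_le (a i w * (f i w - f i z)) ((a i w - a i z) * f i z)
    have h4 := mul_le_mul_of_nonneg_left (hR.le i z hz w hw) (mul_nonneg hC hD)
    rw [show a i w * f i w - a i z * f i z
      = a i w * (f i w - f i z) + (a i w - a i z) * f i z by ring]
    nlinarith

theorem Ctrl.const_mul (c : ℝ) (hf : Ctrl S R₀ R₁ f) : Ctrl S R₀ R₁ fun i x => c * f i x := by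
  obtain ⟨C, hC, hf⟩ := hf
  refine ⟨|c| * C, by positivity, fun i z hz => ⟨?_, fun w hw => ?_⟩⟩
  · rw [abs_mul, mul_assoc]
    exact mul_le_mul_of_nonneg_left (hf i z hz).1 (abs_nonneg c)
  · rw [← mul_sub, abs_mul, mul_assoc]
    exact mul_le_mul_of_nonneg_left ((hf i z hz).2 w hw) (abs_nonneg c)

theorem Ctrl.neg (hf : Ctrl S R₀ R₁ f) : Ctrl S R₀ R₁ fun i x => - f i x := by
  simpa using hf.const_mul (-1)

theorem Ctrl.sub (hf : Ctrl S R₀ R₁ f) (hg : Ctrl S R₀ R₁ g) :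
    Ctrl S R₀ R₁ fun i x => f i x - g i x := by
  simpa only [sub_eq_add_neg] using hf.add hg.neg

/-- This is how error terms of size E enter: they are controlled as soon as E ≤ R₀. -/
theorem UHB.ctrl (hR : Compat γ S R₀ R₁) {w : I → ℝ} (hw : ∀ i, ∀ z ∈ S i, w i ≤ R₀ i z)
    (hf : UHB γ S w f) : Ctrl S R₀ R₁ f := by
  obtain ⟨C, hC, hf⟩ := hf
  refine ⟨C, hC, fun i z hz => ⟨?_, fun x hx => ?_⟩⟩
  · exact ((hf i).1 z hz).trans (mul_le_mul_of_nonneg_left (hw i z hz) hC)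
  · refine ((hf i).2 x hx z hz).trans ?_
    rw [mul_assoc, mul_comm (w i)]
    refine mul_le_mul_of_nonneg_left (le_trans ?_ (hR.le i z hz x hx)) hC
    exact mul_le_mul_of_nonneg_left (hw i z hz) (by positivity)

theorem abs_le_of_coercive {ι : Type*} [Fintype ι] {lam : ℝ} (hlam : 0 < lam) {v y : ι → ℝ}
    (h : lam * ∑ i, v i ^ 2 ≤ ∑ i, v i * y i) (j : ι) : |v j| ≤ lam⁻¹ * ∑ i, |y i| := by
  set r := √(∑ i, v i ^ 2) with hr
  have hs : 0 ≤ ∑ i, v i ^ 2 := Finset.sum_nonneg fun i _ => sq_nonneg _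
  have hv : ∀ i, |v i| ≤ r := fun i => Real.abs_le_sqrt
    (Finset.single_le_sum (f := fun i => v i ^ 2) (fun i _ => sq_nonneg _) (Finset.mem_univ i))
  have h1 : ∑ i, v i * y i ≤ r * ∑ i, |y i| := by
    rw [Finset.mul_sum]
    refine Finset.sum_le_sum fun i _ => (le_abs_self _).trans ?_
    rw [abs_mul]
    exact mul_le_mul_of_nonneg_right (hv i) (abs_nonneg _)
  have h2 : r * r = ∑ i, v i ^ 2 := Real.mul_self_sqrt hs
  have hy : 0 ≤ ∑ i, |y i| := Finset.sum_nonneg fun i _ => abs_nonneg _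
  have h3 : r ≤ lam⁻¹ * ∑ i, |y i| := by
    rw [inv_mul_eq_div, le_div_iff₀ hlam]
    rcases (Real.sqrt_nonneg (∑ i, v i ^ 2)).eq_or_lt with h0 | h0
    · rw [hr, ← h0]; simpa using hy
    · refine le_of_mul_le_mul_left ?_ h0
      rw [← hr]; nlinarith
  exact (hv j).trans h3

/-- Inversion of a coercive matrix with Hölder continuous entries. -/
theorem Ctrl.of_coercive {ι : Type*} [Fintype ι] {lam : ℝ} (hlam : 0 < lam)
    (hR : Compat γ S R₀ R₁) {B : ι → ι → I → Pt n → ℝ} {v : ι → I → Pt n → ℝ}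
    (hB : ∀ i j, UHB γ S (fun _ => 1) (B i j))
    (hco : ∀ s, ∀ z ∈ S s, ∀ ζ : ι → ℝ, lam * ∑ i, ζ i ^ 2 ≤ ∑ i, ζ i * ∑ j, B i j s z * ζ j)
    (hBv : ∀ i, Ctrl S R₀ R₁ fun s z => ∑ j, B i j s z * v j s z) (j : ι) :
    Ctrl S R₀ R₁ (v j) := by
  choose C hC hB using hB
  choose D hD hBv using hBv
  simp only [mul_one] at hB
  have hi : 0 < lam⁻¹ := inv_pos.2 hlam
  set K := lam⁻¹ * ∑ i, D i with hK
  have hK0 : 0 ≤ K := mul_nonneg hi.le (Finset.sum_nonneg fun i _ => hD i)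
  have hv : ∀ s, ∀ z ∈ S s, ∀ j, |v j s z| ≤ K * R₀ s z := fun s z hz j => by
    refine (abs_le_of_coercive hlam (hco s z hz fun i => v i s z) j).trans ?_
    rw [hK, mul_assoc, Finset.sum_mul]
    exact mul_le_mul_of_nonneg_left (Finset.sum_le_sum fun i _ => (hBv i s z hz).1) hi.le
  set K' := lam⁻¹ * ∑ i, (D i + ∑ k, C i k * K) with hK'
  have hK0' : 0 ≤ K' := mul_nonneg hi.le (Finset.sum_nonneg fun i _ =>
    add_nonneg (hD i) (Finset.sum_nonneg fun k _ => mul_nonneg (hC i k) hK0))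
  refine ⟨K + K', add_nonneg hK0 hK0', fun s z hz => ⟨?_, fun w hw => ?_⟩⟩
  · have := mul_nonneg hK0' (hR.nonneg s z hz)
    have := hv s z hz j
    linarith
  · have hle := hR.le s z hz w hw
    have hR1 : 0 ≤ R₁ s w z :=
      (mul_nonneg (by positivity) (hR.nonneg s z hz)).trans hle
    have h1 := abs_le_of_coercive hlam (hco s w hw fun i => v i s w - v i s z) j
    have h2 : ∀ i ∈ Finset.univ, |∑ k, B i k s w * (v k s w - v k s z)| ≤
        (D i + ∑ k, C i k * K) * R₁ s w z := by
      intro i _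
      -- Coercivity at w is applied to the difference of v. Its image is the controlled difference
      -- of Bv minus the variation of B acting on v(z), which is already bounded.
      have e : ∑ k, B i k s w * (v k s w - v k s z) =
          (∑ k, B i k s w * v k s w - ∑ k, B i k s z * v k s z)
            - ∑ k, (B i k s w - B i k s z) * v k s z := by
        rw [← Finset.sum_sub_distrib, ← Finset.sum_sub_distrib]
        exact Finset.sum_congr rfl fun k _ => by ring
      have h3 := (hBv i s z hz).2 w hw
      have h4 : |∑ k, (B i k s w - B i k s z) * v k s z| ≤ (∑ k, C i k * K) * R₁ s w z := by
        rw [Finset.sum_mul]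
        refine (Finset.abs_sum_le_sum_abs _ _).trans (Finset.sum_le_sum fun k _ => ?_)
        rw [abs_mul]
        refine (mul_le_mul ((hB i k s).2 w hw z hz) (hv s z hz k) (abs_nonneg _)
          (mul_nonneg (hC i k) (by positivity))).trans ?_
        have := mul_le_mul_of_nonneg_left hle (mul_nonneg (hC i k) hK0)
        linarith
      rw [e]
      refine (abs_sub _ _).trans ?_
      linarith
    refine h1.trans ?_
    have h5 := mul_le_mul_of_nonneg_left (Finset.sum_le_sum h2) hi.le
    rw [← Finset.sum_mul, ← mul_assoc] at h5
    have := mul_nonneg hK0 hR1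
    linarith

end Control

end

section

/-! ### Binomial expansion in several variables. -/

section Poly

variable {d : ℕ} {A : Type*} [CommRing A] [Algebra ℝ A]

theorem piFinset_Icc (p : Fin d → ℕ) :
    (Fintype.piFinset fun b => Finset.Icc 0 (p b)) = Finset.Icc 0 p := by
  ext q
  simp [Fintype.mem_piFinset, Finset.mem_Icc, Pi.le_def]

/-- The sums over q' weighted by π^{q'} in the definition of U^{p'} are exactly such expansions.
With -c it gives the inverse change of variables. -/
theorem expand_prod (X₀ : A) (Z : Fin d → A) (c : Fin d → ℝ) (a : ℕ) (p : Fin d → ℕ) :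
    X₀ ^ a * ∏ b, (Z b + c b • X₀) ^ p b = ∑ q ∈ Finset.Icc 0 p,
      (binom p q * ∏ b, c b ^ q b) • (X₀ ^ (a + order q) * ∏ b, Z b ^ (p - q) b) := by
  have h1 : ∀ b, (Z b + c b • X₀) ^ p b = ∑ k ∈ Finset.Icc 0 (p b),
      (((p b).choose k : ℝ) * c b ^ k) • (X₀ ^ k * Z b ^ (p b - k)) := by
    intro b
    rw [add_comm, add_pow, Finset.range_eq_Ico]
    refine Finset.sum_congr (by ext; simp) fun k _ => ?_
    rw [smul_pow, mul_smul, Algebra.smul_def ((p b).choose k : ℝ), map_natCast, smul_mul_assoc]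
    ring
  simp_rw [h1]
  rw [Finset.prod_univ_sum, piFinset_Icc, Finset.mul_sum]
  refine Finset.sum_congr rfl fun q _ => ?_
  rw [Finset.prod_smul, Finset.prod_mul_distrib, Finset.prod_mul_distrib, Finset.prod_pow_eq_pow_sum,
    mul_smul_comm, pow_add, mul_assoc]
  rfl

end Poly

variable {d N m : ℕ} {γ : ℝ≥0} {lam Lam M : ℝ}

/-- The subregion `Q₅^k`. -/
abbrev StripIdx.S (s : StripIdx d N m γ lam Lam M) : Set (Pt (d + 1)) := s.G.strip 5 s.k

/-! ### The functions U^{p'} and the differentiated equation, modulo lower order. -/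

section Reduction

/-- The smaller strip is the larger one intersected with an open cube. Derivatives relative to Q₇^k
can therefore be replaced by those relative to Q₅^k, where u is of class C^{m+1}. -/
theorem StripIdx.wd_seven (s : StripIdx d N m γ lam Lam M) (l : List (Fin (d + 1))) (f : Pt (d + 1) → ℝ) :
    EqOn (wd (s.G.strip 7 s.k) l f) (wd s.S l f) s.S := by
  have := wd_inter (S := s.G.strip 7 s.k) (isOpen_cube (d + 1) 5) f l
  rw [← Graphs.strip_five_eq] at this
  exact this.symm

theorem StripIdx.subset_seven (s : StripIdx d N m γ lam Lam M) : s.S ⊆ s.G.strip 7 s.k :=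
  Graphs.strip_mono (by norm_num) _

theorem uhb_vpi_five (hγ0 : 0 < γ) (hγ : γ ≤ 1 / 4) (α : Fin (d + 1)) :
    UHB γ (fun s : StripIdx d N m γ lam Lam M => s.S) (fun _ => 1) fun s => s.G.vpi α :=
  (uhb_vpi hγ0 hγ α).subset fun _ => Graphs.strip_five_subset_mid _

theorem uc_A_five (hγ : γ ≤ 1) (α β : Fin (d + 1)) (i j : Fin N) :
    UC γ (fun s : StripIdx d N m γ lam Lam M => s.S) (fun _ => 1) m fun s => s.A s.k α β i j :=
  (uc_A hγ α β i j).subset (fun s => s.uniqueDiffOn_five) fun _ => Graphs.strip_five_subset_mid _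

theorem uc_u_five (hγ : γ ≤ 1) (j : Fin N) :
    UC γ (fun s : StripIdx d N m γ lam Lam M => s.S) (fun s => s.Etot) m fun s x => s.u x j :=
  ((uc_u hγ j).subset (fun s => s.uniqueDiffOn_five)
    fun _ => Graphs.strip_five_subset_mid _).mono_weight fun s => s.E_le s.hk

theorem uc_F_five (hγ : γ ≤ 1) (i : Fin N) (α : Fin (d + 1)) :
    UC γ (fun s : StripIdx d N m γ lam Lam M => s.S) (fun s => s.Etot) m fun s x => s.F x (i, α) :=
  ((uc_F hγ i α).subset (fun s => s.uniqueDiffOn_five)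
    fun _ => Graphs.strip_five_subset_mid _).mono_weight fun s => s.E_le s.hk

/-- Top-order derivatives of the flux, up to lower-order terms. -/
theorem uhb_wd_flux (hγ : γ ≤ 1) (i : Fin N) (α : Fin (d + 1)) (l : List (Fin (d + 1)))
    (hl : l.length = m) : UHB γ (fun s : StripIdx d N m γ lam Lam M => s.S) (fun s => s.Etot)
      fun s x => wd s.S l (s.flux5 i α) x -
        ∑ j, ∑ β, s.A s.k α β i j x * wd s.S l (pd s.S β fun y => s.u y j) x := by
  have hA : ∀ β j, ∀ s : StripIdx d N m γ lam Lam M, ContDiffOn ℝ l.length (s.A s.k α β i j) s.S := fun β j s => by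
    rw [hl]; exact s.contDiffOn_A α β i j
  have hu : ∀ β j, ∀ s : StripIdx d N m γ lam Lam M, ContDiffOn ℝ l.length (pd s.S β fun y => s.u y j) s.S :=
    fun β j s => by
      rw [hl]; exact contDiffOn_pd s.uniqueDiffOn_five (s.contDiffOn_u j) β
  have hF : ∀ s : StripIdx d N m γ lam Lam M, ContDiffOn ℝ l.length (fun y => s.F y (i, α)) s.S := fun s => by
    rw [hl]; exact s.contDiffOn_F i α
  have h1 : UHB γ (fun s : StripIdx d N m γ lam Lam M => s.S) (fun s => s.Etot) fun s x => ∑ j, ∑ β,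
      (wd s.S l (fun y => s.A s.k α β i j y * pd s.S β (fun y => s.u y j) y) x -
        s.A s.k α β i j x * wd s.S l (pd s.S β fun y => s.u y j) x) :=
    UHB.sum _ fun j _ => UHB.sum _ fun β _ =>
      -- The commutator involves at most m derivatives of u, all bounded by the data norm. Those of
      -- order m + 1 appear only with undifferentiated coefficients.
      UHB.commutator (fun s : StripIdx d N m γ lam Lam M => s.uniqueDiffOn_five) l
        (by rw [hl]; exact uc_A_five hγ α β i j)
        (fun r hr => ((uc_u_five hγ j).of_le (by omega : r + 1 ≤ m)).2.2 β) (hA β j) (hu β j)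
  have h2 : UHB γ (fun s : StripIdx d N m γ lam Lam M => s.S) (fun s => s.Etot)
      fun s => wd s.S l (fun y => s.F y (i, α)) :=
    (UC.wd (j := 0) l (by rw [hl, zero_add]; exact uc_F_five hγ i α)).uhb
  refine (h1.sub h2).congr fun s x hx => ?_
  have e : wd s.S l (s.flux5 i α) x = (∑ j, ∑ β,
      wd s.S l (fun y => s.A s.k α β i j y * pd s.S β (fun y => s.u y j) y) x) -
        wd s.S l (fun y => s.F y (i, α)) x := by
    have e1 := wd_sub s.uniqueDiffOn_five (l := l)
      (f := fun x => ∑ j, ∑ β, s.A s.k α β i j x * pd s.S β (fun y => s.u y j) x)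
      (ContDiffOn.sum fun j _ => ContDiffOn.sum fun β _ => (hA β j s).mul (hu β j s)) (hF s) hx
    refine e1.trans ?_
    beta_reduce
    congr 1
    rw [wd_sum s.uniqueDiffOn_five _ (fun j _ => ContDiffOn.sum fun β _ =>
      (hA β j s).mul (hu β j s)) hx]
    exact Finset.sum_congr rfl fun j _ =>
      wd_sum s.uniqueDiffOn_five _ (fun β _ => (hA β j s).mul (hu β j s)) hx
  simp only [Finset.sum_sub_distrib]
  rw [e]; ring

/-- The differentiated equation, up to lower-order terms. -/
theorem uhb_pde (hγ : γ ≤ 1) (i : Fin N) (l : List (Fin (d + 1))) (hl : l.length + 1 = m) :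
    UHB γ (fun s : StripIdx d N m γ lam Lam M => s.S) (fun s => s.Etot)
      fun s x => ∑ α, ∑ j, ∑ β,
        s.A s.k α β i j x * wd s.S (l ++ [α]) (pd s.S β fun y => s.u y j) x := by
  have h1 := UHB.sum Finset.univ fun α _ =>
    uhb_wd_flux (N := N) (lam := lam) (Lam := Lam) (M := M) hγ i α (l ++ [α]) (by simpa using hl)
  refine h1.neg.congr fun s x hx => ?_
  beta_reduce
  rw [Finset.sum_sub_distrib, neg_sub, eq_comm, sub_eq_self]
  simp only [wd_concat]
  have hc : ∀ α ∈ Finset.univ, ContDiffOn ℝ l.length (pd s.S α (s.flux5 i α)) s.S := fun α _ =>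
    contDiffOn_pd s.uniqueDiffOn_five (by rw [hl]; exact s.contDiffOn_flux i α) α
  -- Summed over α, the exact derivatives of the flux add up to a derivative of its divergence,
  -- which vanishes; only the commutators survive.
  refine (wd_sum s.uniqueDiffOn_five _ hc hx).symm.trans ((wd_congr (s.pde i) l hx).trans ?_)
  have := wd_const_mul s.uniqueDiffOn_five 0 (f := fun _ => 0) (l := l) contDiffOn_const hx
  simpa using this

/-- The frozen-coefficient derivative `∑_q (p choose q) π^q D^{(|q|, p-q)} D_β u^j`. -/
def StripIdx.frozen (s : StripIdx d N m γ lam Lam M) (p : Fin d → ℕ) (β : Fin (d + 1)) (j : Fin N) (z : Pt (d + 1)) : ℝ :=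
  ∑ q ∈ Finset.Icc 0 p, binom p q * s.G.vpiPow q z *
    wd s.S (word (mi (order q) (p - q))) (pd s.S β fun y => s.u y j) z

theorem StripIdx.bigUComp_succ (s : StripIdx d N m γ lam Lam M) (p : Fin d → ℕ) (i : Fin N) (b : Fin d) :
    EqOn (s.G.bigUComp s.A s.F s.u p i b.succ) (fun z => s.G.bigG s.A s.F s.u p i b.succ z +
      (s.frozen p b.succ i z + s.G.vpi b.succ z * s.frozen p 0 i z)) s.S := fun z hz => by
  have h : ∀ ξ β, mpd (s.G.strip 7 s.k) ξ (pd (s.G.strip 7 s.k) β fun y => s.u y i) z =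
      wd s.S (word ξ) (pd s.S β fun y => s.u y i) z := fun ξ β => by
    rw [mpd_eq_wd, ← wd_concat, ← wd_concat, s.wd_seven _ _ hz]
  simp only [Graphs.bigUComp, Fin.cases_succ, frozen]
  congr 1
  rw [Finset.mul_sum, ← Finset.sum_add_distrib]
  refine Finset.sum_congr rfl fun q _ => ?_
  rw [Graphs.glue_apply s.adm _ s.hk (s.subset_seven hz),
    Graphs.glue_apply s.adm _ s.hk (s.subset_seven hz), h, h]
  ring

theorem StripIdx.bigUComp_zero (s : StripIdx d N m γ lam Lam M) (p : Fin d → ℕ) (i : Fin N) :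
    EqOn (s.G.bigUComp s.A s.F s.u p i 0) (fun z => s.G.bigG s.A s.F s.u p i 0 z +
      ∑ α, s.G.vpi α z * ∑ q ∈ Finset.Icc 0 p, binom p q * s.G.vpiPow q z *
        wd s.S (word (mi (order q) (p - q))) (s.flux5 i α) z) s.S := fun z hz => by
  simp only [Graphs.bigUComp, Fin.cases_zero]
  congr 1
  refine Finset.sum_congr rfl fun α _ => ?_
  congr 1
  refine Finset.sum_congr rfl fun q _ => ?_
  rw [Graphs.glue_apply s.adm _ s.hk (s.subset_seven hz), mpd_eq_wd, s.wd_seven _ _ hz]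
  congr 1
  refine wd_congr (fun x hx => ?_) _ hz
  simp only [Graphs.flux, flux5]
  congr 1
  refine Finset.sum_congr rfl fun j _ => Finset.sum_congr rfl fun β _ => ?_
  congr 1
  exact s.wd_seven [β] _ hx

theorem uhb_vpiPow (hγ0 : 0 < γ) (hγ : γ ≤ 1 / 4) (q : Fin d → ℕ) :
    UHB γ (fun s : StripIdx d N m γ lam Lam M => s.S) (fun _ => 1) fun s => s.G.vpiPow q :=
  UHB.prod _ fun b _ => (uhb_vpi_five hγ0 hγ b.succ).pow (q b)

theorem sum_mi {p q : Fin d → ℕ} (h : q ≤ p) : ∑ α, mi (order q) (p - q) α = order p := by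
  have := sum_sub_le h
  simp only [mi, Fin.sum_univ_succ, Fin.cons_zero, Fin.cons_succ]
  omega

theorem γ_le_one_of_le (hγ : γ ≤ 1 / 4) : γ ≤ 1 :=
  hγ.trans (by rw [one_div]; exact inv_le_one_of_one_le₀ (by norm_num))

/-- The first component of `U^{p'}` up to lower-order terms. -/
theorem uhb_bigUComp_zero (hγ0 : 0 < γ) (hγ : γ ≤ 1 / 4) (hm : 1 ≤ m) (p : Fin d → ℕ)
    (hp : order p = m) (i : Fin N) : UHB γ (fun s : StripIdx d N m γ lam Lam M => s.S) (fun s => s.Etot)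
      fun s z => s.G.bigUComp s.A s.F s.u p i 0 z - ∑ α, s.G.vpi α z *
        ∑ j, ∑ β, s.A s.k α β i j z * s.frozen p β j z := by
  have hγ1 := γ_le_one_of_le hγ
  have h1 : UHB γ (fun s : StripIdx d N m γ lam Lam M => s.S) (fun s => s.Etot) fun s z => ∑ α, s.G.vpi α z *
      ∑ q ∈ Finset.Icc 0 p, binom p q * (s.G.vpiPow q z *
        (wd s.S (word (mi (order q) (p - q))) (s.flux5 i α) z - ∑ j, ∑ β, s.A s.k α β i j z *
          wd s.S (word (mi (order q) (p - q))) (pd s.S β fun y => s.u y j) z)) :=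
    UHB.sum _ fun α _ => (uhb_vpi_five hγ0 hγ α).mul (UHB.sum _ fun q hq =>
      ((uhb_vpiPow hγ0 hγ q).mul (uhb_wd_flux hγ1 i α _ (by
        rw [length_word, sum_mi (Finset.mem_Icc.1 hq).2, hp]))).const_mul _)
  refine ((uhb_bigG hγ0 hγ1 hm p hp i 0).add h1).congr fun s z hz => ?_
  rw [s.bigUComp_zero p i hz, add_sub_assoc]
  congr 1
  rw [← Finset.sum_sub_distrib]
  refine Finset.sum_congr rfl fun α _ => ?_
  rw [← mul_sub]
  congr 1
  have e : ∑ j, ∑ β, s.A s.k α β i j z * s.frozen p β j z = ∑ q ∈ Finset.Icc 0 p,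
      binom p q * s.G.vpiPow q z * ∑ j, ∑ β, s.A s.k α β i j z *
        wd s.S (word (mi (order q) (p - q))) (pd s.S β fun y => s.u y j) z := by
    simp only [StripIdx.frozen, Finset.mul_sum]
    rw [Finset.sum_congr rfl fun j _ => Finset.sum_comm, Finset.sum_comm]
    exact Finset.sum_congr rfl fun q _ => Finset.sum_congr rfl fun j _ =>
      Finset.sum_congr rfl fun β _ => by ring
  rw [e, ← Finset.sum_sub_distrib]
  exact Finset.sum_congr rfl fun q _ => by ring

end Reduction

end

section

variable {d N m : ℕ} {γ : ℝ≥0} {lam Lam M : ℝ}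

open MvPolynomial

/-! ### Derivatives at a point as a functional on polynomials. -/

section Theta

/-- The linear functional `X^ξ ↦ D^ξ u^j(z)` on polynomials. -/
def StripIdx.theta (s : StripIdx d N m γ lam Lam M) (j : Fin N) (z : Pt (d + 1)) :
    MvPolynomial (Fin (d + 1)) ℝ →ₗ[ℝ] ℝ :=
  (basisMonomials (Fin (d + 1)) ℝ).constr ℝ fun ξ => wd s.S (word ⇑ξ) (fun y => s.u y j) z

theorem theta_monomial (s : StripIdx d N m γ lam Lam M) (j : Fin N) (z : Pt (d + 1))
    (ξ : Fin (d + 1) →₀ ℕ) :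
    s.theta j z (monomial ξ 1) = wd s.S (word ⇑ξ) (fun y => s.u y j) z := by
  have := (basisMonomials (Fin (d + 1)) ℝ).constr_basis ℝ
    (fun ξ => wd s.S (word ⇑ξ) (fun y => s.u y j) z) ξ
  rwa [coe_basisMonomials] at this

theorem exists_monomial (ξ : Fin (d + 1) → ℕ) (l : List (Fin (d + 1))) :
    ∃ ζ : Fin (d + 1) →₀ ℕ, (∏ α, (X α : MvPolynomial (Fin (d + 1)) ℝ) ^ ξ α) * (l.map X).prod =
      monomial ζ 1 ∧ ∀ α, ζ α = ξ α + l.count α := by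
  induction l with
  | nil =>
    refine ⟨Finsupp.equivFunOnFinite.symm ξ, ?_, fun α => by simp⟩
    rw [monomial_eq, Finsupp.prod_fintype _ _ (by simp)]
    simp
  | cons β l ih =>
    obtain ⟨ζ, h1, h2⟩ := ih
    refine ⟨ζ + Finsupp.single β 1, ?_, fun α => ?_⟩
    · rw [List.map_cons, List.prod_cons, mul_left_comm, h1, mul_comm, X, monomial_mul, one_mul]
    · rw [Finsupp.add_apply, h2, List.count_cons, Finsupp.single_apply, add_assoc]
      simp

/-- Derivatives may be taken in any order only up to the smoothness of u, so the degree is limited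
to m + 1. -/
theorem theta_apply (s : StripIdx d N m γ lam Lam M) (j : Fin N) {z : Pt (d + 1)} (hz : z ∈ s.S)
    (ξ : Fin (d + 1) → ℕ) (l : List (Fin (d + 1))) (h : ∑ α, ξ α + l.length ≤ m + 1) :
    s.theta j z ((∏ α, X α ^ ξ α) * (l.map X).prod) =
      wd s.S (word ξ) (wd s.S l fun y => s.u y j) z := by
  obtain ⟨ζ, h1, h2⟩ := exists_monomial ξ l
  rw [h1, theta_monomial, ← wd_append]
  have hp : (word ξ ++ l).Perm (word ⇑ζ) := perm_word fun α => by
    rw [List.count_append, count_word, h2]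
  refine (wd_perm s.uniqueDiffOn_five (s.adm.strip_subset_closure (by norm_num) s.hk) hp ?_ hz).symm
  refine (s.contDiffOn_u j).of_le ?_
  rw [List.length_append, length_word]
  exact_mod_cast h

/-- The polynomial `X₀^a ∏_b (X_b + c_b X₀)^{e_b}`. -/
def yPoly (c : Fin d → ℝ) (a : ℕ) (e : Fin d → ℕ) : MvPolynomial (Fin (d + 1)) ℝ :=
  X 0 ^ a * ∏ b, (X b.succ + c b • X 0) ^ e b

theorem yPoly_succ (c : Fin d → ℝ) (a : ℕ) (e : Fin d → ℕ) :
    yPoly c a e * X 0 = yPoly c (a + 1) e := by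
  simp only [yPoly]; ring

theorem yPoly_mul (c : Fin d → ℝ) (a : ℕ) (e : Fin d → ℕ) (b : Fin d) :
    yPoly c a e * (X b.succ + c b • X 0) = yPoly c a (e + Pi.single b 1) := by
  simp only [yPoly, Pi.add_apply, pow_add, Finset.prod_mul_distrib]
  have : ∏ x, (X x.succ + c x • X 0 : MvPolynomial (Fin (d + 1)) ℝ) ^ (Pi.single b 1 : Fin d → ℕ) x
      = X b.succ + c b • X 0 := by
    rw [Finset.prod_eq_single b (fun x _ hx => by simp [hx]) (by simp)]
    simp
  rw [this]; ring

theorem yPoly_expand (c : Fin d → ℝ) (a : ℕ) (e : Fin d → ℕ) :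
    yPoly c a e = ∑ q ∈ Finset.Icc 0 e, (binom e q * ∏ b, c b ^ q b) •
      ∏ α, (X α : MvPolynomial (Fin (d + 1)) ℝ) ^ (mi (a + order q) (e - q) α) := by
  rw [yPoly, expand_prod]
  refine Finset.sum_congr rfl fun q _ => ?_
  rw [Fin.prod_univ_succ]
  simp [mi]

/-- The inverse substitution X_b = Y_b - c_b X_0, which finally returns from the adapted to the
original derivatives. -/
theorem monomial_expand (c : Fin d → ℝ) (a : ℕ) (e : Fin d → ℕ) :
    ∏ α, (X α : MvPolynomial (Fin (d + 1)) ℝ) ^ (mi a e α) =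
      ∑ q ∈ Finset.Icc 0 e, (binom e q * ∏ b, (-c b) ^ q b) • yPoly c (a + order q) (e - q) := by
  have := expand_prod (X 0 : MvPolynomial (Fin (d + 1)) ℝ) (fun b => X b.succ + c b • X 0)
    (fun b => - c b) a e
  simp only [neg_smul, add_neg_cancel_right] at this
  rw [Fin.prod_univ_succ]
  simp only [mi, Fin.cons_zero, Fin.cons_succ]
  rw [this]
  rfl

/-- The coefficients `π₂, …, π_n` at a point. -/
def StripIdx.c (s : StripIdx d N m γ lam Lam M) (z : Pt (d + 1)) (b : Fin d) : ℝ :=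
  s.G.vpi b.succ z

theorem sum_mi_add {a : ℕ} {p q : Fin d → ℕ} (h : q ≤ p) :
    ∑ α, mi (a + order q) (p - q) α = a + order p := by
  have := sum_sub_le h
  simp only [mi, Fin.sum_univ_succ, Fin.cons_zero, Fin.cons_succ]
  omega

theorem theta_yPoly (s : StripIdx d N m γ lam Lam M) (j : Fin N) {z : Pt (d + 1)} (hz : z ∈ s.S)
    (a : ℕ) (e : Fin d → ℕ) (l : List (Fin (d + 1))) (h : a + order e + l.length ≤ m + 1) :
    s.theta j z (yPoly (s.c z) a e * (l.map X).prod) = ∑ q ∈ Finset.Icc 0 e,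
      binom e q * s.G.vpiPow q z *
        wd s.S (word (mi (a + order q) (e - q))) (wd s.S l fun y => s.u y j) z := by
  rw [yPoly_expand, Finset.sum_mul, map_sum]
  refine Finset.sum_congr rfl fun q hq => ?_
  rw [smul_mul_assoc, map_smul, theta_apply s j hz _ _ (by
    rw [sum_mi_add (Finset.mem_Icc.1 hq).2]; exact h), smul_eq_mul]
  rfl

theorem theta_frozen (s : StripIdx d N m γ lam Lam M) (j : Fin N) {z : Pt (d + 1)} (hz : z ∈ s.S)
    (p : Fin d → ℕ) (hp : order p = m) (β : Fin (d + 1)) :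
    s.theta j z (yPoly (s.c z) 0 p * X β) = s.frozen p β j z := by
  have := theta_yPoly s j hz 0 p [β] (by simp [hp])
  simp only [List.map_cons, List.map_nil, List.prod_cons, List.prod_nil, mul_one, zero_add] at this
  exact this

end Theta

/-! ### Recovering all derivatives of order m + 1 by induction on the normal order. -/

section Inversion

variable {R₀ : StripIdx d N m γ lam Lam M → Pt (d + 1) → ℝ}
  {R₁ : StripIdx d N m γ lam Lam M → Pt (d + 1) → Pt (d + 1) → ℝ}

/-- The matrix `∑_{α,β} π_α π_β A^{αβ}_{ij}`. -/
def StripIdx.normalMat (i j : Fin N) (s : StripIdx d N m γ lam Lam M) (z : Pt (d + 1)) : ℝ :=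
  ∑ α, ∑ β, s.G.vpi α z * s.G.vpi β z * s.A s.k α β i j z

theorem uhb_normalMat (hγ0 : 0 < γ) (hγ : γ ≤ 1 / 4) (i j : Fin N) :
    UHB γ (fun s : StripIdx d N m γ lam Lam M => s.S) (fun _ => 1) (StripIdx.normalMat i j) :=
  UHB.sum _ fun α _ => UHB.sum _ fun β _ =>
    ((uhb_vpi_five hγ0 hγ α).mul (uhb_vpi_five hγ0 hγ β)).mul
      (uc_A_five (γ_le_one_of_le hγ) α β i j).uhb

/-- Ellipticity is tested on the rank-one matrix ζ_i π_α. Its norm is at least |ζ|, because π_1 =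
-1. -/
theorem normalMat_coercive (hlam : 0 < lam) (s : StripIdx d N m γ lam Lam M) (z : Pt (d + 1))
    (ζ : Fin N → ℝ) :
    lam * ∑ i, ζ i ^ 2 ≤ ∑ i, ζ i * ∑ j, StripIdx.normalMat i j s z * ζ j := by
  have h := s.elliptic s.k s.hk z (WithLp.toLp 2 fun iα => ζ iα.1 * s.G.vpi iα.2 z)
  have e : ∑ i, ζ i * ∑ j, StripIdx.normalMat i j s z * ζ j = ∑ i, ∑ j, ∑ α, ∑ β,
      s.A s.k α β i j z * (ζ i * s.G.vpi α z) * (ζ j * s.G.vpi β z) := by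
    simp only [StripIdx.normalMat, Finset.sum_mul, Finset.mul_sum]
    exact Finset.sum_congr rfl fun i _ => Finset.sum_congr rfl fun j _ =>
      Finset.sum_congr rfl fun α _ => Finset.sum_congr rfl fun β _ => by ring
  rw [e]
  refine le_trans (mul_le_mul_of_nonneg_left ?_ hlam.le) h
  rw [EuclideanSpace.norm_sq_eq, Fintype.sum_prod_type]
  refine Finset.sum_le_sum fun i _ => ?_
  rw [Fin.sum_univ_succ]
  have h0 : 0 ≤ ∑ b : Fin d, ‖ζ i * s.G.vpi b.succ z‖ ^ 2 :=
    Finset.sum_nonneg fun b _ => by positivity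
  have h1 : ‖ζ i * s.G.vpi 0 z‖ ^ 2 = ζ i ^ 2 := by
    simp [Graphs.vpi]
  linarith

/-- The tangential part `X_β + π_β X₀` of the direction `β` (zero for `β = 0`). -/
def StripIdx.tang (s : StripIdx d N m γ lam Lam M) (z : Pt (d + 1)) (β : Fin (d + 1)) :
    MvPolynomial (Fin (d + 1)) ℝ := X β + s.G.vpi β z • X 0

theorem tang_zero (s : StripIdx d N m γ lam Lam M) (z : Pt (d + 1)) : s.tang z 0 = 0 := by
  simp [StripIdx.tang, Graphs.vpi]

theorem X_eq (s : StripIdx d N m γ lam Lam M) (z : Pt (d + 1)) (β : Fin (d + 1)) :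
    (X β : MvPolynomial (Fin (d + 1)) ℝ) = s.tang z β - s.G.vpi β z • X 0 := by
  simp [StripIdx.tang]

theorem order_add_single (e : Fin d → ℕ) (b : Fin d) : order (e + Pi.single b 1) = order e + 1 := by
  simp [order, Finset.sum_add_distrib]

/-- Control of the derivatives of order `m + 1` with `a` normal directions. -/
def NormalCtrl (R₀ : StripIdx d N m γ lam Lam M → Pt (d + 1) → ℝ)
    (R₁ : StripIdx d N m γ lam Lam M → Pt (d + 1) → Pt (d + 1) → ℝ) (a : ℕ) : Prop :=
  ∀ e : Fin d → ℕ, a + order e = m + 1 → ∀ j : Fin N,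
    Ctrl (fun s => s.S) R₀ R₁ fun s z => s.theta j z (yPoly (s.c z) a e)

theorem NormalCtrl.tang {a : ℕ} (h : NormalCtrl R₀ R₁ a) {e : Fin d → ℕ}
    (he : a + order e = m) (β : Fin (d + 1)) (j : Fin N) :
    Ctrl (fun s => s.S) R₀ R₁ fun s z => s.theta j z (yPoly (s.c z) a e * s.tang z β) := by
  refine Fin.cases ?_ (fun b => ?_) β
  · exact Ctrl.zero.congr fun s z _ => by simp [tang_zero]
  · exact (h (e + Pi.single b 1) (by rw [order_add_single]; omega) j).congr fun s z _ => by
      beta_reduce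
      rw [← yPoly_mul]; rfl

/-- The components of `U^{p'}` are controlled. -/
def UCtrl (R₀ : StripIdx d N m γ lam Lam M → Pt (d + 1) → ℝ)
    (R₁ : StripIdx d N m γ lam Lam M → Pt (d + 1) → Pt (d + 1) → ℝ) : Prop :=
  ∀ p : Fin d → ℕ, order p = m → ∀ (i : Fin N) (α : Fin (d + 1)),
    Ctrl (fun s => s.S) R₀ R₁ fun s => s.G.bigUComp s.A s.F s.u p i α

/-- As e has positive order, one factor Y_b splits off, and the rest Y^{p'} Y_b is U_b^{p'} -
G_b^{p'} exactly. -/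
theorem normalCtrl_zero (hγ0 : 0 < γ) (hγ : γ ≤ 1 / 4) (hm : 1 ≤ m)
    (hR : Compat γ (fun s : StripIdx d N m γ lam Lam M => s.S) R₀ R₁)
    (hE : ∀ s : StripIdx d N m γ lam Lam M, ∀ z ∈ s.S, s.Etot ≤ R₀ s z) (hU : UCtrl R₀ R₁) :
    NormalCtrl R₀ R₁ 0 := by
  intro e he j
  rw [zero_add] at he
  obtain ⟨b, -, hb⟩ : ∃ b ∈ Finset.univ, e b ≠ 0 := by
    by_contra h
    push Not at h
    have : order e = 0 := Finset.sum_eq_zero h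
    omega
  obtain ⟨p, rfl⟩ : ∃ p : Fin d → ℕ, e = p + Pi.single b 1 := by
    refine ⟨e - Pi.single b 1, ?_⟩
    funext x
    by_cases hx : x = b
    · subst hx; simp; omega
    · simp [hx]
  rw [order_add_single] at he
  have hp : order p = m := by omega
  refine ((hU p hp j b.succ).sub ((uhb_bigG hγ0 (γ_le_one_of_le hγ) hm p hp j b.succ).ctrl hR
    hE)).congr fun s z hz => ?_
  beta_reduce
  rw [s.bigUComp_succ p j b hz, ← yPoly_mul, mul_add, map_add, mul_smul_comm, map_smul,
    theta_frozen s j hz p hp, theta_frozen s j hz p hp]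
  simp [StripIdx.c]

/-- In the conormal component U_1^{p'} the tangential parts are known already. What remains is the
coercive normal matrix acting on X_0 Y^{p'}. -/
theorem normalCtrl_one (hγ0 : 0 < γ) (hγ : γ ≤ 1 / 4) (hm : 1 ≤ m) (hlam : 0 < lam)
    (hR : Compat γ (fun s : StripIdx d N m γ lam Lam M => s.S) R₀ R₁)
    (hE : ∀ s : StripIdx d N m γ lam Lam M, ∀ z ∈ s.S, s.Etot ≤ R₀ s z) (hU : UCtrl R₀ R₁)
    (h0 : NormalCtrl R₀ R₁ 0) : NormalCtrl R₀ R₁ 1 := by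
  intro p hp
  have hp' : order p = m := by omega
  refine fun j => Ctrl.of_coercive hlam hR (uhb_normalMat hγ0 hγ)
    (fun s z _ ζ => normalMat_coercive hlam s z ζ)
    (v := fun j s z => s.theta j z (yPoly (s.c z) 1 p)) (fun i => ?_) j
  have h1 := (hU p hp' i 0).sub ((uhb_bigUComp_zero hγ0 hγ hm p hp' i).ctrl hR hE)
  have h2 : Ctrl (fun s => s.S) R₀ R₁ fun s z => ∑ α, s.G.vpi α z * ∑ j, ∑ β,
      s.A s.k α β i j z * s.theta j z (yPoly (s.c z) 0 p * s.tang z β) :=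
    Ctrl.sum _ fun α _ => (Ctrl.sum _ fun j _ => Ctrl.sum _ fun β _ =>
      (h0.tang (by omega) β j).mul hR (uc_A_five (γ_le_one_of_le hγ) α β i j).uhb).mul hR
        (uhb_vpi_five hγ0 hγ α)
  refine (h2.sub h1).congr fun s z hz => ?_
  have e : ∀ j β, s.frozen p β j z = s.theta j z (yPoly (s.c z) 0 p * s.tang z β) -
      s.G.vpi β z * s.theta j z (yPoly (s.c z) 1 p) := fun j β => by
    rw [← theta_frozen s j hz p hp', X_eq s z β, mul_sub, map_sub, mul_smul_comm, map_smul,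
      yPoly_succ, smul_eq_mul]
  simp only [e, StripIdx.normalMat]
  simp only [mul_sub, Finset.sum_sub_distrib, sub_sub_cancel]
  simp only [Finset.sum_mul, Finset.mul_sum]
  rw [Finset.sum_comm]
  exact Finset.sum_congr rfl fun α _ => Finset.sum_congr rfl fun j _ =>
    Finset.sum_congr rfl fun β _ => by ring

/-- The U^{p'} give no direct access to two normal factors; the equation does. Decomposing both X_α
and X_β in its principal part leaves products with at most a + 1 factors X_0, and the normal matrix
on X_0^{a+2} Y^p. -/
theorem normalCtrl_add_two (hγ0 : 0 < γ) (hγ : γ ≤ 1 / 4) (hlam : 0 < lam)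
    (hR : Compat γ (fun s : StripIdx d N m γ lam Lam M => s.S) R₀ R₁)
    (hE : ∀ s : StripIdx d N m γ lam Lam M, ∀ z ∈ s.S, s.Etot ≤ R₀ s z) {a : ℕ}
    (h0 : NormalCtrl R₀ R₁ a) (h1 : NormalCtrl R₀ R₁ (a + 1)) : NormalCtrl R₀ R₁ (a + 2) := by
  intro p hp
  have hγ1 := γ_le_one_of_le hγ
  refine fun j => Ctrl.of_coercive hlam hR (uhb_normalMat hγ0 hγ)
    (fun s z _ ζ => normalMat_coercive hlam s z ζ)
    (v := fun j s z => s.theta j z (yPoly (s.c z) (a + 2) p)) (fun i => ?_) j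
  have hpde : Ctrl (fun s => s.S) R₀ R₁ fun s z => ∑ α, ∑ j, ∑ β, s.A s.k α β i j z *
      s.theta j z (yPoly (s.c z) a p * (X α * X β)) := by
    -- The equation is differentiated by the operator with symbol X_0^a Y^p, π frozen at z, of order
    -- a + |p| = m - 1.
    have h := UHB.sum (Finset.Icc 0 p) fun q hq => ((uhb_vpiPow (N := N) (m := m) (lam := lam)
      (Lam := Lam) (M := M) hγ0 hγ q).mul (uhb_pde hγ1 i (word (mi (a + order q) (p - q))) (by
        rw [length_word, sum_mi_add (Finset.mem_Icc.1 hq).2]; omega))).const_mul (binom p q)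
    refine (h.ctrl hR hE).congr fun s z hz => ?_
    have e : ∀ j α β, s.theta j z (yPoly (s.c z) a p * (X α * X β)) = ∑ q ∈ Finset.Icc 0 p,
        binom p q * s.G.vpiPow q z * wd s.S (word (mi (a + order q) (p - q)) ++ [α])
          (pd s.S β fun y => s.u y j) z := fun j α β => by
      have := theta_yPoly s j hz a p [α, β] (by simp; omega)
      simp only [List.map_cons, List.map_nil, List.prod_cons, List.prod_nil, mul_one] at this
      rw [this]
      exact Finset.sum_congr rfl fun q _ => by rw [wd_concat]; rfl
    simp only [e, Finset.mul_sum]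
    rw [Finset.sum_congr rfl fun α _ => Finset.sum_congr rfl fun j _ => Finset.sum_comm,
      Finset.sum_congr rfl fun α _ => Finset.sum_comm, Finset.sum_comm]
    exact Finset.sum_congr rfl fun q _ => Finset.sum_congr rfl fun α _ =>
      Finset.sum_congr rfl fun j _ => Finset.sum_congr rfl fun β _ => by ring
  have hT : ∀ α β j, Ctrl (fun s => s.S) R₀ R₁ fun s z =>
      s.theta j z (yPoly (s.c z) a p * (s.tang z α * s.tang z β)) := by
    intro α β j
    refine Fin.cases ?_ (fun b => ?_) α
    · exact Ctrl.zero.congr fun s z _ => by simp [tang_zero]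
    · exact (h0.tang (e := p + Pi.single b 1) (by rw [order_add_single]; omega) β j).congr
        fun s z _ => by
          beta_reduce
          rw [← yPoly_mul, mul_assoc]; rfl
  have hT1 : ∀ α j, Ctrl (fun s => s.S) R₀ R₁ fun s z =>
      s.theta j z (yPoly (s.c z) (a + 1) p * s.tang z α) := fun α j => h1.tang (by omega) α j
  have hV : ∀ α, UHB γ (fun s : StripIdx d N m γ lam Lam M => s.S) (fun _ => 1)
      fun s => s.G.vpi α := fun α => uhb_vpi_five hγ0 hγ α
  have h2 : Ctrl (fun s => s.S) R₀ R₁ fun s z => ∑ α, ∑ j, ∑ β, s.A s.k α β i j z *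
      (s.theta j z (yPoly (s.c z) a p * (s.tang z α * s.tang z β)) -
        s.G.vpi α z * s.theta j z (yPoly (s.c z) (a + 1) p * s.tang z β) -
        s.G.vpi β z * s.theta j z (yPoly (s.c z) (a + 1) p * s.tang z α)) :=
    Ctrl.sum _ fun α _ => Ctrl.sum _ fun j _ => Ctrl.sum _ fun β _ =>
      ((((hT α β j).sub ((hT1 β j).mul hR (hV α))).sub ((hT1 α j).mul hR (hV β))).mul hR
        (uc_A_five hγ1 α β i j).uhb)
  refine (hpde.sub h2).congr fun s z hz => ?_
  have e : ∀ j α β, s.theta j z (yPoly (s.c z) a p * (X α * X β)) =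
      s.theta j z (yPoly (s.c z) a p * (s.tang z α * s.tang z β)) -
        s.G.vpi α z * s.theta j z (yPoly (s.c z) (a + 1) p * s.tang z β) -
        s.G.vpi β z * s.theta j z (yPoly (s.c z) (a + 1) p * s.tang z α) +
        s.G.vpi α z * s.G.vpi β z * s.theta j z (yPoly (s.c z) (a + 2) p) := fun j α β => by
    have : yPoly (s.c z) a p * (X α * X β) = yPoly (s.c z) a p * (s.tang z α * s.tang z β) -
        s.G.vpi α z • (yPoly (s.c z) (a + 1) p * s.tang z β) -
        s.G.vpi β z • (yPoly (s.c z) (a + 1) p * s.tang z α) +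
        (s.G.vpi α z * s.G.vpi β z) • (yPoly (s.c z) (a + 2) p) := by
      conv_lhs => rw [X_eq s z α, X_eq s z β]
      rw [← yPoly_succ _ (a + 1), ← yPoly_succ]
      simp only [smul_eq_C_mul, C_mul]
      ring
    rw [this, map_add, map_sub, map_sub, map_smul, map_smul, map_smul]
    simp only [smul_eq_mul]
  simp only [e, StripIdx.normalMat]
  simp only [mul_add, Finset.sum_add_distrib, add_sub_cancel_left]
  simp only [Finset.sum_mul]
  rw [Finset.sum_comm]
  exact Finset.sum_congr rfl fun α _ => Finset.sum_congr rfl fun j _ =>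
    Finset.sum_congr rfl fun β _ => by ring

/-- Two consecutive orders are carried along, because the step to a + 2 uses both a and a + 1. -/
theorem normalCtrl (hγ0 : 0 < γ) (hγ : γ ≤ 1 / 4) (hm : 1 ≤ m) (hlam : 0 < lam)
    (hR : Compat γ (fun s : StripIdx d N m γ lam Lam M => s.S) R₀ R₁)
    (hE : ∀ s : StripIdx d N m γ lam Lam M, ∀ z ∈ s.S, s.Etot ≤ R₀ s z) (hU : UCtrl R₀ R₁) :
    ∀ a, NormalCtrl R₀ R₁ a ∧ NormalCtrl R₀ R₁ (a + 1) := by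
  intro a
  induction a with
  | zero =>
    have h0 := normalCtrl_zero hγ0 hγ hm hR hE hU
    exact ⟨h0, normalCtrl_one hγ0 hγ hm hlam hR hE hU h0⟩
  | succ a ih => exact ⟨ih.2, normalCtrl_add_two hγ0 hγ hlam hR hE ih.1 ih.2⟩

/-- All derivatives of order `m + 1` are controlled once the `U^{p'}` are. -/
theorem UCtrl.wd (hγ0 : 0 < γ) (hγ : γ ≤ 1 / 4) (hm : 1 ≤ m) (hlam : 0 < lam)
    (hR : Compat γ (fun s : StripIdx d N m γ lam Lam M => s.S) R₀ R₁)
    (hE : ∀ s : StripIdx d N m γ lam Lam M, ∀ z ∈ s.S, s.Etot ≤ R₀ s z) (hU : UCtrl R₀ R₁)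
    (l : List (Fin (d + 1))) (hl : l.length = m + 1) (j : Fin N) :
    Ctrl (fun s => s.S) R₀ R₁ fun s => wd s.S l fun y => s.u y j := by
  set a := l.count 0 with ha
  set e : Fin d → ℕ := fun b => l.count b.succ with he
  have hmi : ∀ α, l.count α = mi a e α := fun α => by
    refine Fin.cases ?_ (fun b => ?_) α <;> simp [mi, ha, he]
  have hperm := perm_word hmi
  have hord : a + order e = m + 1 := by
    have := hperm.length_eq
    rw [length_word, Fin.sum_univ_succ, hl] at this
    simp only [mi, Fin.cons_zero, Fin.cons_succ] at this
    exact this.symm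
  have h : Ctrl (fun s => s.S) R₀ R₁ fun s z => ∑ q ∈ Finset.Icc 0 e,
      (binom e q * ∏ b, (-s.c z b) ^ q b) * s.theta j z (yPoly (s.c z) (a + order q) (e - q)) :=
    Ctrl.sum _ fun q hq => ((normalCtrl hγ0 hγ hm hlam hR hE hU (a + order q)).1 (e - q) (by
      have := sum_sub_le (Finset.mem_Icc.1 hq).2
      simp only [order] at *
      omega) j).mul hR ((UHB.prod _ fun b _ =>
        (uhb_vpi_five hγ0 hγ b.succ).neg.pow (q b)).const_mul _)
  refine h.congr fun s z hz => ?_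
  have hc : ContDiffOn ℝ l.length (fun y => s.u y j) s.S := by rw [hl]; exact s.contDiffOn_u j
  rw [wd_perm s.uniqueDiffOn_five (s.adm.strip_subset_closure (by norm_num) s.hk) hperm hc hz]
  have h1 := theta_apply s j hz (mi a e) [] (by
    rw [Fin.sum_univ_succ]; simp only [mi, Fin.cons_zero, Fin.cons_succ, List.length_nil]
    exact hord.le)
  simp only [List.map_nil, List.prod_nil, mul_one, wd_nil] at h1
  rw [← h1, monomial_expand (s.c z), map_sum]
  exact Finset.sum_congr rfl fun q _ => by rw [map_smul, smul_eq_mul]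

end Inversion

end

section

/-! ### From components to norms of tensors. -/

section Norms

theorem norm_le_sum_abs {ι : Type*} [Fintype ι] (x : EuclideanSpace ℝ ι) : ‖x‖ ≤ ∑ i, |x i| := by
  classical
  conv_lhs => rw [← (EuclideanSpace.basisFun ι ℝ).sum_repr x]
  refine (norm_sum_le _ _).trans (Finset.sum_le_sum fun i _ => ?_)
  rw [norm_smul, OrthonormalBasis.norm_eq_one, mul_one]
  rfl

theorem norm_le_sum_basis {n k : ℕ} {V : Type*} [NormedAddCommGroup V] [NormedSpace ℝ V]
    (f : Pt n [×k]→L[ℝ] V) :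
    ‖f‖ ≤ ∑ e : Fin k → Fin n, ‖f fun i => EuclideanSpace.single (e i) 1‖ := by
  refine ContinuousMultilinearMap.opNorm_le_bound (Finset.sum_nonneg fun _ _ => norm_nonneg _)
    fun v => ?_
  have hv : v = fun i => ∑ a, v i a • (EuclideanSpace.single a (1 : ℝ) : Pt n) := by
    funext i
    have := (EuclideanSpace.basisFun (Fin n) ℝ).sum_repr (v i)
    simpa using this.symm
  have h : f v = ∑ e : Fin k → Fin n,
      (∏ i, v i (e i)) • f fun i => EuclideanSpace.single (e i) 1 := by
    conv_lhs => rw [hv]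
    rw [ContinuousMultilinearMap.map_sum]
    exact Finset.sum_congr rfl fun e _ => f.map_smul_univ (fun i => v i (e i)) _
  rw [h, Finset.sum_mul]
  refine (norm_sum_le _ _).trans (Finset.sum_le_sum fun e _ => ?_)
  rw [norm_smul, mul_comm, norm_prod]
  exact mul_le_mul_of_nonneg_left (Finset.prod_le_prod (fun _ _ => norm_nonneg _)
    fun i _ => PiLp.norm_apply_le (v i) (e i)) (norm_nonneg _)

theorem Ctrl.norm_bound {I κ W : Type*} [Fintype κ] [NormedAddCommGroup W] {n : ℕ}
    {S : I → Set (Pt n)} {R₀ : I → Pt n → ℝ} {R₁ : I → Pt n → Pt n → ℝ} {f : κ → I → Pt n → ℝ}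
    {D : I → Pt n → W} (hf : ∀ a, Ctrl S R₀ R₁ (f a))
    (h0 : ∀ i, ∀ z ∈ S i, ‖D i z‖ ≤ ∑ a, |f a i z|)
    (h1 : ∀ i, ∀ z ∈ S i, ∀ w ∈ S i, ‖D i w - D i z‖ ≤ ∑ a, |f a i w - f a i z|) :
    ∃ C : ℝ, 0 ≤ C ∧ ∀ i, ∀ z ∈ S i, ‖D i z‖ ≤ C * R₀ i z ∧
      ∀ w ∈ S i, ‖D i w - D i z‖ ≤ C * R₁ i w z := by
  choose C hC hf using hf
  refine ⟨∑ a, C a, Finset.sum_nonneg fun a _ => hC a, fun i z hz => ⟨?_, fun w hw => ?_⟩⟩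
  · rw [Finset.sum_mul]
    exact (h0 i z hz).trans (Finset.sum_le_sum fun a _ => (hf a i z hz).1)
  · rw [Finset.sum_mul]
    exact (h1 i z hz w hw).trans (Finset.sum_le_sum fun a _ => (hf a i z hz).2 w hw)

end Norms

variable {d N m : ℕ} {γ : ℝ≥0} {lam Lam M : ℝ}

/-! ### The estimates for D^{m+1}u in both directions. -/

section TopDerivative

/-- The derivative of order `m + 1` of the solution. -/
def StripIdx.top (s : StripIdx d N m γ lam Lam M) : Pt (d + 1) → Pt (d + 1) [×(m + 1)]→L[ℝ] Pt N :=
  s.G.pieceDeriv s.u (m + 1)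

/-- The derivative is defined relative to Q₇^k, where u need not be C^{m+1}. Inside the open cube Q₅
it is the same as the one relative to Q₅^k. -/
theorem StripIdx.top_eq (s : StripIdx d N m γ lam Lam M) {z : Pt (d + 1)} (hz : z ∈ s.S) :
    s.top z = iteratedFDerivWithin ℝ (m + 1) s.u s.S z := by
  rw [top, Graphs.pieceDeriv, Graphs.glue_apply s.adm _ s.hk (s.subset_seven hz)]
  have := iteratedFDerivWithin_inter_open (𝕜 := ℝ) (f := s.u) (s := s.G.strip 7 s.k) (n := m + 1)
    (isOpen_cube (d + 1) 5) hz.1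
  rw [← this, ← Graphs.strip_five_eq]

theorem StripIdx.top_apply (s : StripIdx d N m γ lam Lam M) {z : Pt (d + 1)} (hz : z ∈ s.S)
    {l : List (Fin (d + 1))} (hl : l.length = m + 1) (j : Fin N) :
    (s.top z fun i => EuclideanSpace.single (l.get (i.cast hl.symm)) 1) j =
      wd s.S l (fun y => s.u y j) z := by
  have hu : ContDiffOn ℝ l.length s.u s.S := by rw [hl]; exact s.smooth s.k s.hk
  have h1 := wd_eq_iteratedFDerivWithin s.uniqueDiffOn_five hu le_rfl hz
  have h2 := wd_clm s.uniqueDiffOn_five (EuclideanSpace.proj (𝕜 := ℝ) j) hu hz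
  have h3 : iteratedFDerivWithin ℝ (m + 1) s.u s.S z
      (fun i => EuclideanSpace.single (l.get (i.cast hl.symm)) 1) = wd s.S l s.u z := by
    rw [h1]
    clear h1 h2 hu
    generalize m + 1 = r at hl
    subst hl
    rfl
  rw [s.top_eq hz, h3]
  exact h2.symm

theorem StripIdx.top_apply_ofFn (s : StripIdx d N m γ lam Lam M) {z : Pt (d + 1)} (hz : z ∈ s.S)
    (e : Fin (m + 1) → Fin (d + 1)) (j : Fin N) :
    (s.top z fun i => EuclideanSpace.single (e i) 1) j =
      wd s.S (List.ofFn e) (fun y => s.u y j) z := by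
  rw [← s.top_apply hz List.length_ofFn j]
  have h : ∀ i, (List.ofFn e).get (Fin.cast List.length_ofFn.symm i) = e i := fun i =>
    List.get_ofFn e _
  simp only [h]

theorem StripIdx.abs_wd_le (s : StripIdx d N m γ lam Lam M) {z : Pt (d + 1)} (hz : z ∈ s.S)
    {l : List (Fin (d + 1))} (hl : l.length = m + 1) (j : Fin N) :
    |wd s.S l (fun y => s.u y j) z| ≤ ‖s.top z‖ := by
  rw [← s.top_apply hz hl]
  refine (PiLp.norm_apply_le (s.top z _) j).trans
    ((ContinuousMultilinearMap.le_opNorm _ _).trans ?_)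
  rw [norm_single_prod, mul_one]

variable {R₀ : StripIdx d N m γ lam Lam M → Pt (d + 1) → ℝ}
  {R₁ : StripIdx d N m γ lam Lam M → Pt (d + 1) → Pt (d + 1) → ℝ}

theorem UCtrl.top (hγ0 : 0 < γ) (hγ : γ ≤ 1 / 4) (hm : 1 ≤ m) (hlam : 0 < lam)
    (hR : Compat γ (fun s : StripIdx d N m γ lam Lam M => s.S) R₀ R₁)
    (hE : ∀ s : StripIdx d N m γ lam Lam M, ∀ z ∈ s.S, s.Etot ≤ R₀ s z) (hU : UCtrl R₀ R₁) :
    ∃ C : ℝ, 0 ≤ C ∧ ∀ s : StripIdx d N m γ lam Lam M, ∀ z ∈ s.S, ‖s.top z‖ ≤ C * R₀ s z ∧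
      ∀ w ∈ s.S, ‖s.top w - s.top z‖ ≤ C * R₁ s w z := by
  refine Ctrl.norm_bound (κ := (Fin (m + 1) → Fin (d + 1)) × Fin N)
    (f := fun a s => PiecewiseSmooth.wd s.S (List.ofFn a.1) fun y => s.u y a.2)
    (fun a => hU.wd hγ0 hγ hm hlam hR hE _ List.length_ofFn a.2) (fun s z hz => ?_)
    fun s z hz w hw => ?_
  · refine (norm_le_sum_basis _).trans ?_
    rw [Fintype.sum_prod_type]
    refine Finset.sum_le_sum fun e _ => (norm_le_sum_abs _).trans (Finset.sum_le_sum fun j _ => ?_)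
    rw [s.top_apply_ofFn hz]
  · refine (norm_le_sum_basis _).trans ?_
    rw [Fintype.sum_prod_type]
    refine Finset.sum_le_sum fun e _ => (norm_le_sum_abs _).trans (Finset.sum_le_sum fun j _ => ?_)
    rw [sub_apply, PiLp.sub_apply, s.top_apply_ofFn hz,
      s.top_apply_ofFn hw]

/-- The components of `U^{p'}` are controlled by the derivatives of order `m + 1`. -/
theorem UCtrl.of_wd (hγ0 : 0 < γ) (hγ : γ ≤ 1 / 4) (hm : 1 ≤ m)
    (hR : Compat γ (fun s : StripIdx d N m γ lam Lam M => s.S) R₀ R₁)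
    (hE : ∀ s : StripIdx d N m γ lam Lam M, ∀ z ∈ s.S, s.Etot ≤ R₀ s z)
    (h : ∀ l : List (Fin (d + 1)), l.length = m + 1 → ∀ j : Fin N,
      Ctrl (fun s : StripIdx d N m γ lam Lam M => s.S) R₀ R₁
        fun s => PiecewiseSmooth.wd s.S l fun y => s.u y j) : UCtrl R₀ R₁ := by
  intro p hp i α
  have hγ1 := γ_le_one_of_le hγ
  have hfr : ∀ β j, Ctrl (fun s : StripIdx d N m γ lam Lam M => s.S) R₀ R₁
      fun s => s.frozen p β j := fun β j =>
    Ctrl.sum _ fun q hq => (((h (word (mi (order q) (p - q)) ++ [β]) (by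
      rw [List.length_append, length_word, sum_mi (Finset.mem_Icc.1 hq).2, hp]; rfl) j).congr
        fun s z _ => by rw [wd_concat]).mul hR ((uhb_vpiPow hγ0 hγ q).const_mul _))
  refine Fin.cases ?_ (fun b => ?_) α
  · have h1 : Ctrl (fun s : StripIdx d N m γ lam Lam M => s.S) R₀ R₁ fun s z => ∑ α,
        s.G.vpi α z * ∑ j, ∑ β, s.A s.k α β i j z * s.frozen p β j z :=
      Ctrl.sum _ fun α _ => (Ctrl.sum _ fun j _ => Ctrl.sum _ fun β _ =>
        (hfr β j).mul hR (uc_A_five hγ1 α β i j).uhb).mul hR (uhb_vpi_five hγ0 hγ α)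
    exact (((uhb_bigUComp_zero hγ0 hγ hm p hp i).ctrl hR hE).add h1).congr fun s z _ => by
      beta_reduce; ring
  · exact (((uhb_bigG hγ0 hγ1 hm p hp i b.succ).ctrl hR hE).add ((hfr b.succ i).add
      ((hfr 0 i).mul hR (uhb_vpi_five hγ0 hγ b.succ)))).congr fun s => s.bigUComp_succ p i b

theorem norm_bigU_le (s : StripIdx d N m γ lam Lam M) (p : Fin d → ℕ) (z : Pt (d + 1)) :
    ‖s.G.bigU s.A s.F s.u p z‖ ≤ ∑ a : Fin N × Fin (d + 1),
      |s.G.bigUComp s.A s.F s.u p a.1 a.2 z| := norm_le_sum_abs _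

theorem mem_idx {p : Fin d → ℕ} : p ∈ Graphs.idx d m ↔ order p = m := by
  simp [Graphs.idx, order, Finset.mem_piAntidiag]

/-- The sum of the norms of the `U^{p'}`. -/
def StripIdx.sumU (s : StripIdx d N m γ lam Lam M) (z : Pt (d + 1)) : ℝ :=
  ∑ p ∈ Graphs.idx d m, ‖s.G.bigU s.A s.F s.u p z‖

theorem StripIdx.sumU_nonneg (s : StripIdx d N m γ lam Lam M) (z : Pt (d + 1)) : 0 ≤ s.sumU z :=
  Finset.sum_nonneg fun _ _ => norm_nonneg _

/-- The right-hand side of the Hölder estimate. -/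
def StripIdx.diffU (s : StripIdx d N m γ lam Lam M) (w z : Pt (d + 1)) : ℝ :=
  ∑ p ∈ Graphs.idx d m, (‖s.G.bigU s.A s.F s.u p w - s.G.bigU s.A s.F s.u p z‖ +
    ‖w - z‖ ^ (γ : ℝ) * ‖s.G.bigU s.A s.F s.u p z‖)

/-- With R₀ and R₁ taken as the two right-hand sides to be proved, the U^{p'} are controlled with
constant 1, and the abstract inversion applies. -/
theorem top_le_bigU (hγ0 : 0 < γ) (hγ : γ ≤ 1 / 4) (hm : 1 ≤ m) (hlam : 0 < lam) :
    ∃ C : ℝ, 0 ≤ C ∧ ∀ s : StripIdx d N m γ lam Lam M, ∀ z ∈ s.S,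
      ‖s.top z‖ ≤ C * (s.Etot + s.sumU z) ∧ ∀ w ∈ s.S,
        ‖s.top w - s.top z‖ ≤ C * (s.diffU w z + ‖w - z‖ ^ (γ : ℝ) * s.Etot) := by
  refine UCtrl.top hγ0 hγ hm hlam (R₀ := fun s z => s.Etot + s.sumU z)
    (R₁ := fun s w z => s.diffU w z + ‖w - z‖ ^ (γ : ℝ) * s.Etot)
    ⟨fun s z _ => add_nonneg s.Etot_nonneg (s.sumU_nonneg z), fun s z _ w _ => ?_⟩
    (fun s z _ => le_add_of_nonneg_right (s.sumU_nonneg z)) fun p hp i α => ?_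
  · rw [mul_add, add_comm, StripIdx.sumU, Finset.mul_sum]
    exact add_le_add_left (Finset.sum_le_sum fun p _ =>
      le_add_of_nonneg_left (norm_nonneg _)) _
  · refine ⟨1, zero_le_one, fun s z _ => ⟨?_, fun w _ => ?_⟩⟩
    · rw [one_mul]
      refine (PiLp.norm_apply_le (s.G.bigU s.A s.F s.u p z) (i, α)).trans ?_
      refine le_trans ?_ (le_add_of_nonneg_left s.Etot_nonneg)
      exact Finset.single_le_sum (f := fun p => ‖s.G.bigU s.A s.F s.u p z‖)
        (fun _ _ => norm_nonneg _) (mem_idx.2 hp)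
    · rw [one_mul]
      refine (PiLp.norm_apply_le (s.G.bigU s.A s.F s.u p w - s.G.bigU s.A s.F s.u p z)
        (i, α)).trans ?_
      refine le_trans ?_ (le_add_of_nonneg_right
        (mul_nonneg (Real.rpow_nonneg (norm_nonneg _) _) s.Etot_nonneg))
      refine le_trans ?_ (Finset.single_le_sum (f := fun p =>
        ‖s.G.bigU s.A s.F s.u p w - s.G.bigU s.A s.F s.u p z‖ +
          ‖w - z‖ ^ (γ : ℝ) * ‖s.G.bigU s.A s.F s.u p z‖) (fun _ _ => by positivity)
        (mem_idx.2 hp))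
      exact le_add_of_nonneg_right (by positivity)

theorem bigU_le_top (hγ0 : 0 < γ) (hγ : γ ≤ 1 / 4) (hm : 1 ≤ m) :
    ∃ C : ℝ, 0 ≤ C ∧ ∀ s : StripIdx d N m γ lam Lam M, ∀ z ∈ s.S,
      s.sumU z ≤ C * (s.Etot + ‖s.top z‖) := by
  set R₀ : StripIdx d N m γ lam Lam M → Pt (d + 1) → ℝ := fun s z => s.Etot + ‖s.top z‖ with hR₀
  have hn : ∀ s z, 0 ≤ R₀ s z := fun s z => add_nonneg s.Etot_nonneg (norm_nonneg _)
  -- Only the pointwise bound is wanted here. This R₁ makes the difference bounds follow from the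
  -- triangle inequality.
  have hU : UCtrl R₀ fun s w z => R₀ s w + R₀ s z + ‖w - z‖ ^ (γ : ℝ) * R₀ s z := by
    refine UCtrl.of_wd hγ0 hγ hm ⟨fun s z _ => hn s z, fun s z _ w _ => ?_⟩
      (fun s z _ => le_add_of_nonneg_right (norm_nonneg _)) fun l hl j => ?_
    · linarith [hn s z, hn s w]
    · have hb : ∀ s : StripIdx d N m γ lam Lam M, ∀ z ∈ s.S,
          |wd s.S l (fun y => s.u y j) z| ≤ R₀ s z := fun s z hz =>
        (s.abs_wd_le hz hl j).trans (le_add_of_nonneg_left s.Etot_nonneg)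
      refine ⟨1, zero_le_one, fun s z hz => ⟨by rw [one_mul]; exact hb s z hz, fun w hw => ?_⟩⟩
      have h1 := abs_sub (wd s.S l (fun y => s.u y j) w) (wd s.S l (fun y => s.u y j) z)
      have h2 : 0 ≤ ‖w - z‖ ^ (γ : ℝ) * R₀ s z :=
        mul_nonneg (Real.rpow_nonneg (norm_nonneg _) _) (hn s z)
      linarith [hb s z hz, hb s w hw]
  have h : ∀ p : Fin d → ℕ, ∃ C : ℝ, 0 ≤ C ∧ (p ∈ Graphs.idx d m →
      ∀ s : StripIdx d N m γ lam Lam M, ∀ z ∈ s.S,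
        ‖s.G.bigU s.A s.F s.u p z‖ ≤ C * R₀ s z) := fun p => by
    by_cases hp : p ∈ Graphs.idx d m
    · choose C hC hb using hU p (mem_idx.1 hp)
      refine ⟨∑ a : Fin N × Fin (d + 1), C a.1 a.2, Finset.sum_nonneg fun a _ => hC _ _,
        fun _ s z hz => ?_⟩
      rw [Finset.sum_mul]
      exact (norm_bigU_le s p z).trans (Finset.sum_le_sum fun a _ => (hb a.1 a.2 s z hz).1)
    · exact ⟨0, le_rfl, fun h => absurd h hp⟩
  choose C hC hb using h
  refine ⟨∑ p ∈ Graphs.idx d m, C p, Finset.sum_nonneg fun p _ => hC p, fun s z hz => ?_⟩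
  rw [Finset.sum_mul]
  exact Finset.sum_le_sum fun p hp => hb p hp s z hz

end TopDerivative

end

end PiecewiseSmooth

end

/-! ### The estimates with a single constant. -/

theorem mainTheorem3 (d N m : ℕ) (hm : 1 ≤ m) (γ : ℝ≥0) (hγ0 : 0 < γ) (hγ : γ ≤ 1 / 4)
    (lam Lam M : ℝ) (hlam : 0 < lam) (hLam : lam ≤ Lam) :
    ∃ c : ℝ, 0 < c ∧
      ∀ (G : PiecewiseSmooth.Graphs d) (A : PiecewiseSmooth.Coeff N (d + 1))
        (F : PiecewiseSmooth.Pt (d + 1) → PiecewiseSmooth.Mat N (d + 1))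
        (u : PiecewiseSmooth.Pt (d + 1) → PiecewiseSmooth.Pt N),
        -- the composite cube
        G.IsCompositeCube 7 →
        (∀ k ∈ G.K, ∀ x' ∈ PiecewiseSmooth.cube d 7, G.φ k x' < G.φ (k + 1) x') →
        (∀ k ∈ G.Kplus, PiecewiseSmooth.MemCHolder (m + 1) γ (PiecewiseSmooth.cube d 7) (G.φ k) ∧
          PiecewiseSmooth.holderENorm (m + 1) γ (PiecewiseSmooth.cube d 7) (G.φ k)
            ≤ ENNReal.ofReal M) →
        (∀ k ∈ G.Kplus, ∀ x' ∈ PiecewiseSmooth.cube d 7,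
          ‖fderiv ℝ (G.φ k) x'‖ ≤ 1 / (20 * ((d + 1 : ℕ) : ℝ))) →
        -- the coefficients
        (∀ k ∈ G.K, ∀ x, ∀ ζ : PiecewiseSmooth.Mat N (d + 1),
          lam * ‖ζ‖ ^ 2 ≤ ∑ i, ∑ j, ∑ α, ∑ β, A k α β i j x * ζ (i, α) * ζ (j, β)) →
        (∀ k ∈ G.K, ∀ α β i j x, |A k α β i j x| ≤ Lam) →
        (∀ k ∈ G.K, ∀ α β i j, PiecewiseSmooth.MemCHolder m γ Set.univ (A k α β i j) ∧
          PiecewiseSmooth.holderENorm m γ Set.univ (A k α β i j) ≤ ENNReal.ofReal M) →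
        -- the data and the solution
        (∀ k ∈ G.K, PiecewiseSmooth.MemCHolder m γ (G.strip 7 k) F) →
        (∀ k ∈ G.K, PiecewiseSmooth.MemCHolder m γ (G.strip 7 k) u) →
        (∀ k ∈ G.K, ContDiffOn ℝ (m + 1 : ℕ) u (G.strip 5 k)) →
        PiecewiseSmooth.IsWeakSolution (PiecewiseSmooth.cube (d + 1) 7) (G.coeff A) F u →
        (∀ z ∈ PiecewiseSmooth.cube (d + 1) 5,
          ‖G.pieceDeriv u (m + 1) z‖ ≤
            c * (G.dataNorm F u m γ +
              ∑ p ∈ PiecewiseSmooth.Graphs.idx d m, ‖G.bigU A F u p z‖) ∧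
          G.dataNorm F u m γ + ∑ p ∈ PiecewiseSmooth.Graphs.idx d m, ‖G.bigU A F u p z‖ ≤
            c * (G.dataNorm F u m γ + ‖G.pieceDeriv u (m + 1) z‖)) ∧
        (∀ k ∈ G.K, ∀ w ∈ G.strip 5 k, ∀ z ∈ G.strip 5 k,
          ‖G.pieceDeriv u (m + 1) w - G.pieceDeriv u (m + 1) z‖ ≤
            c * ∑ p ∈ PiecewiseSmooth.Graphs.idx d m,
                (‖G.bigU A F u p w - G.bigU A F u p z‖ + ‖w - z‖ ^ (γ : ℝ) * ‖G.bigU A F u p z‖)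
              + c * ‖w - z‖ ^ (γ : ℝ) * G.dataNorm F u m γ) := by
  obtain ⟨C₁, hC₁, h₁⟩ := PiecewiseSmooth.top_le_bigU (d := d) (N := N) (Lam := Lam) (M := M)
    hγ0 hγ hm hlam
  obtain ⟨C₂, hC₂, h₂⟩ := PiecewiseSmooth.bigU_le_top (d := d) (N := N) (lam := lam) (Lam := Lam)
    (M := M) hγ0 hγ hm
  -- Both constants are fixed before any data is introduced, which is the required uniformity. The
  -- summand 1 makes c positive and accounts for the term E in the second estimate.
  refine ⟨C₁ + C₂ + 1, by positivity, ?_⟩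
  intro G A F u composite lt holder_φ slope elliptic bounded holder_A holder_F holder_u smooth weak
  let s : PiecewiseSmooth.Setting d N m γ lam Lam M :=
    { G, A, F, u, composite, lt, holder_φ, slope, elliptic, bounded, holder_A, holder_F, holder_u,
      smooth, weak, one_le := hm }
  have hE : 0 ≤ G.dataNorm F u m γ := s.Etot_nonneg
  refine ⟨fun z hz => ?_, fun k hk w hw z hz => ?_⟩
  · obtain ⟨k, hk, hzk⟩ := PiecewiseSmooth.Graphs.exists_strip s.adm (by norm_num) hz
    let t : PiecewiseSmooth.StripIdx d N m γ lam Lam M := { toSetting := s, k, hk }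
    have e₁ : ‖G.pieceDeriv u (m + 1) z‖ ≤ C₁ * (G.dataNorm F u m γ +
        ∑ p ∈ PiecewiseSmooth.Graphs.idx d m, ‖G.bigU A F u p z‖) := (h₁ t z hzk).1
    have e₂ : ∑ p ∈ PiecewiseSmooth.Graphs.idx d m, ‖G.bigU A F u p z‖ ≤
        C₂ * (G.dataNorm F u m γ + ‖G.pieceDeriv u (m + 1) z‖) := h₂ t z hzk
    have hU : 0 ≤ ∑ p ∈ PiecewiseSmooth.Graphs.idx d m, ‖G.bigU A F u p z‖ := t.sumU_nonneg z
    have hD := norm_nonneg (G.pieceDeriv u (m + 1) z)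
    constructor
    · nlinarith
    · nlinarith
  · let t : PiecewiseSmooth.StripIdx d N m γ lam Lam M := { toSetting := s, k, hk }
    refine ((h₁ t z hz).2 w hw).trans ?_
    have hr : 0 ≤ ‖w - z‖ ^ (γ : ℝ) * G.dataNorm F u m γ :=
      mul_nonneg (Real.rpow_nonneg (norm_nonneg _) _) hE
    have hd : 0 ≤ t.diffU w z := Finset.sum_nonneg fun p _ => by positivity
    change C₁ * (t.diffU w z + ‖w - z‖ ^ (γ : ℝ) * G.dataNorm F u m γ) ≤
      (C₁ + C₂ + 1) * t.diffU w z + (C₁ + C₂ + 1) * ‖w - z‖ ^ (γ : ℝ) * G.dataNorm F u m γ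
    nlinarith
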